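/- A knot is a subset $K\subset\mathbb{R}^3$ homeomorphic to a circle, considered up to ambient isotopy; it is trivial if it is ambient isotopic to a round circle. Write $\sigma_1,\dots,\sigma_{n-1}$ for the standard generators of the $n$-strand braid group. An $n$-braid word represents $K$ if its closure is ambient isotopic to $K$, and its length is the number of letters $\sigma_i^{\pm1}$ in it, that is, the number of crossings. Let $br(K)$ be the braid index of $K$, the least number of strands of a braid representing $K$ ($\infty$ if no braid represents $K$). For integers $n\ge br(K)$ let $b_n(K)$ be the minimum length of an $n$-braid word representing $K$, and put $b_n'(K)=b_n(K)-n\in\mathbb{Z}$. The trefoil is the closure of the $2$-braid $\sigma_1^{3}$ or of its mirror image $\sigma_1^{-3}$, and the figure-eight knot is the closure of the $3$-braid $\sigma_1\sigma_2^{-1}\sigma_1\sigma_2^{-1}$. Theorem. Let $K$ be a nontrivial knot. Then $b_n'(K)=1$ for some $n\ge br(K)$ if and only if $K$ is the trefoil (of either handedness) or the figure-eight knot. Hence, if $K$ is neither the trefoil nor the figure-eight knot, then $b_n'(K)\ge 3$ for all $n\ge br(K)$. -/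

import Mathlib

namespace KnotBraid

/-- Three-dimensional space with coordinates `(x, y, z)`. -/
abbrev Space : Type := ℝ × ℝ × ℝ

/-- A knot: a subset of three-space that is an embedded circle. -/
def IsKnot (K : Set Space) : Prop :=
  ∃ f : Circle → Space, Topology.IsEmbedding f ∧ Set.range f = K

/-- `K` and `K'` are ambient isotopic: a continuous family of self-homeomorphisms of
three-space starts at the identity and ends at one that carries `K` onto `K'`. -/
def AmbientIsotopic (K K' : Set Space) : Prop :=
  ∃ H : unitInterval → (Space ≃ₜ Space),
    Continuous (fun p : unitInterval × Space => H p.1 p.2) ∧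
    (∀ p, H 0 p = p) ∧ H 1 '' K = K'

/-- A flat round circle, in the plane `y = 0`. -/
def roundCircle : Set Space := {p | p.1 ^ 2 + p.2.2 ^ 2 = 1 ∧ p.2.1 = 0}

/-- The trivial knot. -/
def IsTrivial (K : Set Space) : Prop := AmbientIsotopic K roundCircle

/-- A braid word on `n` strands. The strand positions are `0, …, n - 1`; the letter
`(i, true)` is the Artin generator exchanging the strands in positions `i` and `i + 1`,
and `(i, false)` is its inverse. The length of the list is the number of crossings. -/
abbrev BraidWord (n : ℕ) : Type := List (Fin (n - 1) × Bool)

/-- A crossing drawn over `[x, x + 1]` between the positions `i` and `i + 1`. The strand from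
position `i + 1` to position `i` is straight, at height `0`; the strand from position `i` to
position `i + 1` passes over it (height `1`) for a generator and under it (height `-1`) for
the inverse of a generator. -/
def crossing (x : ℝ) (i : ℕ) (positive : Bool) : Set Space :=
  segment ℝ ((x, (i : ℝ), 0) : Space)
      (x + 1 / 2, (i : ℝ) + 1 / 2, if positive then 1 else -1) ∪
    segment ℝ ((x + 1 / 2, (i : ℝ) + 1 / 2, if positive then 1 else -1) : Space)
      (x + 1, (i : ℝ) + 1, 0) ∪
    segment ℝ ((x, (i : ℝ) + 1, 0) : Space) (x + 1, (i : ℝ), 0)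

/-- The elementary `n`-braid of one letter, drawn over `[x, x + 1]`: the crossing, and the
remaining strands running straight. -/
def elementaryBraid (n : ℕ) (x : ℝ) (g : Fin (n - 1) × Bool) : Set Space :=
  crossing x (g.1 : ℕ) g.2 ∪
    ⋃ j : {j : Fin n // (j : ℕ) ≠ (g.1 : ℕ) ∧ (j : ℕ) ≠ (g.1 : ℕ) + 1},
      segment ℝ ((x, ((j : Fin n) : ℝ), 0) : Space) (x + 1, ((j : Fin n) : ℝ), 0)

/-- The arc in the plane `y = j` that joins the end `(l, j, 0)` of a braid drawn over `[0, l]`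
to its beginning `(0, j, 0)`, passing below the braid at height `-2`. -/
def closingArc (l j : ℕ) : Set Space :=
  segment ℝ (((l : ℝ), (j : ℝ), 0) : Space) ((l : ℝ) + 1, (j : ℝ), 0) ∪
    segment ℝ (((l : ℝ) + 1, (j : ℝ), 0) : Space) ((l : ℝ) + 1, (j : ℝ), -2) ∪
    segment ℝ (((l : ℝ) + 1, (j : ℝ), -2) : Space) (0, (j : ℝ), -2) ∪
    segment ℝ ((0, (j : ℝ), -2) : Space) (0, (j : ℝ), 0)

/-- The closed braid of a braid word on `n` strands: the letters are drawn one after the other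
over `[0, 1], [1, 2], …`, and the ends are joined by the parallel closing arcs. -/
def closedBraid {n : ℕ} (w : BraidWord n) : Set Space :=
  (⋃ k : Fin w.length, elementaryBraid n ((k : ℕ) : ℝ) (w.get k)) ∪
    ⋃ j : Fin n, closingArc w.length (j : ℕ)

/-- The braid word `w` represents `K`. -/
def Represents {n : ℕ} (w : BraidWord n) (K : Set Space) : Prop :=
  AmbientIsotopic (closedBraid w) K

/-- The braid index: the least number of strands of a braid representing `K`
(it is `⊤` for a set that no braid represents). -/
noncomputable def braidIndex (K : Set Space) : ℕ∞ :=
  ⨅ n ∈ {n : ℕ | ∃ w : BraidWord n, Represents w K}, (n : ℕ∞)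

/-- `b_n(K)`: the minimum length of an `n`-braid representing `K`, meant for
`braidIndex K ≤ n`. -/
noncomputable def minLength (n : ℕ) (K : Set Space) : ℕ :=
  sInf {l : ℕ | ∃ w : BraidWord n, w.length = l ∧ Represents w K}

/-- `b_n'(K) = b_n(K) - n`, as an integer. -/
noncomputable def reducedLength (n : ℕ) (K : Set Space) : ℤ := (minLength n K : ℤ) - (n : ℤ)

/-- The 2-braid `σ₁³` (for `true`) or `σ₁⁻³` (for `false`). -/
def trefoilWord (e : Bool) : BraidWord 2 := [(0, e), (0, e), (0, e)]

/-- The 3-braid `σ₁ σ₂⁻¹ σ₁ σ₂⁻¹`. -/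
def figureEightWord : BraidWord 3 := [(0, true), (1, false), (0, true), (1, false)]

/-- `K` is a trefoil, of either handedness. -/
def IsTrefoil (K : Set Space) : Prop := ∃ e : Bool, AmbientIsotopic K (closedBraid (trefoilWord e))

/-- `K` is the figure-eight knot. -/
def IsFigureEight (K : Set Space) : Prop := AmbientIsotopic K (closedBraid figureEightWord)

end KnotBraid

namespace KnotBraid

open Topology

/-! ### Ambient isotopy -/

/-! Let a word on n strands close to a nontrivial knot. A knot is connected, so the permutation of
the word is transitive on the n positions (`transitive_of_isPreconnected`). Hence each of the n - 1
generators occurs. Every letter is a transposition and an n-cycle has sign (-1)^(n-1), so the length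
has the parity of n - 1 (`Transitive.even_length_add`). The length is therefore n - 1, n + 1 or at
least n + 3. In the first case every generator occurs once, and removing the last strand repeatedly
ends at a round circle (`closureSet_trivial`), which nontriviality excludes.

At length n + 1 two letters are in excess. A first or last generator that occurs only once is
conjugated to the end and removed with its strand; a half turn of space exchanges the two ends.
Otherwise both end generators occur at least twice. On four or more strands this uses up the excess,
so the generator next to the first one occurs once, and some strand closes up on its own
(`not_isConnected_of_count`). What remains is three letters on two strands, or two letters of each
kind on three strands. Cancellation and the braid relation reduce these to the trivial knot, a
trefoil or the figure-eight knot (`isSmall_of_length`). Conversely, the defining words of these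
knots have length n + 1, and the same lower bound makes them minimal. Stabilisation gives a word for
each n from the braid index on, so the minimum is attained.

The moves on closed braids are proved for actual subsets of space. A homeomorphism of bounded
displacement is isotopic to the identity, and moving one vertex of a polygon inside a convex cell is
induced by such a homeomorphism. Cancellation, the positive braid relation, destabilisation and
positive conjugation thus become finite lists of vertex moves with integral coordinates, checked by
`decide` (`isotopicIn_of_carries`). The versions for inverse generators follow algebraically. -/

theorem AmbientIsotopic.refl (K : Set Space) : AmbientIsotopic K K :=
  ⟨fun _ => Homeomorph.refl _, continuous_snd, fun _ => rfl, by simp⟩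

theorem AmbientIsotopic.symm {K K' : Set Space} (h : AmbientIsotopic K K') :
    AmbientIsotopic K' K := by
  obtain ⟨H, hc, h0, h1⟩ := h
  -- Running the isotopy backwards starts at `H 1`, so it is precomposed with the inverse of `H 1`
  -- to start at the identity.
  refine ⟨fun t => (H 1).symm.trans (H (unitInterval.symm t)), ?_, fun p => ?_, ?_⟩
  · have : Continuous (fun p : unitInterval × Space =>
        ((unitInterval.symm p.1, (H 1).symm p.2) : unitInterval × Space)) := by fun_prop
    exact hc.comp this
  · simp
  · rw [← h1, Set.image_image]
    simp [h0]

theorem AmbientIsotopic.trans {K K' K'' : Set Space} (h : AmbientIsotopic K K')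
    (h' : AmbientIsotopic K' K'') : AmbientIsotopic K K'' := by
  obtain ⟨H, hc, h0, h1⟩ := h
  obtain ⟨G, gc, g0, g1⟩ := h'
  refine ⟨fun t => (H t).trans (G t), ?_, fun p => ?_, ?_⟩
  · have : Continuous (fun p : unitInterval × Space =>
        ((p.1, H p.1 p.2) : unitInterval × Space)) := by fun_prop
    exact gc.comp this
  · simp [h0, g0]
  · rw [← g1, ← h1, Set.image_image]
    rfl

/-- The Alexander trick: a homeomorphism that moves all points by a bounded amount is isotopic
to the identity. -/
theorem AmbientIsotopic.of_bounded {K K' : Set Space} (F : Space ≃ₜ Space) (C : ℝ)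
    (hC : ∀ p, ‖F p - p‖ ≤ C) (hK : F '' K = K') : AmbientIsotopic K K' := by
  classical
  have hC0 : 0 ≤ C := (norm_nonneg _).trans (hC 0)
  -- Conjugate `F` by the scaling with factor t. The displacement is then at most t * C, so the
  -- family extends continuously by the identity at t = 0.
  let H : unitInterval → (Space ≃ₜ Space) := fun t =>
    if h : (t : ℝ) = 0 then Homeomorph.refl _ else
      ((Homeomorph.smulOfNeZero (t : ℝ) h).symm.trans F).trans (Homeomorph.smulOfNeZero (t : ℝ) h)
  have hH0 : ∀ t : unitInterval, (t : ℝ) = 0 → ∀ p, H t p = p := by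
    intro t ht p
    have : H t = Homeomorph.refl _ := dif_pos ht
    rw [this]; rfl
  have hH : ∀ t : unitInterval, (t : ℝ) ≠ 0 → ∀ p, H t p = (t : ℝ) • F ((t : ℝ)⁻¹ • p) := by
    intro t ht p
    have : H t = ((Homeomorph.smulOfNeZero (t : ℝ) ht).symm.trans F).trans
        (Homeomorph.smulOfNeZero (t : ℝ) ht) := dif_neg ht
    rw [this]; rfl
  have hb : ∀ (t : unitInterval) p, ‖H t p - p‖ ≤ t * C := by
    intro t p
    by_cases ht : (t : ℝ) = 0
    · simp [hH0 t ht, ht]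
    · rw [hH t ht]
      have : (t : ℝ) • F ((t : ℝ)⁻¹ • p) - p
          = (t : ℝ) • (F ((t : ℝ)⁻¹ • p) - (t : ℝ)⁻¹ • p) := by
        rw [smul_sub, smul_inv_smul₀ ht]
      rw [this, norm_smul, Real.norm_of_nonneg t.2.1]
      exact mul_le_mul_of_nonneg_left (hC _) t.2.1
  refine ⟨H, ?_, fun p => hH0 0 rfl p, ?_⟩
  · rw [continuous_iff_continuousAt]
    rintro ⟨t, p⟩
    by_cases ht : (t : ℝ) = 0
    · have e : H t p = p := hH0 t ht p
      rw [ContinuousAt]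
      simp only [e]
      rw [tendsto_iff_norm_sub_tendsto_zero]
      have hlim : Filter.Tendsto (fun q : unitInterval × Space => (q.1 : ℝ) * C + ‖q.2 - p‖)
          (𝓝 (t, p)) (𝓝 0) := by
        have : Continuous (fun q : unitInterval × Space => (q.1 : ℝ) * C + ‖q.2 - p‖) := by
          fun_prop
        have h := this.tendsto (t, p)
        simpa [ht] using h
      refine squeeze_zero (fun _ => norm_nonneg _) (fun q => ?_) hlim
      calc ‖H q.1 q.2 - p‖ = ‖(H q.1 q.2 - q.2) + (q.2 - p)‖ := by congr 1; abel
        _ ≤ _ := (norm_add_le _ _).trans (add_le_add_left (hb _ _) _)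
    · have hne : ∀ᶠ q : unitInterval × Space in 𝓝 (t, p), (q.1 : ℝ) ≠ 0 := by
        have : Continuous (fun q : unitInterval × Space => (q.1 : ℝ)) := by fun_prop
        exact this.continuousAt.eventually_ne ht
      have hcont : ContinuousAt (fun q : unitInterval × Space =>
          (q.1 : ℝ) • F ((q.1 : ℝ)⁻¹ • q.2)) (t, p) := by
        have h1 : ContinuousAt (fun q : unitInterval × Space => (q.1 : ℝ)) (t, p) := by fun_prop
        have h2 : ContinuousAt (fun q : unitInterval × Space => (q.1 : ℝ)⁻¹) (t, p) :=
          h1.inv₀ ht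
        have h3 : ContinuousAt (fun q : unitInterval × Space => (q.1 : ℝ)⁻¹ • q.2) (t, p) :=
          h2.smul continuousAt_snd
        exact h1.smul (F.continuous.continuousAt.comp h3)
      refine hcont.congr ?_
      filter_upwards [hne] with q hq
      exact (hH q.1 hq q.2).symm
  · rw [← hK]
    have : ∀ p, H 1 p = F p := fun p => by rw [hH 1 (by simp)]; simp
    exact Set.image_congr fun p _ => this p

/-! ### Pushing a point inside a convex open set -/

section Push

variable {U : Set Space}

/-- The gauge of `U` seen from its point `m`. -/
noncomputable def gaugeFrom (U : Set Space) (m p : Space) : ℝ :=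
  gauge ((fun q => q + m) ⁻¹' U) (p - m)

theorem shift_nhds (ho : IsOpen U) {m : Space} (hm : m ∈ U) :
    ((fun q : Space => q + m) ⁻¹' U) ∈ 𝓝 (0 : Space) :=
  (ho.preimage (by fun_prop)).mem_nhds (by simpa using hm)

theorem shift_convex (hc : Convex ℝ U) (m : Space) :
    Convex ℝ ((fun q : Space => q + m) ⁻¹' U) := by
  have := hc.translate_preimage_left m
  simpa [add_comm] using this

theorem continuous_gaugeFrom (ho : IsOpen U) (hc : Convex ℝ U) {m : Space} (hm : m ∈ U) :
    Continuous (gaugeFrom U m) :=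
  (continuous_gauge (shift_convex hc m) (shift_nhds ho hm)).comp (by fun_prop)

theorem gaugeFrom_lt_one (ho : IsOpen U) (hc : Convex ℝ U) {m : Space} (hm : m ∈ U) (p : Space) :
    gaugeFrom U m p < 1 ↔ p ∈ U := by
  rw [gaugeFrom, gauge_lt_one_iff_mem_interior (shift_convex hc m) (shift_nhds ho hm),
    (ho.preimage (by fun_prop)).interior_eq]
  simp

theorem gaugeFrom_eq_one (ho : IsOpen U) (hc : Convex ℝ U) {m : Space} (hm : m ∈ U) (p : Space) :
    gaugeFrom U m p = 1 ↔ p ∈ closure U ∧ p ∉ U := by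
  have h := gauge_le_one_iff_mem_closure (x := p - m) (shift_convex hc m) (shift_nhds ho hm)
  have e : (fun q : Space => q + m) ⁻¹' (closure U) = closure ((fun q : Space => q + m) ⁻¹' U) :=
    (Homeomorph.addRight m).preimage_closure U
  rw [← e] at h
  simp only [Set.mem_preimage, sub_add_cancel] at h
  rw [← h, ← gaugeFrom_lt_one ho hc hm p]
  rw [gaugeFrom]
  constructor
  · intro h; rw [h]; simp
  · rintro ⟨h1, h2⟩; exact le_antisymm h1 (not_lt.1 h2)

theorem gaugeFrom_nonneg (m p : Space) : 0 ≤ gaugeFrom U m p := gauge_nonneg _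

theorem gaugeFrom_line (m u : Space) {s : ℝ} (hs : 0 ≤ s) :
    gaugeFrom U m (m + s • (u - m)) = s * gaugeFrom U m u := by
  rw [gaugeFrom, add_sub_cancel_left, gauge_smul_of_nonneg hs]; rfl

theorem gaugeFrom_eq_zero (ho : IsOpen U) (hb : Bornology.IsBounded U) {m : Space}
    (hm : m ∈ U) (p : Space) : gaugeFrom U m p = 0 ↔ p = m := by
  rw [gaugeFrom, gauge_eq_zero (absorbent_nhds_zero (shift_nhds ho hm)), sub_eq_zero]
  rw [NormedSpace.isVonNBounded_iff]
  have e : (fun q : Space => q + m) ⁻¹' U = (fun q => q + (-m)) '' U := by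
    ext q; simp
  rw [e]
  exact (LipschitzWith.of_dist_le_mul (K := 1) (by simp)).isBounded_image hb

/-- The map that moves `m` to `c` and is linear on the rays from `m` to the frontier of `U`. -/
noncomputable def push (U : Set Space) (m c p : Space) : Space :=
  p + max 0 (1 - gaugeFrom U m p) • (c - m)

theorem continuous_push (ho : IsOpen U) (hc : Convex ℝ U) {m : Space} (hm : m ∈ U) (c : Space) :
    Continuous (push U m c) := by
  have := continuous_gaugeFrom ho hc hm
  unfold push
  fun_prop

theorem push_of_notMem (ho : IsOpen U) (hc : Convex ℝ U) {m : Space} (hm : m ∈ U) (c : Space)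
    {p : Space} (hp : p ∉ U) : push U m c p = p := by
  have := (gaugeFrom_lt_one ho hc hm p).not.2 hp
  rw [push, max_eq_left (by linarith)]; simp

/-- The gauge is linear along the ray from `m` to the frontier point `u`, with value s at parameter
s. The correction (1 - s)(c - m) therefore turns the segment from `m` to `u` affinely into the one
from `c` to `u`. -/
theorem push_line (ho : IsOpen U) (hc : Convex ℝ U) {m : Space} (hm : m ∈ U) (c : Space)
    {u : Space} (hu : u ∈ closure U) (hu' : u ∉ U) {s : ℝ} (hs : 0 ≤ s) (hs1 : s ≤ 1) :
    push U m c (m + s • (u - m)) = c + s • (u - c) := by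
  have h1 := (gaugeFrom_eq_one ho hc hm u).2 ⟨hu, hu'⟩
  rw [push, gaugeFrom_line m u hs, h1, mul_one, max_eq_right (by linarith)]
  module

/-- Every point of `U` other than `m` lies on a segment from `m` to a frontier point. Pushing keeps
the frontier point and the parameter, so pushing back from `c` to `m` undoes it. Boundedness of `U`
makes the gauge vanish only at the centre. -/
theorem push_push (ho : IsOpen U) (hc : Convex ℝ U) (hb : Bornology.IsBounded U) {m c : Space}
    (hm : m ∈ U) (hcU : c ∈ U) (p : Space) : push U c m (push U m c p) = p := by
  by_cases hp : p ∈ U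
  swap
  · rw [push_of_notMem ho hc hm c hp, push_of_notMem ho hc hcU m hp]
  by_cases hpm : p = m
  · subst hpm
    have h0 := (gaugeFrom_eq_zero ho hb hm p).2 rfl
    have h0' := (gaugeFrom_eq_zero ho hb hcU c).2 rfl
    have : push U p c p = c := by rw [push, h0]; simp
    rw [this, push, h0']; simp
  set g := gaugeFrom U m p with hg
  have hg0 : 0 < g := lt_of_le_of_ne (gaugeFrom_nonneg m p)
    (fun h => hpm ((gaugeFrom_eq_zero ho hb hm p).1 h.symm))
  have hg1 : g < 1 := (gaugeFrom_lt_one ho hc hm p).2 hp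
  -- The point at which the ray from `m` through `p` leaves `U`.
  set u := m + g⁻¹ • (p - m) with hu
  have hpu : p = m + g • (u - m) := by
    rw [hu, add_sub_cancel_left, smul_inv_smul₀ hg0.ne']; abel
  have hu1 : gaugeFrom U m u = 1 := by
    rw [hu, gaugeFrom_line m p (inv_nonneg.2 hg0.le), ← hg, inv_mul_cancel₀ hg0.ne']
  obtain ⟨hu2, hu3⟩ := (gaugeFrom_eq_one ho hc hm u).1 hu1
  rw [hpu, push_line ho hc hm c hu2 hu3 hg0.le hg1.le,
    push_line ho hc hcU m hu2 hu3 hg0.le hg1.le]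

/-- Pushing `m` to `c` inside a bounded convex open set, as a homeomorphism. -/
noncomputable def pushHomeomorph (ho : IsOpen U) (hc : Convex ℝ U) (hb : Bornology.IsBounded U)
    {m c : Space} (hm : m ∈ U) (hcU : c ∈ U) : Space ≃ₜ Space where
  toFun := push U m c
  invFun := push U c m
  left_inv := push_push ho hc hb hm hcU
  right_inv := push_push ho hc hb hcU hm
  continuous_toFun := continuous_push ho hc hm c
  continuous_invFun := continuous_push ho hc hcU m

/-- The bound needed for the Alexander trick. -/
theorem norm_push_sub_le (m c p : Space) : ‖push U m c p - p‖ ≤ ‖c - m‖ := by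
  have : max 0 (1 - gaugeFrom U m p) ≤ 1 :=
    max_le zero_le_one (by linarith [gaugeFrom_nonneg (U := U) m p])
  rw [push, add_sub_cancel_left, norm_smul, Real.norm_of_nonneg (le_max_left _ _)]
  exact mul_le_of_le_one_left (norm_nonneg _) this

theorem push_image_segment (ho : IsOpen U) (hc : Convex ℝ U) {m : Space} (hm : m ∈ U) (c : Space)
    {u : Space} (hu : u ∈ closure U) (hu' : u ∉ U) :
    push U m c '' segment ℝ m u = segment ℝ c u := by
  rw [segment_eq_image', segment_eq_image', Set.image_image]
  exact Set.image_congr fun s hs => push_line ho hc hm c hu hu' hs.1 hs.2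

/-- The elementary move of a polygon. The ends `a` and `b` lie on the frontier of the cell `U`, so
they stay fixed together with `R`, and only the vertex between them travels. -/
theorem ambientIsotopic_push (ho : IsOpen U) (hc : Convex ℝ U) (hb : Bornology.IsBounded U)
    {a b m c : Space} (hm : m ∈ U) (hcU : c ∈ U) (ha : a ∈ closure U) (ha' : a ∉ U)
    (hbc : b ∈ closure U) (hb' : b ∉ U) {R : Set Space} (hR : Disjoint R U) :
    AmbientIsotopic (R ∪ (segment ℝ a m ∪ segment ℝ m b))
      (R ∪ (segment ℝ a c ∪ segment ℝ c b)) := by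
  refine AmbientIsotopic.of_bounded (pushHomeomorph ho hc hb hm hcU) ‖c - m‖
    (fun p => norm_push_sub_le m c p) ?_
  rw [Set.image_union, Set.image_union]
  congr 1
  · have : ∀ p ∈ R, push U m c p = p := fun p hp =>
      push_of_notMem ho hc hm c (Set.disjoint_left.1 hR hp)
    exact (Set.image_congr this).trans (Set.image_id' R)
  congr 1
  · rw [segment_symm ℝ a m, segment_symm ℝ a c]
    exact push_image_segment ho hc hm c ha ha'
  · exact push_image_segment ho hc hm c hbc hb'

end Push

/-! ### Moves of polygonal sets with integral vertices -/

/-- `P` can be carried to `Q` in the presence of any set that avoids `B`. -/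
def IsotopicIn (B P Q : Set Space) : Prop :=
  ∀ R : Set Space, Disjoint R B → AmbientIsotopic (R ∪ P) (R ∪ Q)

theorem IsotopicIn.refl (B P : Set Space) : IsotopicIn B P P := fun _ _ => AmbientIsotopic.refl _

theorem IsotopicIn.trans {B P Q S : Set Space} (h : IsotopicIn B P Q) (h' : IsotopicIn B Q S) :
    IsotopicIn B P S := fun R hR => (h R hR).trans (h' R hR)

/-- A point of the lattice `(ℤ/4)³`, scaled by `4`. -/
abbrev LatticePoint : Type := ℤ × ℤ × ℤ

/-- The point of space that a lattice point stands for. -/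
noncomputable def LatticePoint.toSpace (p : LatticePoint) : Space :=
  ((p.1 : ℝ) / 4, (p.2.1 : ℝ) / 4, (p.2.2 : ℝ) / 4)

/-- An integral affine function `α x + β y + γ z + δ` of the scaled coordinates. -/
abbrev AffineForm : Type := ℤ × ℤ × ℤ × ℤ

/-- The value of an affine form at a lattice point. -/
def AffineForm.eval (f : AffineForm) (p : LatticePoint) : ℤ :=
  f.1 * p.1 + f.2.1 * p.2.1 + f.2.2.1 * p.2.2 + f.2.2.2

/-- The value of an affine form at a point of space. -/
def AffineForm.evalAt (f : AffineForm) (p : Space) : ℝ :=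
  f.1 * (4 * p.1) + f.2.1 * (4 * p.2.1) + f.2.2.1 * (4 * p.2.2) + f.2.2.2

theorem AffineForm.evalAt_toSpace (f : AffineForm) (p : LatticePoint) :
    f.evalAt p.toSpace = f.eval p := by
  simp only [evalAt, eval, LatticePoint.toSpace]; push_cast; ring

theorem AffineForm.continuous_evalAt (f : AffineForm) : Continuous f.evalAt := by
  unfold AffineForm.evalAt; fun_prop

theorem AffineForm.evalAt_combo (f : AffineForm) (p q : Space) {s t : ℝ} (h : s + t = 1) :
    f.evalAt (s • p + t • q) = s * f.evalAt p + t * f.evalAt q := by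
  simp only [evalAt, Prod.fst_add, Prod.snd_add, Prod.smul_fst, Prod.smul_snd, smul_eq_mul]
  linear_combination (-(f.2.2.2 : ℝ)) * h

/-- The union of the segments of a list. -/
def polygon (L : List (LatticePoint × LatticePoint)) : Set Space :=
  {p | ∃ s ∈ L, p ∈ segment ℝ s.1.toSpace s.2.toSpace}

theorem polygon_nil : polygon [] = ∅ := by simp [polygon]

theorem polygon_cons (s : LatticePoint × LatticePoint) (L : List (LatticePoint × LatticePoint)) :
    polygon (s :: L) = segment ℝ s.1.toSpace s.2.toSpace ∪ polygon L := by
  ext p; simp [polygon]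

theorem polygon_of_subset {L L' : List (LatticePoint × LatticePoint)}
    (h : ∀ s ∈ L, s ∈ L') (h' : ∀ s ∈ L', s ∈ L) : polygon L = polygon L' := by
  ext p
  exact ⟨fun ⟨s, hs, hp⟩ => ⟨s, h s hs, hp⟩, fun ⟨s, hs, hp⟩ => ⟨s, h' s hs, hp⟩⟩

theorem polygon_erase {s : LatticePoint × LatticePoint}
    {L : List (LatticePoint × LatticePoint)} (h : s ∈ L) :
    polygon L = segment ℝ s.1.toSpace s.2.toSpace ∪ polygon (L.erase s) := by
  rw [← polygon_cons]
  have := List.perm_cons_erase h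
  exact polygon_of_subset (fun t ht => this.mem_iff.1 ht) fun t ht => this.mem_iff.2 ht

/-- A move of a polygonal set: `vertex` carries the two edges `a m`, `m b` to `a c`, `c b`, inside
the convex set where the forms of a zone and some further forms are positive; `split` and `merge`
subdivide an edge. -/
inductive PolygonMove
  | vertex (a m b c : LatticePoint) (zone : ℕ) (forms : List AffineForm)
  | split (a c b : LatticePoint) (k k' : ℕ)
  | merge (a c b : LatticePoint) (k k' : ℕ)

/-- `c` divides the segment from `a` to `b` in the ratio `k' : k`. -/
def divides (a c b : LatticePoint) (k k' : ℕ) : Prop :=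
  0 < k ∧ 0 < k' ∧ k * (c.1 - a.1) = k' * (b.1 - c.1) ∧
    k * (c.2.1 - a.2.1) = k' * (b.2.1 - c.2.1) ∧ k * (c.2.2 - a.2.2) = k' * (b.2.2 - c.2.2)

instance (a c b : LatticePoint) (k k' : ℕ) : Decidable (divides a c b k k') := by
  unfold divides; infer_instance

/-- The condition under which the vertex `m` can be moved to `c`. -/
def canPush (fs : List AffineForm) (a m b c : LatticePoint)
    (rest : List (LatticePoint × LatticePoint)) : Prop :=
  (∀ f ∈ fs, 0 ≤ f.eval a ∧ 0 ≤ f.eval b ∧ 0 < f.eval m ∧ 0 < f.eval c) ∧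
    (∃ f ∈ fs, f.eval a = 0) ∧ (∃ f ∈ fs, f.eval b = 0) ∧
    ∀ s ∈ rest, ∃ f ∈ fs, f.eval s.1 ≤ 0 ∧ f.eval s.2 ≤ 0

instance (fs : List AffineForm) (a m b c : LatticePoint)
    (rest : List (LatticePoint × LatticePoint)) : Decidable (canPush fs a m b c rest) := by
  unfold canPush; infer_instance

/-- The polygon after a move, if the move is admissible in the zones `Z`. -/
def PolygonMove.step (Z : List (List AffineForm)) :
    PolygonMove → List (LatticePoint × LatticePoint) →
      Option (List (LatticePoint × LatticePoint))
  | .vertex a m b c i fs, L =>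
    match Z[i]? with
    | none => none
    | some z =>
      if (a, m) ∈ L ∧ (m, b) ∈ L.erase (a, m) ∧
          canPush (z ++ fs) a m b c ((L.erase (a, m)).erase (m, b)) then
        some ((a, c) :: (c, b) :: (L.erase (a, m)).erase (m, b))
      else none
  | .split a c b k k', L =>
    if (a, b) ∈ L ∧ divides a c b k k' then some ((a, c) :: (c, b) :: L.erase (a, b)) else none
  | .merge a c b k k', L =>
    if (a, c) ∈ L ∧ (c, b) ∈ L.erase (a, c) ∧ divides a c b k k' then
      some ((a, b) :: (L.erase (a, c)).erase (c, b))
    else none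

/-- Whether a sequence of admissible moves carries the polygon `L` to `L'`. -/
def carries (Z : List (List AffineForm)) : List PolygonMove →
    List (LatticePoint × LatticePoint) → List (LatticePoint × LatticePoint) → Bool
  | [], L, L' => decide ((∀ s ∈ L, s ∈ L') ∧ ∀ s ∈ L', s ∈ L)
  | m :: ms, L, L' =>
    match m.step Z L with
    | none => false
    | some L₁ => carries Z ms L₁ L'

/-- The union of the zones. -/
def region (Z : List (List AffineForm)) : Set Space :=
  {p | ∃ z ∈ Z, ∀ f ∈ z, 0 < AffineForm.evalAt f p}

/-- Subdividing an edge does not change the set: `c` is the point at parameter k' / (k + k'). -/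
theorem segment_of_divides {a c b : LatticePoint} {k k' : ℕ} (h : divides a c b k k') :
    segment ℝ a.toSpace b.toSpace
      = segment ℝ a.toSpace c.toSpace ∪ segment ℝ c.toSpace b.toSpace := by
  obtain ⟨hk, hk', h1, h2, h3⟩ := h
  have hkr : (0 : ℝ) < k := by exact_mod_cast hk
  have hkr' : (0 : ℝ) < k' := by exact_mod_cast hk'
  have hs : (0 : ℝ) < k + k' := by positivity
  have hc : c.toSpace = AffineMap.lineMap a.toSpace b.toSpace ((k' : ℝ) / (k + k')) := by
    rw [AffineMap.lineMap_apply_module']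
    have e1 : (k : ℝ) * (c.1 - a.1) = k' * (b.1 - c.1) := by exact_mod_cast h1
    have e2 : (k : ℝ) * (c.2.1 - a.2.1) = k' * (b.2.1 - c.2.1) := by exact_mod_cast h2
    have e3 : (k : ℝ) * (c.2.2 - a.2.2) = k' * (b.2.2 - c.2.2) := by exact_mod_cast h3
    refine Prod.ext ?_ (Prod.ext ?_ ?_) <;>
      simp only [LatticePoint.toSpace, Prod.fst_add, Prod.snd_add, Prod.smul_fst, Prod.smul_snd,
        Prod.fst_sub, Prod.snd_sub, smul_eq_mul] <;> field_simp <;> linarith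
  rw [hc]
  set t : ℝ := (k' : ℝ) / (k + k') with ht
  have ht0 : 0 ≤ t := by positivity
  have ht1 : t ≤ 1 := by rw [ht, div_le_one hs]; linarith
  rw [segment_eq_image_lineMap, segment_eq_image_lineMap, segment_eq_image_lineMap]
  ext p
  simp only [Set.mem_image, Set.mem_union, Set.mem_Icc]
  constructor
  · rintro ⟨s, ⟨hs0, hs1⟩, rfl⟩
    rcases le_or_gt s t with hst | hst
    · left
      have htp : 0 < t := by rw [ht]; positivity
      refine ⟨s / t, ⟨by positivity, (div_le_one htp).2 hst⟩, ?_⟩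
      rw [AffineMap.lineMap_lineMap_right, mul_comm, mul_div_cancel₀ _ htp.ne']
    · right
      have htp : 0 < 1 - t := by linarith
      refine ⟨(s - t) / (1 - t), ⟨div_nonneg (by linarith) htp.le,
        (div_le_one htp).2 (by linarith)⟩, ?_⟩
      rw [AffineMap.lineMap_lineMap_left]
      congr 1
      field_simp
      ring
  · rintro (⟨s, ⟨hs0, hs1⟩, rfl⟩ | ⟨s, ⟨hs0, hs1⟩, rfl⟩)
    · exact ⟨t * s, ⟨by positivity, by nlinarith⟩, by
        rw [AffineMap.lineMap_lineMap_right, mul_comm]⟩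
    · refine ⟨1 - (1 - s) * (1 - t), ⟨by nlinarith, by nlinarith⟩, ?_⟩
      rw [AffineMap.lineMap_lineMap_left]

/-- Forms that are nonnegative at `a` and positive at `m` are positive on the open segment between
them, and `a` is a limit of that segment. -/
theorem mem_closure_of_forms {fs : List AffineForm} {a m : Space} {ρ : ℝ}
    (ha : ∀ f ∈ fs, 0 ≤ AffineForm.evalAt f a) (hm : ∀ f ∈ fs, 0 < AffineForm.evalAt f m)
    (haρ : a ∈ Metric.ball (0 : Space) ρ) (hmρ : m ∈ Metric.ball (0 : Space) ρ) :
    a ∈ closure ({p | ∀ f ∈ fs, 0 < AffineForm.evalAt f p} ∩ Metric.ball 0 ρ) := by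
  have h1 : openSegment ℝ a m ⊆ {p | ∀ f ∈ fs, 0 < AffineForm.evalAt f p} ∩ Metric.ball 0 ρ := by
    intro p hp
    refine ⟨fun f hf => ?_, (convex_ball (0 : Space) ρ).openSegment_subset haρ hmρ hp⟩
    obtain ⟨s, t, hs, ht, hst, rfl⟩ := hp
    rw [f.evalAt_combo _ _ hst]
    have := ha f hf
    have := hm f hf
    positivity
  exact closure_mono h1 (by rw [closure_openSegment]; exact left_mem_segment ℝ a m)

/-- The cell is the open polyhedron where all forms are positive, cut off by a ball to make it
bounded. A form vanishing at `a`, and one at `b`, puts these points outside the cell. Each remaining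
edge is kept out by a single form that is nonpositive at both of its ends, and `R` is kept out by
the forms of the zone. -/
theorem isotopicIn_push {Z : List (List AffineForm)} {z fs : List AffineForm} (hz : z ∈ Z)
    {a m b c : LatticePoint} {rest : List (LatticePoint × LatticePoint)}
    (h : canPush (z ++ fs) a m b c rest) :
    IsotopicIn (region Z)
      (segment ℝ a.toSpace m.toSpace ∪ (segment ℝ m.toSpace b.toSpace ∪ polygon rest))
      (segment ℝ a.toSpace c.toSpace ∪ (segment ℝ c.toSpace b.toSpace ∪ polygon rest)) := by
  intro R hR
  obtain ⟨h1, ⟨f, hf, hfa⟩, ⟨g, hg, hgb⟩, hrest⟩ := h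
  set V : Set Space := {p | ∀ f ∈ z ++ fs, 0 < AffineForm.evalAt f p} with hV
  obtain ⟨ρ, hρ⟩ : ∃ ρ : ℝ, ‖a.toSpace‖ < ρ ∧ ‖m.toSpace‖ < ρ ∧ ‖b.toSpace‖ < ρ ∧
      ‖c.toSpace‖ < ρ :=
    ⟨‖a.toSpace‖ + ‖m.toSpace‖ + ‖b.toSpace‖ + ‖c.toSpace‖ + 1, by
      have := norm_nonneg a.toSpace
      have := norm_nonneg m.toSpace
      have := norm_nonneg b.toSpace
      have := norm_nonneg c.toSpace
      refine ⟨?_, ?_, ?_, ?_⟩ <;> linarith⟩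
  obtain ⟨ra, rm, rb, rc⟩ := hρ
  have key : ∀ q : LatticePoint, ‖q.toSpace‖ < ρ → q.toSpace ∈ Metric.ball (0 : Space) ρ :=
    fun q hq => by simpa using hq
  have ho : IsOpen (V ∩ Metric.ball 0 ρ) := by
    refine IsOpen.inter ?_ Metric.isOpen_ball
    have : V = ⋂ f ∈ (z ++ fs).toFinset, {p | 0 < AffineForm.evalAt f p} := by
      ext p; simp [hV]
    rw [this]
    exact isOpen_biInter_finset fun f _ => isOpen_lt continuous_const f.continuous_evalAt
  have hc : Convex ℝ (V ∩ Metric.ball 0 ρ) := by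
    refine Convex.inter ?_ (convex_ball _ _)
    intro p hp q hq s t hs ht hst f hf
    rw [f.evalAt_combo _ _ hst]
    have h1 := hp f hf
    have h2 := hq f hf
    rcases hs.eq_or_lt with rfl | hs
    · have : t = 1 := by linarith
      subst this; simpa using h2
    · positivity
  have hb : Bornology.IsBounded (V ∩ Metric.ball 0 ρ) :=
    Metric.isBounded_ball.subset Set.inter_subset_right
  have pos : ∀ q : LatticePoint, (∀ f ∈ z ++ fs, 0 < AffineForm.eval f q) → q.toSpace ∈ V :=
    fun q hq f hf => by rw [f.evalAt_toSpace]; exact_mod_cast hq f hf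
  have nonneg : ∀ q : LatticePoint, (∀ f ∈ z ++ fs, 0 ≤ AffineForm.eval f q) →
      ∀ f ∈ z ++ fs, 0 ≤ AffineForm.evalAt f q.toSpace :=
    fun q hq f hf => by rw [f.evalAt_toSpace]; exact_mod_cast hq f hf
  have hm := pos m fun f hf => (h1 f hf).2.2.1
  have hcV := pos c fun f hf => (h1 f hf).2.2.2
  have hRU : Disjoint (R ∪ polygon rest) (V ∩ Metric.ball 0 ρ) := by
    rw [Set.disjoint_left]
    rintro p (hp | ⟨s, hs, hp⟩) ⟨hpV, -⟩
    · exact Set.disjoint_left.1 hR hp ⟨z, hz, fun f hf => hpV f (List.mem_append_left _ hf)⟩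
    · obtain ⟨f, hf, hf1, hf2⟩ := hrest s hs
      have := hpV f hf
      obtain ⟨u, v, hu, hv, huv, rfl⟩ := hp
      rw [f.evalAt_combo _ _ huv, f.evalAt_toSpace, f.evalAt_toSpace] at this
      have e1 : ((f.eval s.1 : ℤ) : ℝ) ≤ 0 := by exact_mod_cast hf1
      have e2 : ((f.eval s.2 : ℤ) : ℝ) ≤ 0 := by exact_mod_cast hf2
      have := mul_nonpos_of_nonneg_of_nonpos hu e1
      have := mul_nonpos_of_nonneg_of_nonpos hv e2
      linarith
  have := ambientIsotopic_push ho hc hb (a := a.toSpace) (b := b.toSpace)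
    ⟨hm, key m rm⟩ ⟨hcV, key c rc⟩
    (mem_closure_of_forms (nonneg a fun f hf => (h1 f hf).1) hm (key a ra) (key m rm))
    (fun ⟨h, _⟩ => by have := h f hf; rw [f.evalAt_toSpace, hfa] at this; simp at this)
    (mem_closure_of_forms (nonneg b fun f hf => (h1 f hf).2.1) hm (key b rb) (key m rm))
    (fun ⟨h, _⟩ => by have := h g hg; rw [g.evalAt_toSpace, hgb] at this; simp at this) hRU
  have e : ∀ X Y : Set Space, R ∪ (X ∪ (Y ∪ polygon rest)) = R ∪ polygon rest ∪ (X ∪ Y) := by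
    intro X Y; ext p; simp only [Set.mem_union]; tauto
  rw [e, e]
  exact this

theorem PolygonMove.isotopicIn {Z : List (List AffineForm)} (m : PolygonMove)
    {L L' : List (LatticePoint × LatticePoint)} (h : m.step Z L = some L') :
    IsotopicIn (region Z) (polygon L) (polygon L') := by
  cases m with
  | vertex a m b c i fs =>
    simp only [step] at h
    split at h
    · simp at h
    · rename_i z hz
      split_ifs at h with hh
      obtain ⟨h1, h2, h3⟩ := hh
      obtain rfl := Option.some.inj h
      rw [polygon_erase h1, polygon_erase h2, polygon_cons, polygon_cons]
      exact isotopicIn_push (List.mem_of_getElem? hz) h3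
  | split a c b k k' =>
    simp only [step] at h
    split_ifs at h with hh
    obtain ⟨h1, h2⟩ := hh
    obtain rfl := Option.some.inj h
    rw [polygon_erase h1, polygon_cons, polygon_cons, segment_of_divides h2, Set.union_assoc]
    exact IsotopicIn.refl _ _
  | merge a c b k k' =>
    simp only [step] at h
    split_ifs at h with hh
    obtain ⟨h1, h2, h3⟩ := hh
    obtain rfl := Option.some.inj h
    rw [polygon_erase h1, polygon_erase h2, polygon_cons, segment_of_divides h3, Set.union_assoc]
    exact IsotopicIn.refl _ _

/-- Soundness of the checker: an integer computation yields an isotopy that leaves everything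
outside the zones in place. -/
theorem isotopicIn_of_carries {Z : List (List AffineForm)} {ms : List PolygonMove}
    {L L' : List (LatticePoint × LatticePoint)} (h : carries Z ms L L' = true) :
    IsotopicIn (region Z) (polygon L) (polygon L') := by
  induction ms generalizing L with
  | nil =>
    simp only [carries, decide_eq_true_eq] at h
    rw [polygon_of_subset h.1 h.2]
    exact IsotopicIn.refl _ _
  | cons m ms ih =>
    simp only [carries] at h
    split at h
    · simp at h
    · rename_i L₁ hL
      exact (m.isotopicIn hL).trans (ih h)

/-! ### Homeomorphisms of space that act on one coordinate -/

/-- Ambient isotopy may be checked after a homeomorphism of space. -/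
theorem AmbientIsotopic.image {K K' : Set Space} (Φ : Space ≃ₜ Space) (h : AmbientIsotopic K K') :
    AmbientIsotopic (Φ '' K) (Φ '' K') := by
  obtain ⟨H, hc, h0, h1⟩ := h
  refine ⟨fun t => (Φ.symm.trans (H t)).trans Φ, ?_, fun p => by simp [h0], ?_⟩
  · have : Continuous (fun p : unitInterval × Space =>
        ((p.1, Φ.symm p.2) : unitInterval × Space)) := by fun_prop
    exact Φ.continuous.comp (hc.comp this)
  · rw [← h1, Set.image_image, Set.image_image]
    simp

/-- Allows a word of any length to be compressed into a slab of fixed width before a local move is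
compared. -/
theorem AmbientIsotopic.of_image {K K' : Set Space} (Φ : Space ≃ₜ Space)
    (h : AmbientIsotopic (Φ '' K) (Φ '' K')) : AmbientIsotopic K K' := by
  have := h.image Φ.symm
  simpa [Set.image_image] using this

/-- Translation by `v`. -/
noncomputable def translation (v : Space) : Space ≃ₜ Space := Homeomorph.addLeft v

@[simp] theorem translation_apply (v p : Space) : translation v p = v + p := rfl

theorem ambientIsotopic_translation (v : Space) (K : Set Space) :
    AmbientIsotopic K (translation v '' K) :=
  AmbientIsotopic.of_bounded (translation v) ‖v‖ (fun p => by simp) rfl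

theorem translation_image_segment (v a b : Space) :
    translation v '' segment ℝ a b = segment ℝ (v + a) (v + b) :=
  segment_translate_image ℝ v a b

/-- The homeomorphism of the line that stretches `[p, p + w]` to `[p, p + w']`. -/
noncomputable def stretch (p w w' x : ℝ) : ℝ := x + (w' / w - 1) * max 0 (min (x - p) w)

theorem stretch_of_le {p w w' x : ℝ} (hx : x ≤ p) : stretch p w w' x = x := by
  rw [stretch, max_eq_left ((min_le_left _ _).trans (by linarith))]; ring

theorem stretch_of_mem {p w w' x : ℝ} (hx : p ≤ x) (hx' : x ≤ p + w) :
    stretch p w w' x = p + w' / w * (x - p) := by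
  rw [stretch, min_eq_left (by linarith), max_eq_right (by linarith)]; ring

theorem stretch_of_ge {p w w' x : ℝ} (hw : 0 < w) (hx : p + w ≤ x) :
    stretch p w w' x = x + (w' - w) := by
  rw [stretch, min_eq_right (by linarith), max_eq_right hw.le]; field_simp

theorem stretch_stretch {p w w' : ℝ} (hw : 0 < w) (hw' : 0 < w') (x : ℝ) :
    stretch p w' w (stretch p w w' x) = x := by
  rcases le_total x p with h | h
  · rw [stretch_of_le h, stretch_of_le h]
  rcases le_total x (p + w) with h' | h'
  · have h0 : 0 ≤ w' / w * (x - p) := mul_nonneg (by positivity) (by linarith)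
    have h1 : w' / w * (x - p) ≤ w' := by
      rw [div_mul_eq_mul_div, div_le_iff₀ hw]; nlinarith
    rw [stretch_of_mem h h', stretch_of_mem (by linarith) (by linarith)]
    field_simp
    ring
  · rw [stretch_of_ge hw h', stretch_of_ge hw' (by linarith)]
    ring

/-- `stretch` on the first coordinate of space. -/
noncomputable def stretchHomeomorph (p w w' : ℝ) (hw : 0 < w) (hw' : 0 < w') : Space ≃ₜ Space where
  toFun q := (stretch p w w' q.1, q.2)
  invFun q := (stretch p w' w q.1, q.2)
  left_inv q := by simp [stretch_stretch hw hw']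
  right_inv q := by simp [stretch_stretch hw' hw]
  continuous_toFun := by unfold stretch; fun_prop
  continuous_invFun := by unfold stretch; fun_prop

@[simp] theorem stretchHomeomorph_apply (p w w' : ℝ) (hw : 0 < w) (hw' : 0 < w') (q : Space) :
    stretchHomeomorph p w w' hw hw' q = (stretch p w w' q.1, q.2) := rfl

/-- Points beyond the slab are only translated by w' - w, so the displacement is bounded and the
Alexander trick applies. -/
theorem ambientIsotopic_stretch (p w w' : ℝ) (hw : 0 < w) (hw' : 0 < w') (K : Set Space) :
    AmbientIsotopic K ((stretchHomeomorph p w w' hw hw') '' K) := by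
  refine AmbientIsotopic.of_bounded _ (|w' / w - 1| * w) (fun q => ?_) rfl
  have h0 : 0 ≤ max 0 (min (q.1 - p) w) := le_max_left _ _
  have h1 : max 0 (min (q.1 - p) w) ≤ w := max_le hw.le (min_le_right _ _)
  have : stretchHomeomorph p w w' hw hw' q - q
      = (((w' / w - 1) * max 0 (min (q.1 - p) w), 0, 0) : Space) := by
    refine Prod.ext ?_ (Prod.ext ?_ ?_) <;> simp [stretch]
  rw [this]
  simp only [Prod.norm_def, norm_zero, max_self, Real.norm_eq_abs, abs_mul, abs_of_nonneg h0]
  exact max_le (mul_le_mul_of_nonneg_left h1 (abs_nonneg _)) (by positivity)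

theorem image_segment_of_combo {Φ : Space → Space} {u v : Space}
    (h : ∀ s t : ℝ, 0 ≤ s → 0 ≤ t → s + t = 1 → Φ (s • u + t • v) = s • Φ u + t • Φ v) :
    Φ '' segment ℝ u v = segment ℝ (Φ u) (Φ v) := by
  ext p
  constructor
  · rintro ⟨q, ⟨s, t, hs, ht, hst, rfl⟩, rfl⟩
    exact ⟨s, t, hs, ht, hst, (h s t hs ht hst).symm⟩
  · rintro ⟨s, t, hs, ht, hst, rfl⟩
    exact ⟨_, ⟨s, t, hs, ht, hst, rfl⟩, h s t hs ht hst⟩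

theorem stretch_image_segment_of_mem {p w w' : ℝ} (hw : 0 < w) (hw' : 0 < w') {u v : Space}
    (hu : p ≤ u.1) (hu' : u.1 ≤ p + w) (hv : p ≤ v.1) (hv' : v.1 ≤ p + w) :
    (stretchHomeomorph p w w' hw hw') '' segment ℝ u v
      = segment ℝ (p + w' / w * (u.1 - p), u.2) (p + w' / w * (v.1 - p), v.2) := by
  have e1 : stretchHomeomorph p w w' hw hw' u = (p + w' / w * (u.1 - p), u.2) := by
    simp [stretch_of_mem hu hu']
  have e2 : stretchHomeomorph p w w' hw hw' v = (p + w' / w * (v.1 - p), v.2) := by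
    simp [stretch_of_mem hv hv']
  rw [image_segment_of_combo, e1, e2]
  intro s t hs ht hst
  rw [e1, e2]
  have h1 : (s • u + t • v).1 = s * u.1 + t * v.1 := rfl
  have h2 : p ≤ s * u.1 + t * v.1 := by
    linear_combination mul_nonneg hs (sub_nonneg.2 hu) + mul_nonneg ht (sub_nonneg.2 hv) - p * hst
  have h3 : s * u.1 + t * v.1 ≤ p + w := by
    linear_combination mul_nonneg hs (sub_nonneg.2 hu') + mul_nonneg ht (sub_nonneg.2 hv')
      + (p + w) * hst
  refine Prod.ext ?_ ?_
  · rw [stretchHomeomorph_apply, h1, stretch_of_mem h2 h3]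
    simp only [Prod.smul_mk, Prod.mk_add_mk, smul_eq_mul]
    linear_combination (p - w' / w * p) * hst.symm
  · simp

theorem stretch_monotone {p w w' : ℝ} (hw : 0 < w) (hw' : 0 < w') :
    Monotone (stretch p w w') := by
  intro x y hxy
  rcases le_total y p with h1 | h1
  · rwa [stretch_of_le h1, stretch_of_le (hxy.trans h1)]
  have hy : p ≤ stretch p w w' y := by
    rcases le_total y (p + w) with h2 | h2
    · rw [stretch_of_mem h1 h2]
      have : 0 ≤ w' / w * (y - p) := mul_nonneg (by positivity) (by linarith)
      linarith
    · rw [stretch_of_ge hw h2]; linarith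
  rcases le_total x p with h3 | h3
  · rw [stretch_of_le h3]; linarith
  rcases le_total x (p + w) with h4 | h4
  · rw [stretch_of_mem h3 h4]
    have hww : 0 < w' / w := by positivity
    rcases le_total y (p + w) with h2 | h2
    · rw [stretch_of_mem h1 h2]
      nlinarith
    · rw [stretch_of_ge hw h2]
      have : w' / w * (x - p) ≤ w' := by
        rw [div_mul_eq_mul_div, div_le_iff₀ hw]; nlinarith
      linarith
  · rw [stretch_of_ge hw h4, stretch_of_ge hw (h4.trans hxy)]; linarith

theorem mem_segment_parallel {x x' : ℝ} (h : x ≤ x') (y : ℝ × ℝ) (p : Space) :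
    p ∈ segment ℝ ((x, y) : Space) (x', y) ↔ x ≤ p.1 ∧ p.1 ≤ x' ∧ p.2 = y := by
  constructor
  · rintro ⟨s, t, hs, ht, hst, rfl⟩
    refine ⟨?_, ?_, ?_⟩
    · simp only [Prod.smul_mk, Prod.mk_add_mk, smul_eq_mul]
      linear_combination mul_nonneg ht (sub_nonneg.2 h) - x * hst
    · simp only [Prod.smul_mk, Prod.mk_add_mk, smul_eq_mul]
      linear_combination mul_nonneg hs (sub_nonneg.2 h) + x' * hst
    · simp [← add_smul, hst]
  · rintro ⟨h1, h2, h3⟩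
    have : p.1 ∈ segment ℝ x x' := by rw [segment_eq_Icc h]; exact ⟨h1, h2⟩
    obtain ⟨s, t, hs, ht, hst, e⟩ := this
    refine ⟨s, t, hs, ht, hst, ?_⟩
    refine Prod.ext (by simpa using e) ?_
    simp [← add_smul, hst, h3]

/-- For a segment parallel to the first axis monotonicity is enough, so it may cross the ends of the
slab; a sloped segment has to stay where the stretch is affine. -/
theorem stretch_image_segment_parallel {p w w' : ℝ} (hw : 0 < w) (hw' : 0 < w') {x x' : ℝ}
    (h : x ≤ x') (y : ℝ × ℝ) :
    (stretchHomeomorph p w w' hw hw') '' segment ℝ ((x, y) : Space) (x', y)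
      = segment ℝ (stretch p w w' x, y) (stretch p w w' x', y) := by
  ext q
  rw [mem_segment_parallel (stretch_monotone hw hw' h)]
  constructor
  · rintro ⟨r, hr, rfl⟩
    obtain ⟨h1, h2, h3⟩ := (mem_segment_parallel h y r).1 hr
    exact ⟨stretch_monotone hw hw' h1, stretch_monotone hw hw' h2, h3⟩
  · rintro ⟨h1, h2, h3⟩
    refine ⟨(stretch p w' w q.1, q.2), (mem_segment_parallel h y _).2 ⟨?_, ?_, h3⟩, ?_⟩
    · rw [← stretch_stretch (p := p) hw hw' x]; exact stretch_monotone hw' hw h1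
    · rw [← stretch_stretch (p := p) hw hw' x']; exact stretch_monotone hw' hw h2
    · simp [stretch_stretch hw' hw]

theorem stretch_image_of_le {p w w' : ℝ} (hw : 0 < w) (hw' : 0 < w') {S : Set Space}
    (hS : ∀ q ∈ S, q.1 ≤ p) : (stretchHomeomorph p w w' hw hw') '' S = S := by
  have : ∀ q ∈ S, stretchHomeomorph p w w' hw hw' q = q := fun q hq => by
    simp [stretch_of_le (hS q hq)]
  exact (Set.image_congr this).trans (Set.image_id' S)

theorem stretch_image_of_ge {p w w' : ℝ} (hw : 0 < w) (hw' : 0 < w') {S : Set Space}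
    (hS : ∀ q ∈ S, p + w ≤ q.1) :
    (stretchHomeomorph p w w' hw hw') '' S = translation (w' - w, 0, 0) '' S := by
  refine Set.image_congr fun q hq => ?_
  refine Prod.ext ?_ ?_
  · simp [stretch_of_ge hw (hS q hq)]; ring
  · simp

/-! ### Drawings of braid words and their closures -/

/-- The straight strands over `[x, x']` at the positions in `J`. -/
def strandsOn (J : Set ℕ) (x x' : ℝ) : Set Space :=
  {p | ∃ j ∈ J, p ∈ segment ℝ ((x, (j : ℝ), 0) : Space) (x', (j : ℝ), 0)}

/-- The closing arcs between `x = b` and `x = a` at the positions in `J`. -/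
def arcsOn (J : Set ℕ) (a b : ℝ) : Set Space :=
  {p | ∃ j ∈ J, p ∈ segment ℝ ((b, (j : ℝ), 0) : Space) (b, (j : ℝ), -2) ∪
    segment ℝ ((b, (j : ℝ), -2) : Space) (a, (j : ℝ), -2) ∪
    segment ℝ ((a, (j : ℝ), -2) : Space) (a, (j : ℝ), 0)}

/-- The positions that a crossing between `i` and `i + 1` leaves alone. -/
def others (n i : ℕ) : Set ℕ := {j | j < n ∧ j ≠ i ∧ j ≠ i + 1}

/-- A letter with natural number index, drawn over `[x, x + 1]` on `n` strands. -/
def letterSet (n : ℕ) (x : ℝ) (g : ℕ × Bool) : Set Space :=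
  crossing x g.1 g.2 ∪ strandsOn (others n g.1) x (x + 1)

/-- A word drawn from `x` on. -/
def draw (n : ℕ) : ℝ → List (ℕ × Bool) → Set Space
  | _, [] => ∅
  | x, g :: w => letterSet n x g ∪ draw n (x + 1) w

/-- The closure of a word drawn from `x` on, with closing arcs between `a` and `b`. -/
def braidClosure (n : ℕ) (a x : ℝ) (w : List (ℕ × Bool)) (b : ℝ) : Set Space :=
  strandsOn {j | j < n} a x ∪ draw n x w ∪ strandsOn {j | j < n} (x + w.length) b ∪
    arcsOn {j | j < n} a b

/-- A word all of whose letters are meaningful on `n` strands. -/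
def Valid (n : ℕ) (w : List (ℕ × Bool)) : Prop := ∀ g ∈ w, g.1 + 1 < n

theorem mem_strandsOn {J : Set ℕ} {x x' : ℝ} (h : x ≤ x') {p : Space} :
    p ∈ strandsOn J x x' ↔ ∃ j ∈ J, x ≤ p.1 ∧ p.1 ≤ x' ∧ p.2 = ((j : ℝ), 0) := by
  simp only [strandsOn, Set.mem_ofPred_eq, mem_segment_parallel h]

theorem strandsOn_trans (J : Set ℕ) {x x' x'' : ℝ} (h : x ≤ x') (h' : x' ≤ x'') :
    strandsOn J x x' ∪ strandsOn J x' x'' = strandsOn J x x'' := by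
  ext p
  simp only [Set.mem_union, mem_strandsOn h, mem_strandsOn h', mem_strandsOn (h.trans h')]
  constructor
  · rintro (⟨j, hj, h1, h2, h3⟩ | ⟨j, hj, h1, h2, h3⟩)
    · exact ⟨j, hj, h1, h2.trans h', h3⟩
    · exact ⟨j, hj, h.trans h1, h2, h3⟩
  · rintro ⟨j, hj, h1, h2, h3⟩
    rcases le_total p.1 x' with h4 | h4
    · exact Or.inl ⟨j, hj, h1, h4, h3⟩
    · exact Or.inr ⟨j, hj, h4, h2, h3⟩

theorem strandsOn_union (J J' : Set ℕ) (x x' : ℝ) :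
    strandsOn (J ∪ J') x x' = strandsOn J x x' ∪ strandsOn J' x x' := by
  ext p; simp [strandsOn, or_and_right, exists_or]

theorem arcsOn_union (J J' : Set ℕ) (a b : ℝ) :
    arcsOn (J ∪ J') a b = arcsOn J a b ∪ arcsOn J' a b := by
  ext p; simp only [arcsOn, Set.mem_ofPred_eq, Set.mem_union, or_and_right, exists_or]

/-- A margin of width zero contributes only points that already lie on the closing arcs. -/
theorem strandsOn_self_subset (J : Set ℕ) (a b : ℝ) : strandsOn J a a ⊆ arcsOn J a b := by
  rintro p ⟨j, hj, hp⟩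
  refine ⟨j, hj, Or.inr ?_⟩
  rw [segment_same, Set.mem_singleton_iff] at hp
  rw [hp]; exact right_mem_segment _ _ _

theorem lt_eq_others_union {n i : ℕ} (h : i + 1 < n) :
    {j | j < n} = others n i ∪ {i, i + 1} := by
  ext j; simp only [others, Set.mem_ofPred_eq, Set.mem_union, Set.mem_insert_iff,
    Set.mem_singleton_iff]; omega

theorem draw_append (n : ℕ) (x : ℝ) (u v : List (ℕ × Bool)) :
    draw n x (u ++ v) = draw n x u ∪ draw n (x + u.length) v := by
  induction u generalizing x with
  | nil => simp [draw]
  | cons g u ih =>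
    simp only [List.cons_append, draw, ih, Set.union_assoc, List.length_cons]
    push_cast
    rw [add_assoc, add_comm (1 : ℝ)]

theorem crossing_bounds {x : ℝ} {i : ℕ} {e : Bool} {p : Space} (hp : p ∈ crossing x i e) :
    x ≤ p.1 ∧ p.1 ≤ x + 1 ∧ (i : ℝ) ≤ p.2.1 ∧ p.2.1 ≤ i + 1 ∧ -1 ≤ p.2.2 ∧ p.2.2 ≤ 1 := by
  have hc : Convex ℝ (Set.Icc x (x + 1) ×ˢ (Set.Icc (i : ℝ) (i + 1) ×ˢ Set.Icc (-1 : ℝ) 1)) :=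
    (convex_Icc _ _).prod ((convex_Icc _ _).prod (convex_Icc _ _))
  have key : crossing x i e ⊆
      Set.Icc x (x + 1) ×ˢ (Set.Icc (i : ℝ) (i + 1) ×ˢ Set.Icc (-1 : ℝ) 1) := by
    refine Set.union_subset (Set.union_subset ?_ ?_) ?_ <;>
      refine hc.segment_subset ?_ ?_ <;> cases e <;>
      simp only [Set.mem_prod, Set.mem_Icc] <;> norm_num
  have := key hp
  simp only [Set.mem_prod, Set.mem_Icc] at this
  tauto

theorem letterSet_bounds {n : ℕ} {x : ℝ} {g : ℕ × Bool} (hg : g.1 + 1 < n) {p : Space}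
    (hp : p ∈ letterSet n x g) :
    x ≤ p.1 ∧ p.1 ≤ x + 1 ∧ p.2.1 ≤ n - 1 ∧ -1 ≤ p.2.2 ∧ p.2.2 ≤ 1 := by
  rcases hp with hp | hp
  · obtain ⟨h1, h2, h3, h4, h5, h6⟩ := crossing_bounds hp
    have : ((g.1 : ℝ) + 1 + 1) ≤ n := by exact_mod_cast hg
    exact ⟨h1, h2, by linarith, h5, h6⟩
  · obtain ⟨j, hj, h1, h2, h3⟩ := (mem_strandsOn (by linarith)).1 hp
    have : ((j : ℝ) + 1) ≤ n := by exact_mod_cast hj.1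
    rw [h3]
    exact ⟨h1, h2, by simp; linarith, by norm_num, by norm_num⟩

theorem draw_bounds {n : ℕ} {x : ℝ} {w : List (ℕ × Bool)} (hw : Valid n w) {p : Space}
    (hp : p ∈ draw n x w) :
    x ≤ p.1 ∧ p.1 ≤ x + w.length ∧ p.2.1 ≤ n - 1 ∧ -1 ≤ p.2.2 ∧ p.2.2 ≤ 1 := by
  induction w generalizing x with
  | nil => simp [draw] at hp
  | cons g w ih =>
    have hl : (0 : ℝ) ≤ w.length := by positivity
    simp only [List.length_cons]
    push_cast
    rcases hp with hp | hp
    · obtain ⟨h1, h2, h3⟩ := letterSet_bounds (hw g (by simp)) hp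
      exact ⟨h1, by linarith, h3⟩
    · obtain ⟨h1, h2, h3⟩ := ih (fun g hg => hw g (by simp [hg])) hp
      exact ⟨by linarith, by linarith, h3⟩

/-- Between their vertical sides the arcs run at height -2, below the word, whose height is at least
-1. -/
theorem arcsOn_bounds {J : Set ℕ} {a b : ℝ} {p : Space} (hp : p ∈ arcsOn J a b) :
    (p.1 = a ∨ p.1 = b ∨ p.2.2 = -2) ∧ ∃ j ∈ J, p.2.1 = (j : ℝ) := by
  obtain ⟨j, hj, hp⟩ := hp
  have e : ∀ s t c : ℝ, s + t = 1 → s * c + t * c = c :=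
    fun s t c h => by rw [← add_mul, h, one_mul]
  rcases hp with (⟨s, t, hs, ht, hst, rfl⟩ | ⟨s, t, hs, ht, hst, rfl⟩) | ⟨s, t, hs, ht, hst, rfl⟩
  · exact ⟨Or.inr (Or.inl (e s t _ hst)), j, hj, e s t _ hst⟩
  · exact ⟨Or.inr (Or.inr (e s t _ hst)), j, hj, e s t _ hst⟩
  · exact ⟨Or.inl (e s t _ hst), j, hj, e s t _ hst⟩

/-! Translations and stretchings of drawings. -/

theorem translation_strandsOn (d : ℝ) (J : Set ℕ) (x x' : ℝ) :
    translation (d, 0, 0) '' strandsOn J x x' = strandsOn J (x + d) (x' + d) := by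
  have : ∀ J x x', strandsOn J x x' =
      ⋃ j ∈ J, segment ℝ ((x, (j : ℝ), 0) : Space) (x', (j : ℝ), 0) := by
    intro J x x'; ext p; simp [strandsOn]
  simp only [this, Set.image_iUnion, translation_image_segment]
  simp [add_comm]

theorem arcsOn_eq_iUnion (J : Set ℕ) (a b : ℝ) : arcsOn J a b =
      ⋃ j ∈ J, (segment ℝ ((b, (j : ℝ), 0) : Space) (b, (j : ℝ), -2) ∪
    segment ℝ ((b, (j : ℝ), -2) : Space) (a, (j : ℝ), -2) ∪
    segment ℝ ((a, (j : ℝ), -2) : Space) (a, (j : ℝ), 0)) := by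
  ext p; simp [arcsOn]

theorem translation_arcsOn (d : ℝ) (J : Set ℕ) (a b : ℝ) :
    translation (d, 0, 0) '' arcsOn J a b = arcsOn J (a + d) (b + d) := by
  simp only [arcsOn_eq_iUnion, Set.image_iUnion, Set.image_union, translation_image_segment]
  simp [add_comm]

theorem translation_crossing (d x : ℝ) (i : ℕ) (e : Bool) :
    translation (d, 0, 0) '' crossing x i e = crossing (x + d) i e := by
  simp only [crossing, Set.image_union, translation_image_segment, Prod.mk_add_mk, zero_add]
  have e1 : d + x = x + d := add_comm _ _
  have e2 : ∀ c : ℝ, d + (x + c) = x + d + c := fun c => by ring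
  simp only [e1, e2]

theorem translation_draw (d : ℝ) (n : ℕ) (x : ℝ) (w : List (ℕ × Bool)) :
    translation (d, 0, 0) '' draw n x w = draw n (x + d) w := by
  induction w generalizing x with
  | nil => simp [draw]
  | cons g w ih =>
    simp only [draw, letterSet, Set.image_union, translation_crossing, translation_strandsOn, ih,
      add_right_comm x 1 d]

theorem translation_braidClosure (d : ℝ) (n : ℕ) (a x : ℝ) (w : List (ℕ × Bool)) (b : ℝ) :
    translation (d, 0, 0) '' braidClosure n a x w b
      = braidClosure n (a + d) (x + d) w (b + d) := by
  simp only [braidClosure, Set.image_union, translation_draw, translation_strandsOn,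
    translation_arcsOn, add_right_comm x _ d]

theorem stretch_strandsOn {p w w' : ℝ} (hw : 0 < w) (hw' : 0 < w') (J : Set ℕ) {x x' : ℝ}
    (h : x ≤ x') : (stretchHomeomorph p w w' hw hw') '' strandsOn J x x'
      = strandsOn J (stretch p w w' x) (stretch p w w' x') := by
  have : ∀ J x x', strandsOn J x x' =
      ⋃ j ∈ J, segment ℝ ((x, (j : ℝ), 0) : Space) (x', (j : ℝ), 0) := by
    intro J x x'; ext p; simp [strandsOn]
  simp only [this, Set.image_iUnion, stretch_image_segment_parallel hw hw' h]

theorem stretch_image_segment_of_eq {p w w' : ℝ} (hw : 0 < w) (hw' : 0 < w') (x : ℝ)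
    (y y' : ℝ × ℝ) :
    (stretchHomeomorph p w w' hw hw') '' segment ℝ ((x, y) : Space) (x, y')
      = segment ℝ (stretch p w w' x, y) (stretch p w w' x, y') := by
  refine image_segment_of_combo fun s t hs ht hst => ?_
  have : (s • ((x, y) : Space) + t • ((x, y') : Space)).1 = x := by
    simp [← add_mul, hst]
  refine Prod.ext ?_ (by simp)
  rw [stretchHomeomorph_apply, this]
  simp [← add_mul, hst]

theorem stretch_arcsOn {p w w' : ℝ} (hw : 0 < w) (hw' : 0 < w') (J : Set ℕ) {a b : ℝ}
    (h : a ≤ b) : (stretchHomeomorph p w w' hw hw') '' arcsOn J a b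
      = arcsOn J (stretch p w w' a) (stretch p w w' b) := by
  simp only [arcsOn_eq_iUnion, Set.image_iUnion, Set.image_union, stretch_image_segment_of_eq,
    segment_symm ℝ ((b, _, -2) : Space) (a, _, -2), stretch_image_segment_parallel hw hw' h,
    segment_symm ℝ ((stretch p w w' b, _, -2) : Space) (stretch p w w' a, _, -2)]

/-- Only the slab behind the word is stretched, where everything is either parallel to the first
axis or in the plane of the far end. -/
theorem braidClosure_right_margin {n : ℕ} {a x : ℝ} {w : List (ℕ × Bool)} (hv : Valid n w)
    {b b' : ℝ} (ha : a ≤ x) (hb : x + w.length < b) (hb' : x + w.length < b') :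
    AmbientIsotopic (braidClosure n a x w b) (braidClosure n a x w b') := by
  have hl : (0 : ℝ) ≤ w.length := by positivity
  have h1 : 0 < b - (x + w.length) := by linarith
  have h2 : 0 < b' - (x + w.length) := by linarith
  have key : stretchHomeomorph (x + w.length) _ _ h1 h2 '' braidClosure n a x w b
      = braidClosure n a x w b' := by
    simp only [braidClosure, Set.image_union]
    rw [stretch_strandsOn h1 h2 _ ha, stretch_strandsOn h1 h2 _ hb.le,
      stretch_arcsOn h1 h2 _ (by linarith),
      stretch_image_of_le h1 h2 (fun q hq => (draw_bounds hv hq).2.1),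
      stretch_of_le (by linarith : a ≤ x + w.length),
      stretch_of_le (by linarith : x ≤ x + w.length), stretch_of_le le_rfl,
      stretch_of_ge h1 (by linarith)]
    congr 3 <;> ring
  rw [← key]
  exact ambientIsotopic_stretch _ _ _ h1 h2 _

theorem braidClosure_translation (d : ℝ) (n : ℕ) (a x : ℝ) (w : List (ℕ × Bool)) (b : ℝ) :
    AmbientIsotopic (braidClosure n a x w b) (braidClosure n (a + d) (x + d) w (b + d)) := by
  rw [← translation_braidClosure]
  exact ambientIsotopic_translation _ _

/-- Stretching the slab in front of the word shifts the word as well; a translation takes the shift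
back. -/
theorem braidClosure_left_margin {n : ℕ} {a a' x : ℝ} {w : List (ℕ × Bool)} (hv : Valid n w)
    {b : ℝ} (ha : a < x) (ha' : a' < x) (hb : x + w.length ≤ b) :
    AmbientIsotopic (braidClosure n a x w b) (braidClosure n a' x w b) := by
  have hl : (0 : ℝ) ≤ w.length := by positivity
  have h1 : 0 < x - a := by linarith
  have h2 : 0 < x - a' := by linarith
  have key : stretchHomeomorph a _ _ h1 h2 '' braidClosure n a x w b
      = translation (a - a', 0, 0) '' braidClosure n a' x w b := by
    rw [translation_braidClosure]
    simp only [braidClosure, Set.image_union]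
    rw [stretch_strandsOn h1 h2 _ ha.le, stretch_strandsOn h1 h2 _ hb,
      stretch_arcsOn h1 h2 _ (by linarith),
      stretch_image_of_ge h1 h2 (fun q hq => by linarith [(draw_bounds hv hq).1]),
      stretch_of_le le_rfl,
      stretch_of_ge h1 (by linarith : a + (x - a) ≤ x),
      stretch_of_ge h1 (by linarith : a + (x - a) ≤ x + w.length),
      stretch_of_ge h1 (by linarith : a + (x - a) ≤ b), translation_draw]
    congr 1
    · congr 1
      · congr 1
        · congr 1 <;> ring
        · congr 1; ring
      · congr 1 <;> ring
    · congr 1 <;> ring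
  refine (ambientIsotopic_stretch a _ _ h1 h2 _).trans ?_
  rw [key]
  exact (ambientIsotopic_translation _ _).symm

/-- The letter of a braid word, with a natural number index. -/
def natLetter {n : ℕ} (g : Fin (n - 1) × Bool) : ℕ × Bool := ((g.1 : ℕ), g.2)

theorem valid_map_natLetter {n : ℕ} (w : BraidWord n) : Valid n (w.map natLetter) := by
  intro g hg
  obtain ⟨h, -, rfl⟩ := List.mem_map.1 hg
  have := h.1.2
  simp only [natLetter]; omega

theorem elementaryBraid_eq {n : ℕ} (x : ℝ) (g : Fin (n - 1) × Bool) :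
    elementaryBraid n x g = letterSet n x (natLetter g) := by
  ext p
  simp only [elementaryBraid, letterSet, natLetter, Set.mem_union, Set.mem_iUnion, strandsOn,
    others, Set.mem_ofPred_eq]
  refine or_congr Iff.rfl ⟨?_, ?_⟩
  · rintro ⟨⟨j, h1, h2⟩, hp⟩
    exact ⟨j, ⟨j.2, h1, h2⟩, hp⟩
  · rintro ⟨j, ⟨h0, h1, h2⟩, hp⟩
    exact ⟨⟨⟨j, h0⟩, h1, h2⟩, hp⟩

theorem iUnion_elementaryBraid {n : ℕ} (x : ℝ) (w : BraidWord n) :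
    ⋃ k : Fin w.length, elementaryBraid n (x + ((k : ℕ) : ℝ)) (w.get k)
      = draw n x (w.map natLetter) := by
  induction w generalizing x with
  | nil => simp [draw]
  | cons g w ih =>
    rw [List.map_cons, draw, ← ih, ← elementaryBraid_eq]
    ext p
    simp only [Set.mem_iUnion, Set.mem_union]
    constructor
    · rintro ⟨k, hk⟩
      rcases Fin.eq_zero_or_eq_succ k with rfl | ⟨k, rfl⟩
      · left; simpa using hk
      · right; refine ⟨k, ?_⟩
        simp only [List.get_eq_getElem, Fin.val_succ, List.getElem_cons_succ, Nat.cast_add,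
          Nat.cast_one] at hk
        rw [add_assoc, add_comm (1 : ℝ)]
        exact hk
    · rintro (hp | ⟨k, hk⟩)
      · exact ⟨0, by simpa using hp⟩
      · refine ⟨k.succ, ?_⟩
        simp only [List.get_eq_getElem, Fin.val_succ, List.getElem_cons_succ, Nat.cast_add,
          Nat.cast_one]
        rw [add_assoc, add_comm (1 : ℝ)] at hk
        exact hk

theorem closedBraid_eq {n : ℕ} (w : BraidWord n) :
    closedBraid w = braidClosure n 0 0 (w.map natLetter) (w.length + 1) := by
  have h1 := iUnion_elementaryBraid 0 w
  simp only [zero_add] at h1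
  rw [closedBraid, h1, braidClosure, List.length_map, zero_add]
  have h2 : (⋃ j : Fin n, closingArc w.length (j : ℕ)) =
      strandsOn {j | j < n} w.length (w.length + 1) ∪ arcsOn {j | j < n} 0 (w.length + 1) := by
    ext p
    simp only [closingArc, Set.mem_iUnion, Set.mem_union, strandsOn, arcsOn, Set.mem_ofPred_eq]
    constructor
    · rintro ⟨j, ((h | h) | h) | h⟩
      · exact Or.inl ⟨j, j.2, h⟩
      · exact Or.inr ⟨j, j.2, Or.inl (Or.inl h)⟩
      · exact Or.inr ⟨j, j.2, Or.inl (Or.inr h)⟩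
      · exact Or.inr ⟨j, j.2, Or.inr h⟩
    · rintro (⟨j, hj, h⟩ | ⟨j, hj, (h | h) | h⟩)
      · exact ⟨⟨j, hj⟩, Or.inl (Or.inl (Or.inl h))⟩
      · exact ⟨⟨j, hj⟩, Or.inl (Or.inl (Or.inr h))⟩
      · exact ⟨⟨j, hj⟩, Or.inl (Or.inr h)⟩
      · exact ⟨⟨j, hj⟩, Or.inr h⟩
  rw [h2]
  have h3 := strandsOn_self_subset {j | j < n} 0 ((w.length : ℝ) + 1)
  ext p
  have := @h3 p
  simp only [Set.mem_union]
  tauto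

/-! ### Local moves of closed braids -/

/-- A polygon translated by `v`. -/
def placed (v : Space) (L : List (LatticePoint × LatticePoint)) : Set Space :=
  translation v '' polygon L

theorem placed_nil (v : Space) : placed v [] = ∅ := by simp [placed, polygon_nil]

theorem placed_cons (x y z : ℝ) (a b c a' b' c' : ℤ) (L : List (LatticePoint × LatticePoint)) :
    placed (x, y, z) (((a, b, c), (a', b', c')) :: L) =
      segment ℝ ((x + a / 4, y + b / 4, z + c / 4) : Space) (x + a' / 4, y + b' / 4, z + c' / 4) ∪
        placed (x, y, z) L := by
  rw [placed, polygon_cons, Set.image_union, translation_image_segment]; rfl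

theorem ambientIsotopic_of_carries {Z : List (List AffineForm)} {ms : List PolygonMove}
    {L L' : List (LatticePoint × LatticePoint)} (h : carries Z ms L L' = true) (v : Space)
    {R : Set Space} (hR : ∀ p ∈ R, p - v ∉ region Z) :
    AmbientIsotopic (R ∪ placed v L) (R ∪ placed v L') := by
  refine AmbientIsotopic.of_image (translation (-v)) ?_
  have e : ∀ L, translation (-v) '' placed v L = polygon L := by
    intro L; rw [placed, Set.image_image]; simp
  rw [Set.image_union, Set.image_union, e, e]
  refine isotopicIn_of_carries h _ (Set.disjoint_left.2 ?_)
  rintro q ⟨p, hp, rfl⟩ hq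
  refine hR p hp ?_
  have : p - v = -v + p := by abel
  rwa [this]

/-! ### Local moves in a box, and absorption of the left margin. -/

theorem strandsOn_pair (i : ℕ) (x x' : ℝ) : strandsOn {i, i + 1} x x' =
    segment ℝ ((x, (i : ℝ), 0) : Space) (x', (i : ℝ), 0) ∪
      segment ℝ ((x, (i : ℝ) + 1, 0) : Space) (x', (i : ℝ) + 1, 0) := by
  ext p; simp [strandsOn]

/-- The box `x₀ < x < x₁`, `y₀ < y < y₁`, `-2 < z`. -/
def boxZone (x₀ x₁ y₀ y₁ : ℤ) : List AffineForm :=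
  [(1, 0, 0, -4 * x₀), (-1, 0, 0, 4 * x₁), (0, 1, 0, -4 * y₀), (0, -1, 0, 4 * y₁), (0, 0, 1, 8)]

theorem mem_region_boxZone {x₀ x₁ y₀ y₁ : ℤ} {p : Space} :
    p ∈ region [boxZone x₀ x₁ y₀ y₁] ↔
      (x₀ : ℝ) < p.1 ∧ p.1 < x₁ ∧ (y₀ : ℝ) < p.2.1 ∧ p.2.1 < y₁ ∧ -2 < p.2.2 := by
  simp only [region, boxZone, exists_eq_left, Set.mem_ofPred_eq,
    List.mem_cons, List.not_mem_nil, or_false, forall_eq_or_imp, forall_eq, AffineForm.evalAt]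
  push_cast
  constructor
  · rintro ⟨h1, h2, h3, h4, h5⟩
    refine ⟨?_, ?_, ?_, ?_, ?_⟩ <;> linarith
  · rintro ⟨h1, h2, h3, h4, h5⟩
    refine ⟨?_, ?_, ?_, ?_, ?_⟩ <;> linarith

theorem others_notMem {n i : ℕ} {x x' : ℝ} (h : x ≤ x') {p : Space}
    (hp : p ∈ strandsOn (others n i) x x') : p.2.1 ≤ i - 1 ∨ (i : ℝ) + 2 ≤ p.2.1 := by
  obtain ⟨j, hj, -, -, h3⟩ := (mem_strandsOn h).1 hp
  rw [h3]
  have : j + 1 ≤ i ∨ i + 2 ≤ j := by have := hj.2; omega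
  rcases this with h | h
  · left; have : (j : ℝ) + 1 ≤ i := by exact_mod_cast h
    simp; linarith
  · right; have : (i : ℝ) + 2 ≤ j := by exact_mod_cast h
    simpa using this

/-- The end of the integral polygon of a crossing. -/
def crossingTop (e : Bool) : ℤ := if e then 4 else -4

/-- Coordinates are in units of 1/4. A stretch cannot reduce a positive margin to zero, so the
straight lead-in of length 1 is instead merged with the crossing into a crossing of width 2. -/
theorem carries_widen (e : Bool) : carries [boxZone (-1) 1 (-1) 2]
    (if e then
      [.vertex (-4, 0, 0) (0, 0, 0) (2, 2, 4) (-1, 1, 2) 0 [(-1, -2, 1, 2)],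
       .merge (-4, 0, 0) (-1, 1, 2) (2, 2, 4) 1 1,
       .vertex (-4, 0, 0) (2, 2, 4) (4, 4, 0) (0, 2, 4) 0 [(0, 0, 1, 0)],
       .vertex (-4, 4, 0) (0, 4, 0) (4, 0, 0) (0, 2, 0) 0 [(-1, 0, -1, 4), (0, 1, -1, 0)],
       .merge (-4, 4, 0) (0, 2, 0) (4, 0, 0) 1 1]
    else
      [.vertex (-4, 0, 0) (0, 0, 0) (2, 2, -4) (-1, 1, -2) 0 [(-1, -2, -1, 2)],
       .merge (-4, 0, 0) (-1, 1, -2) (2, 2, -4) 1 1,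
       .vertex (-4, 0, 0) (2, 2, -4) (4, 4, 0) (0, 2, -4) 0 [(0, 0, -1, 0)],
       .vertex (-4, 4, 0) (0, 4, 0) (4, 0, 0) (0, 2, 0) 0 [(-1, 0, 1, 4), (0, 1, 1, 0)],
       .merge (-4, 4, 0) (0, 2, 0) (4, 0, 0) 1 1])
    [((-4, 0, 0), (0, 0, 0)), ((0, 0, 0), (2, 2, crossingTop e)),
      ((2, 2, crossingTop e), (4, 4, 0)), ((-4, 4, 0), (0, 4, 0)), ((0, 4, 0), (4, 0, 0))]
    [((-4, 4, 0), (4, 0, 0)), ((-4, 0, 0), (0, 2, crossingTop e)),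
      ((0, 2, crossingTop e), (4, 4, 0))] = true := by
  revert e; decide

theorem braidClosure_cons (n : ℕ) (a x : ℝ) (g : ℕ × Bool) (w : List (ℕ × Bool)) (b : ℝ) :
    braidClosure n a x (g :: w) b = strandsOn {j | j < n} a x ∪ letterSet n x g ∪
      (draw n (x + 1) w ∪ strandsOn {j | j < n} (x + 1 + w.length) b ∪ arcsOn {j | j < n} a b) := by
  simp only [braidClosure, draw, List.length_cons]
  push_cast
  rw [add_assoc x 1, add_comm 1 (w.length : ℝ)]
  simp only [Set.union_assoc]

/-- A margin before the first crossing of a word can be removed. -/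
theorem braidClosure_remove_margin {n : ℕ} {x : ℝ} {g : ℕ × Bool} {w : List (ℕ × Bool)}
    (hv : Valid n (g :: w)) {b : ℝ} (hb : x + 1 + w.length ≤ b) :
    AmbientIsotopic (braidClosure n (x - 1) x (g :: w) b) (braidClosure n x x (g :: w) b) := by
  obtain ⟨i, e⟩ := g
  have hi : i + 1 < n := hv (i, e) (by simp)
  have hw : Valid n w := fun g hg => hv g (by simp [hg])
  have hl : (0 : ℝ) ≤ w.length := by positivity
  set D : Set Space := draw n (x + 1) w ∪ strandsOn {j | j < n} (x + 1 + w.length) b ∪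
    arcsOn {j | j < n} (x - 1) b with hD
  set R : Set Space := strandsOn (others n i) (x - 1) (x + 1) ∪ D with hR
  have hmove := ambientIsotopic_of_carries (carries_widen e) (x, (i : ℝ), 0) (R := R) (by
    intro p hp
    rw [mem_region_boxZone]
    rintro ⟨h1, h2, h3, h4, h5⟩
    simp only [Prod.fst_sub, Prod.snd_sub] at h1 h2 h3 h4 h5
    push_cast at h1 h2 h3 h4 h5
    rcases hp with hp | (hp | hp) | hp
    · rcases others_notMem (by linarith) hp with h | h <;> linarith
    · have := (draw_bounds hw hp).1; linarith
    · obtain ⟨_, _, h, _⟩ := (mem_strandsOn hb).1 hp; linarith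
    · rcases (arcsOn_bounds hp).1 with h | h | h <;> linarith)
  have e1 : braidClosure n (x - 1) x ((i, e) :: w) b = R ∪ placed (x, (i : ℝ), 0)
      [((-4, 0, 0), (0, 0, 0)), ((0, 0, 0), (2, 2, crossingTop e)),
        ((2, 2, crossingTop e), (4, 4, 0)), ((-4, 4, 0), (0, 4, 0)), ((0, 4, 0), (4, 0, 0))] := by
    rw [braidClosure_cons, ← hD, hR, letterSet, lt_eq_others_union hi, strandsOn_union,
      strandsOn_pair, ← strandsOn_trans (others n i) (by linarith : x - 1 ≤ x)
      (by linarith : x ≤ x + 1)]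
    simp only [placed_cons, placed_nil, crossing]
    cases e <;> simp only [crossingTop] <;> norm_num <;> ring_nf <;>
      (ext p; simp only [Set.mem_union]; tauto)
  have h1 : (0 : ℝ) < 1 := one_pos
  have h2 : (0 : ℝ) < 2 := two_pos
  -- The closure without margin acquires the same widened crossing when the slab over its first
  -- letter is doubled; everything behind it moves right by 1, as recorded by the translation.
  have e2 : stretchHomeomorph x 1 2 h1 h2 '' braidClosure n x x ((i, e) :: w) b =
      translation (1, 0, 0) '' (R ∪ placed (x, (i : ℝ), 0)
        [((-4, 4, 0), (4, 0, 0)), ((-4, 0, 0), (0, 2, crossingTop e)),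
          ((0, 2, crossingTop e), (4, 4, 0))]) := by
    have hs := strandsOn_self_subset {j | j < n} x b
    have e3 : braidClosure n x x ((i, e) :: w) b = letterSet n x (i, e) ∪
        (draw n (x + 1) w ∪ strandsOn {j | j < n} (x + 1 + w.length) b ∪
          arcsOn {j | j < n} x b) := by
      rw [braidClosure_cons]
      ext p
      have := @hs p
      simp only [Set.mem_union]
      tauto
    have e4 : stretchHomeomorph x 1 2 h1 h2 '' crossing x i e =
        segment ℝ ((x, (i : ℝ), 0) : Space) (x + 1, (i : ℝ) + 1 / 2, if e then 1 else -1) ∪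
        segment ℝ ((x + 1, (i : ℝ) + 1 / 2, if e then 1 else -1) : Space)
          (x + 2, (i : ℝ) + 1, 0) ∪
        segment ℝ ((x, (i : ℝ) + 1, 0) : Space) (x + 2, (i : ℝ), 0) := by
      simp only [crossing, Set.image_union]
      rw [stretch_image_segment_of_mem, stretch_image_segment_of_mem,
        stretch_image_segment_of_mem]
      · ring_nf
      all_goals norm_num
    rw [e3, letterSet]
    simp only [Set.image_union]
    rw [e4, stretch_strandsOn h1 h2 _ (by linarith), stretch_strandsOn h1 h2 _ hb,
      stretch_arcsOn h1 h2 _ (by linarith), stretch_image_of_ge h1 h2 (S := draw n (x + 1) w)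
      (fun q hq => (draw_bounds hw hq).1), hR, hD, stretch_of_le le_rfl,
      stretch_of_ge h1 (le_refl (x + 1)), stretch_of_ge h1 (by linarith : x + 1 ≤ b),
      stretch_of_ge h1 (by linarith : x + 1 ≤ x + 1 + w.length)]
    simp only [placed_cons, placed_nil, Set.image_union, translation_strandsOn,
      translation_arcsOn, translation_draw, translation_image_segment, Prod.mk_add_mk,
      Set.image_empty]
    cases e <;> simp only [crossingTop] <;> norm_num <;> ring_nf <;>
      (ext p; simp only [Set.mem_union]; tauto)
  rw [e1]
  refine hmove.trans ((ambientIsotopic_translation (1, 0, 0) _).trans ?_)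
  rw [← e2]
  exact (ambientIsotopic_stretch x 1 2 h1 h2 _).symm

theorem braidClosure_nil (n : ℕ) {a x b : ℝ} (h : a ≤ x) (h' : x ≤ b) :
    braidClosure n a x [] b = braidClosure n a a [] b := by
  have hs := strandsOn_self_subset {j | j < n} a b
  simp only [braidClosure, draw, List.length_nil, Nat.cast_zero, add_zero, Set.union_empty]
  rw [strandsOn_trans _ h h']
  ext p
  have := @hs p
  simp only [Set.mem_union]
  tauto

/-- The closure of a word drawn over `[0, l]`. -/
@[irreducible] def closureSet (n : ℕ) (w : List (ℕ × Bool)) : Set Space :=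
  braidClosure n 0 0 w (w.length + 1)

theorem closedBraid_eq_closureSet {n : ℕ} (w : BraidWord n) :
    closedBraid w = closureSet n (w.map natLetter) := by
  rw [closedBraid_eq, closureSet, List.length_map]

/-- The knot type depends neither on where the word is drawn nor on the margins. The right margin
has to be positive; the left one may be zero. -/
theorem braidClosure_isotopic {n : ℕ} {w : List (ℕ × Bool)} (hv : Valid n w) {a x b : ℝ}
    (ha : a ≤ x) (hb : x + w.length < b) :
    AmbientIsotopic (braidClosure n a x w b) (closureSet n w) := by
  have step : ∀ a b : ℝ, a ≤ 0 → (w.length : ℝ) < b →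
      AmbientIsotopic (braidClosure n a 0 w b) (closureSet n w) := by
    intro a b ha hb
    have h0 : AmbientIsotopic (braidClosure n 0 0 w b) (closureSet n w) := by
      rw [closureSet]
      exact braidClosure_right_margin hv le_rfl (by linarith) (by linarith)
    rcases ha.eq_or_lt with rfl | ha
    · exact h0
    have hl : (0 : ℝ) ≤ w.length := by positivity
    -- The left margin is normalised to 1, the width that the first crossing can absorb.
    refine (braidClosure_left_margin (a' := 0 - 1) hv ha (by norm_num) (by linarith)).trans ?_
    cases w with
    | nil =>
      -- The empty word has no crossing to absorb the margin, but its closure does not depend on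
      -- where the word is placed between the arcs.
      simp only [List.length_nil, Nat.cast_zero] at hb
      rw [braidClosure_nil n (by norm_num) hb.le]
      refine (braidClosure_translation 1 n _ _ _ _).trans ?_
      norm_num [closureSet]
      exact braidClosure_right_margin hv le_rfl (by simp; linarith) (by simp)
    | cons g w =>
      simp only [List.length_cons] at hb
      push_cast at hb
      exact (braidClosure_remove_margin hv (by linarith)).trans h0
  refine (braidClosure_translation (-x) n a x w b).trans ?_
  rw [add_neg_cancel]
  exact step _ _ (by linarith) (by linarith)

/-- The box covers the slab of the moving letters, stays strictly between the neighbouring positions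
and ends above the closing arcs. It thus avoids the rest of the closed braid. -/
theorem ambientIsotopic_of_box {k c : ℕ} {ms : List PolygonMove}
    {L L' : List (LatticePoint × LatticePoint)}
    (h : carries [boxZone 0 k (-1) c] ms L L' = true) {J : Set ℕ} {i : ℕ}
    (hJ : ∀ j ∈ J, j + 1 ≤ i ∨ i + c ≤ j) {y : ℝ} {C : Set Space}
    (hC : ∀ p ∈ C, p.1 ≤ y ∨ y + k ≤ p.1 ∨ p.2.2 ≤ -2) :
    AmbientIsotopic (C ∪ (strandsOn J y (y + k) ∪ placed (y, (i : ℝ), 0) L))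
      (C ∪ (strandsOn J y (y + k) ∪ placed (y, (i : ℝ), 0) L')) := by
  rw [← Set.union_assoc, ← Set.union_assoc]
  refine ambientIsotopic_of_carries h _ ?_
  intro p hp
  rw [mem_region_boxZone]
  rintro ⟨h1, h2, h3, h4, h5⟩
  simp only [Prod.fst_sub, Prod.snd_sub] at h1 h2 h3 h4 h5
  push_cast at h1 h2 h3 h4 h5
  rcases hp with hp | hp
  · rcases hC p hp with h | h | h <;> linarith
  · have hk : (0 : ℝ) ≤ k := by positivity
    obtain ⟨j, hj, -, -, e⟩ := (mem_strandsOn (by linarith)).1 hp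
    rw [e] at h3 h4
    simp only at h3 h4
    rcases hJ j hj with h | h
    · have : (j : ℝ) + 1 ≤ i := by exact_mod_cast h
      linarith
    · have : (i : ℝ) + c ≤ j := by exact_mod_cast h
      linarith

/-! ### Cancellation of a letter against its inverse. -/

theorem carries_cancel (e : Bool) : carries [boxZone 0 2 (-1) 2]
    (if e then
      [.vertex (2, 2, 4) (4, 4, 0) (8, 0, 0) (6, 2, 4) 0 [(2, 1, 1, -10), (-1, 0, 1, 8)],
       .vertex (0, 4, 0) (4, 0, 0) (6, 2, -4) (4, 4, -2) 0 [(-4, -1, -2, 18), (1, 0, -1, 0)],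
       .vertex (4, 4, -2) (6, 2, -4) (8, 4, 0) (6, 4, -1) 0 [(1, 1, -1, -10)],
       .merge (4, 4, -2) (6, 4, -1) (8, 4, 0) 1 1,
       .vertex (0, 4, 0) (4, 4, -2) (8, 4, 0) (4, 4, 0) 0 [(0, 1, 0, -3)],
       .merge (0, 4, 0) (4, 4, 0) (8, 4, 0) 1 1,
       .vertex (0, 0, 0) (2, 2, 4) (6, 2, 4) (3, 1, 2) 0 [(-1, -1, 1, 4)],
       .merge (0, 0, 0) (3, 1, 2) (6, 2, 4) 1 1,
       .vertex (0, 0, 0) (6, 2, 4) (8, 0, 0) (4, 0, 0) 0 [(0, -1, 0, 3)],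
       .merge (0, 0, 0) (4, 0, 0) (8, 0, 0) 1 1]
    else
      [.vertex (2, 2, -4) (4, 4, 0) (8, 0, 0) (6, 2, -4) 0 [(2, 1, -1, -10), (-1, 0, -1, 8)],
       .vertex (0, 4, 0) (4, 0, 0) (6, 2, 4) (4, 4, 2) 0 [(-4, -1, 2, 18), (1, 0, 1, 0)],
       .vertex (4, 4, 2) (6, 2, 4) (8, 4, 0) (6, 4, 1) 0 [(1, 1, 1, -10)],
       .merge (4, 4, 2) (6, 4, 1) (8, 4, 0) 1 1,
       .vertex (0, 4, 0) (4, 4, 2) (8, 4, 0) (4, 4, 0) 0 [(0, 1, 0, -3)],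
       .merge (0, 4, 0) (4, 4, 0) (8, 4, 0) 1 1,
       .vertex (0, 0, 0) (2, 2, -4) (6, 2, -4) (3, 1, -2) 0 [(-1, -1, -1, 4)],
       .merge (0, 0, 0) (3, 1, -2) (6, 2, -4) 1 1,
       .vertex (0, 0, 0) (6, 2, -4) (8, 0, 0) (4, 0, 0) 0 [(0, -1, 0, 3)],
       .merge (0, 0, 0) (4, 0, 0) (8, 0, 0) 1 1])
    [((0, 0, 0), (2, 2, crossingTop e)), ((2, 2, crossingTop e), (4, 4, 0)),
     ((4, 4, 0), (8, 0, 0)), ((0, 4, 0), (4, 0, 0)), ((4, 0, 0), (6, 2, crossingTop (!e))),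
     ((6, 2, crossingTop (!e)), (8, 4, 0))]
    [((0, 0, 0), (8, 0, 0)), ((0, 4, 0), (8, 4, 0))] = true := by
  revert e; decide

theorem draw_cancel {n i : ℕ} (y : ℝ) (e : Bool) :
    draw n y [(i, e), (i, !e)] = strandsOn (others n i) y (y + (2 : ℕ)) ∪ placed (y, (i : ℝ), 0)
      [((0, 0, 0), (2, 2, crossingTop e)), ((2, 2, crossingTop e), (4, 4, 0)),
       ((4, 4, 0), (8, 0, 0)), ((0, 4, 0), (4, 0, 0)), ((4, 0, 0), (6, 2, crossingTop (!e))),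
       ((6, 2, crossingTop (!e)), (8, 4, 0))] := by
  simp only [draw, letterSet, crossing, placed_cons, placed_nil]
  rw [← strandsOn_trans (others n i) (by linarith : y ≤ y + 1) (by norm_num : y + 1 ≤ y + (2 : ℕ))]
  cases e <;> simp only [crossingTop] <;> norm_num <;> ring_nf <;>
    (ext p; simp only [Set.mem_union]; tauto)

theorem strandsOn_two {n i : ℕ} (hi : i + 1 < n) (y : ℝ) :
    strandsOn {j | j < n} y (y + (2 : ℕ)) = strandsOn (others n i) y (y + (2 : ℕ)) ∪
      placed (y, (i : ℝ), 0) [((0, 0, 0), (8, 0, 0)), ((0, 4, 0), (8, 4, 0))] := by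
  rw [lt_eq_others_union hi, strandsOn_union, strandsOn_pair]
  simp only [placed_cons, placed_nil]
  norm_num

/-- Reidemeister's second move: one of the two strands is above the other at both crossings, so they
can be pulled apart. -/
theorem cancel_move {n i : ℕ} (hi : i + 1 < n) (y : ℝ) (e : Bool) {C : Set Space}
    (hC : ∀ p ∈ C, p.1 ≤ y ∨ y + (2 : ℕ) ≤ p.1 ∨ p.2.2 ≤ -2) :
    AmbientIsotopic (C ∪ draw n y [(i, e), (i, !e)])
      (C ∪ strandsOn {j | j < n} y (y + (2 : ℕ))) := by
  rw [draw_cancel, strandsOn_two hi]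
  exact ambientIsotopic_of_box (k := 2) (c := 2) (carries_cancel e)
    (fun j hj => by have := hj.2; omega) hC

theorem closureSet_append_cancel {n : ℕ} {w : List (ℕ × Bool)} (hw : Valid n w) {i : ℕ}
    (hi : i + 1 < n) (e : Bool) :
    AmbientIsotopic (closureSet n (w ++ [(i, e), (i, !e)])) (closureSet n w) := by
  have hl : (0 : ℝ) ≤ w.length := by positivity
  set C : Set Space := strandsOn {j | j < n} 0 0 ∪ draw n 0 w ∪
    strandsOn {j | j < n} (w.length + (2 : ℕ)) (w.length + 3) ∪
    arcsOn {j | j < n} 0 (w.length + 3) with hCdef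
  have hC : ∀ p ∈ C, p.1 ≤ w.length ∨ (w.length : ℝ) + (2 : ℕ) ≤ p.1 ∨ p.2.2 ≤ -2 := by
    rintro p (((hp | hp) | hp) | hp)
    · obtain ⟨_, _, _, h, _⟩ := (mem_strandsOn le_rfl).1 hp; left; linarith
    · left; linarith [(draw_bounds hw hp).2.1]
    · obtain ⟨_, _, h, _⟩ := (mem_strandsOn (by norm_num)).1 hp; right; left; exact h
    · rcases (arcsOn_bounds hp).1 with h | h | h
      · left; linarith
      · right; left; norm_num; linarith
      · right; right; linarith
  have e1 : closureSet n (w ++ [(i, e), (i, !e)]) = C ∪ draw n w.length [(i, e), (i, !e)] := by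
    rw [closureSet, braidClosure, draw_append, hCdef]
    simp only [List.length_append, List.length_cons, List.length_nil]
    push_cast
    norm_num
    ring_nf
    ext p; simp only [Set.mem_union]; tauto
  have e2 : C ∪ strandsOn {j | j < n} w.length (w.length + (2 : ℕ))
      = braidClosure n 0 0 w (w.length + 3) := by
    rw [braidClosure, hCdef, zero_add, ← strandsOn_trans _
      (by norm_num : (w.length : ℝ) ≤ w.length + (2 : ℕ))
      (by norm_num : (w.length : ℝ) + (2 : ℕ) ≤ w.length + 3)]
    ext p; simp only [Set.mem_union]; tauto
  rw [e1]
  refine (cancel_move hi _ e hC).trans ?_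
  rw [e2]
  exact braidClosure_isotopic hw le_rfl (by linarith)

theorem closureSet_cons_cancel {n : ℕ} {w : List (ℕ × Bool)} (hw : Valid n w) {i : ℕ}
    (hi : i + 1 < n) (e : Bool) :
    AmbientIsotopic (closureSet n ((i, e) :: (i, !e) :: w)) (closureSet n w) := by
  have hl : (0 : ℝ) ≤ w.length := by positivity
  set C : Set Space := strandsOn {j | j < n} 0 0 ∪ draw n 2 w ∪
    strandsOn {j | j < n} (2 + w.length) (w.length + 3) ∪
    arcsOn {j | j < n} 0 (w.length + 3) with hCdef
  have hC : ∀ p ∈ C, p.1 ≤ 0 ∨ (0 : ℝ) + (2 : ℕ) ≤ p.1 ∨ p.2.2 ≤ -2 := by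
    push_cast
    rintro p (((hp | hp) | hp) | hp)
    · obtain ⟨_, _, _, h, _⟩ := (mem_strandsOn le_rfl).1 hp; left; linarith
    · right; left; linarith [(draw_bounds hw hp).1]
    · obtain ⟨_, _, h, _⟩ := (mem_strandsOn (by linarith)).1 hp; right; left; linarith
    · rcases (arcsOn_bounds hp).1 with h | h | h
      · left; linarith
      · right; left; linarith
      · right; right; linarith
  have e1 : closureSet n ((i, e) :: (i, !e) :: w) = C ∪ draw n 0 [(i, e), (i, !e)] := by
    rw [closureSet, braidClosure, hCdef]
    simp only [List.length_cons, draw]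
    push_cast
    norm_num
    ring_nf
    ext p; simp only [Set.mem_union]; tauto
  have e2 : C ∪ strandsOn {j | j < n} 0 (0 + (2 : ℕ)) = braidClosure n 0 2 w (w.length + 3) := by
    have hs := strandsOn_self_subset {j | j < n} 0 ((w.length : ℝ) + 3)
    rw [braidClosure, hCdef]
    norm_num
    ext p
    have := @hs p
    simp only [Set.mem_union]; tauto
  rw [e1]
  refine (cancel_move hi _ e hC).trans ?_
  rw [e2]
  exact braidClosure_isotopic hw (by norm_num) (by linarith)

/-- In the positive half twist the strand starting lowest in position passes over both others, and
the middle one passes over the last. The first two are lifted, to heights 3 and 3/2, so that the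
strands lie in separate layers; each then slides to its new course and comes down again. -/
theorem carries_braid : carries [boxZone 0 3 (-1) 3]
    [.vertex (2, 2, 4) (4, 4, 0) (6, 6, 4) (4, 4, 8) 0 [(-2, 1, 0, 6), (1, 1, 0, -4),
       (-1, -2, 1, 14)],
     .merge (0, 0, 0) (2, 2, 4) (4, 4, 8) 1 1,
     .merge (4, 4, 8) (6, 6, 4) (8, 8, 0) 1 1,
     .vertex (4, 4, 8) (8, 8, 0) (12, 8, 0) (8, 6, 4) 0 [(1, 2, 1, -20)],
     .merge (4, 4, 8) (8, 6, 4) (12, 8, 0) 1 1,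
     .vertex (0, 0, 0) (4, 4, 8) (12, 8, 0) (6, 4, 12) 0 [(0, 0, 1, 0), (-1, 1, 0, 4)],
     .vertex (0, 4, 0) (4, 0, 0) (8, 0, 0) (4, 2, 0) 0 [(-1, -1, 0, 8), (1, 0, -1, 0)],
     .merge (0, 4, 0) (4, 2, 0) (8, 0, 0) 1 1,
     .vertex (0, 4, 0) (8, 0, 0) (10, 2, 4) (6, 4, 6) 0 [(-1, -2, 1, 10), (-2, 0, -1, 24),
       (1, 1, -1, -3)],
     .vertex (6, 4, 6) (10, 2, 4) (12, 4, 0) (9, 4, 3) 0 [(2, -3, 0, 0), (0, 0, 1, 0)],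
     .merge (6, 4, 6) (9, 4, 3) (12, 4, 0) 1 1,
     .vertex (0, 8, 0) (4, 8, 0) (8, 4, 0) (4, 6, 0) 0 [(0, 1, 0, -4), (-1, 0, -1, 8)],
     .merge (0, 8, 0) (4, 6, 0) (8, 4, 0) 1 1,
     .vertex (0, 8, 0) (8, 4, 0) (12, 0, 0) (6, 4, 0) 0 [(-1, 0, -1, 12), (1, 0, -1, 0)],
     .vertex (0, 8, 0) (6, 4, 0) (12, 0, 0) (4, 4, 0) 0 [(-1, 0, -1, 12), (1, 0, -1, 0)],
     .split (4, 4, 0) (8, 2, 0) (12, 0, 0) 1 1,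
     .vertex (4, 4, 0) (8, 2, 0) (12, 0, 0) (8, 0, 0) 0 [(0, -1, 0, 4), (1, 0, -1, -4)],
     .split (0, 4, 0) (3, 4, 3) (6, 4, 6) 1 1,
     .vertex (0, 4, 0) (3, 4, 3) (6, 4, 6) (2, 6, 4) 0 [(-2, -2, 1, 14), (-2, 3, 0, 0)],
     .vertex (2, 6, 4) (6, 4, 6) (12, 4, 0) (4, 8, 0) 0 [(1, 2, 1, -18), (-2, 0, -1, 24),
       (0, 2, -1, -1)],
     .split (4, 8, 0) (8, 6, 0) (12, 4, 0) 1 1,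
     .vertex (4, 8, 0) (8, 6, 0) (12, 4, 0) (8, 8, 0) 0 [(1, 1, 0, -12), (-1, 0, -1, 12)],
     .vertex (0, 0, 0) (6, 4, 12) (12, 8, 0) (8, 4, 8) 0 [(0, 0, 1, 0), (1, -1, 0, 0)],
     .split (0, 0, 0) (4, 2, 4) (8, 4, 8) 1 1,
     .vertex (0, 0, 0) (4, 2, 4) (8, 4, 8) (4, 0, 0) 0 [(-1, -2, 1, 8)],
     .split (4, 0, 0) (6, 2, 4) (8, 4, 8) 1 1,
     .split (8, 4, 8) (10, 6, 4) (12, 8, 0) 1 1,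
     .vertex (6, 2, 4) (8, 4, 8) (10, 6, 4) (8, 4, 0) 0 [(2, -1, 0, -10), (-1, -1, 0, 16),
       (1, 2, 1, -14)]]
    [((0, 0, 0), (2, 2, 4)), ((2, 2, 4), (4, 4, 0)), ((4, 4, 0), (6, 6, 4)),
     ((6, 6, 4), (8, 8, 0)), ((8, 8, 0), (12, 8, 0)), ((0, 4, 0), (4, 0, 0)),
     ((4, 0, 0), (8, 0, 0)), ((8, 0, 0), (10, 2, 4)), ((10, 2, 4), (12, 4, 0)),
     ((0, 8, 0), (4, 8, 0)), ((4, 8, 0), (8, 4, 0)), ((8, 4, 0), (12, 0, 0))]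
    [((0, 0, 0), (4, 0, 0)), ((4, 0, 0), (6, 2, 4)), ((6, 2, 4), (8, 4, 0)),
     ((8, 4, 0), (10, 6, 4)), ((10, 6, 4), (12, 8, 0)), ((0, 4, 0), (2, 6, 4)),
     ((2, 6, 4), (4, 8, 0)), ((4, 8, 0), (8, 8, 0)), ((8, 8, 0), (12, 4, 0)),
     ((0, 8, 0), (4, 4, 0)), ((4, 4, 0), (8, 0, 0)), ((8, 0, 0), (12, 0, 0))] = true := by
  decide

/-- The positions away from three consecutive ones. -/
def others₃ (n i : ℕ) : Set ℕ := {j | j < n ∧ j ≠ i ∧ j ≠ i + 1 ∧ j ≠ i + 2}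

theorem strandsOn_others {n i : ℕ} (hi : i + 2 < n) (x x' : ℝ) :
    strandsOn (others n i) x x' = strandsOn (others₃ n i) x x' ∪
      segment ℝ ((x, (i : ℝ) + 2, 0) : Space) (x', (i : ℝ) + 2, 0) := by
  have : others n i = others₃ n i ∪ {i + 2} := by
    ext j; simp only [others, others₃, Set.mem_ofPred_eq, Set.mem_union, Set.mem_singleton_iff]
    omega
  rw [this, strandsOn_union]
  congr 1
  ext p; simp [strandsOn]

theorem strandsOn_others_succ {n i : ℕ} (hi : i + 2 < n) (x x' : ℝ) :
    strandsOn (others n (i + 1)) x x' = strandsOn (others₃ n i) x x' ∪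
      segment ℝ ((x, (i : ℝ), 0) : Space) (x', (i : ℝ), 0) := by
  have : others n (i + 1) = others₃ n i ∪ {i} := by
    ext j; simp only [others, others₃, Set.mem_ofPred_eq, Set.mem_union, Set.mem_singleton_iff]
    omega
  rw [this, strandsOn_union]
  congr 1
  ext p; simp [strandsOn]

theorem strandsOn_three (J : Set ℕ) (y : ℝ) : strandsOn J y (y + (3 : ℕ)) =
    strandsOn J y (y + 1) ∪ strandsOn J (y + 1) (y + 1 + 1) ∪
      strandsOn J (y + 1 + 1) (y + 1 + 1 + 1) := by
  rw [strandsOn_trans J (by linarith) (by linarith), strandsOn_trans J (by linarith) (by linarith)]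
  norm_num
  ring_nf

theorem draw_braid {n i : ℕ} (hi : i + 2 < n) (y : ℝ) :
    draw n y [(i, true), (i + 1, true), (i, true)] =
      strandsOn (others₃ n i) y (y + (3 : ℕ)) ∪ placed (y, (i : ℝ), 0)
      [((0, 0, 0), (2, 2, 4)), ((2, 2, 4), (4, 4, 0)), ((4, 4, 0), (6, 6, 4)),
       ((6, 6, 4), (8, 8, 0)), ((8, 8, 0), (12, 8, 0)), ((0, 4, 0), (4, 0, 0)),
       ((4, 0, 0), (8, 0, 0)), ((8, 0, 0), (10, 2, 4)), ((10, 2, 4), (12, 4, 0)),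
       ((0, 8, 0), (4, 8, 0)), ((4, 8, 0), (8, 4, 0)), ((8, 4, 0), (12, 0, 0))] := by
  rw [strandsOn_three]
  simp only [draw, letterSet, crossing, placed_cons, placed_nil, strandsOn_others hi,
    strandsOn_others_succ hi]
  push_cast
  norm_num
  ring_nf
  ext p; simp only [Set.mem_union]; tauto

theorem draw_braid' {n i : ℕ} (hi : i + 2 < n) (y : ℝ) :
    draw n y [(i + 1, true), (i, true), (i + 1, true)] =
      strandsOn (others₃ n i) y (y + (3 : ℕ)) ∪ placed (y, (i : ℝ), 0)
      [((0, 0, 0), (4, 0, 0)), ((4, 0, 0), (6, 2, 4)), ((6, 2, 4), (8, 4, 0)),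
       ((8, 4, 0), (10, 6, 4)), ((10, 6, 4), (12, 8, 0)), ((0, 4, 0), (2, 6, 4)),
       ((2, 6, 4), (4, 8, 0)), ((4, 8, 0), (8, 8, 0)), ((8, 8, 0), (12, 4, 0)),
       ((0, 8, 0), (4, 4, 0)), ((4, 4, 0), (8, 0, 0)), ((8, 0, 0), (12, 0, 0))] := by
  rw [strandsOn_three]
  simp only [draw, letterSet, crossing, placed_cons, placed_nil, strandsOn_others hi,
    strandsOn_others_succ hi]
  push_cast
  norm_num
  ring_nf
  ext p; simp only [Set.mem_union]; tauto

theorem closureSet_braid {n : ℕ} {u v : List (ℕ × Bool)} (hu : Valid n u) (hv : Valid n v)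
    {i : ℕ} (hi : i + 2 < n) :
    AmbientIsotopic (closureSet n (u ++ [(i, true), (i + 1, true), (i, true)] ++ v))
      (closureSet n (u ++ [(i + 1, true), (i, true), (i + 1, true)] ++ v)) := by
  have hlu : (0 : ℝ) ≤ u.length := by positivity
  have hlv : (0 : ℝ) ≤ v.length := by positivity
  set b : ℝ := u.length + 3 + v.length + 1 with hb
  set C : Set Space := strandsOn {j | j < n} 0 0 ∪ draw n 0 u ∪ draw n (u.length + 3) v ∪
    strandsOn {j | j < n} (u.length + 3 + v.length) b ∪ arcsOn {j | j < n} 0 b with hCdef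
  have hC : ∀ p ∈ C, p.1 ≤ u.length ∨ (u.length : ℝ) + (3 : ℕ) ≤ p.1 ∨ p.2.2 ≤ -2 := by
    push_cast
    rintro p ((((hp | hp) | hp) | hp) | hp)
    · obtain ⟨_, _, _, h, _⟩ := (mem_strandsOn le_rfl).1 hp; left; linarith
    · left; linarith [(draw_bounds hu hp).2.1]
    · right; left; linarith [(draw_bounds hv hp).1]
    · obtain ⟨_, _, h, _⟩ := (mem_strandsOn (by linarith)).1 hp; right; left; linarith
    · rcases (arcsOn_bounds hp).1 with h | h | h
      · left; linarith
      · right; left; linarith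
      · right; right; linarith
  have e1 : ∀ m : List (ℕ × Bool), m.length = 3 →
      closureSet n (u ++ m ++ v) = C ∪ draw n u.length m := by
    intro m hm
    have el : ((u ++ m ++ v).length : ℝ) = u.length + 3 + v.length := by
      simp only [List.length_append, hm]; push_cast; ring
    rw [closureSet, braidClosure, draw_append, draw_append, hCdef, el]
    simp only [zero_add, ← hb, List.length_append, hm]
    push_cast
    ext p; simp only [Set.mem_union]; tauto
  rw [e1 _ rfl, e1 _ rfl, draw_braid hi, draw_braid' hi]
  exact ambientIsotopic_of_box (k := 3) (c := 3) carries_braid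
    (fun j hj => by have := hj.2; omega) hC

/-- The polygon of a stabilising crossing and the two closing arcs at its strands. -/
def kinkPolygon (e : Bool) : List (LatticePoint × LatticePoint) :=
  [((0, 0, 0), (2, 2, crossingTop e)), ((2, 2, crossingTop e), (4, 4, 0)), ((4, 4, 0), (8, 4, 0)),
   ((8, 4, 0), (8, 4, -8)), ((8, 4, -8), (-8, 4, -8)), ((-8, 4, -8), (-8, 4, 0)), ((-8, 4, 0), (0,
   4, 0)), ((0, 4, 0), (4, 0, 0)), ((4, 0, 0), (8, 0, 0)), ((8, 0, 0), (8, 0, -8)), ((8, 0, -8),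
   (-8, 0, -8)), ((-8, 0, -8), (-8, 0, 0))]

/-- The polygon that replaces `kinkPolygon` after the crossing is removed. -/
def straightPolygon : List (LatticePoint × LatticePoint) :=
  [((0, 0, 0), (4, 0, 0)), ((4, 0, 0), (8, 0, 0)), ((8, 0, 0), (8, 0, -8)), ((8, 0, -8), (-8, 0,
   -8)), ((-8, 0, -8), (-8, 0, 0))]

/-- Reidemeister's first move. The first zone is the half space beyond the last remaining position,
where the closing arc of the removed strand is shrunk to a small loop and untwisted. The second, in
front of the compressed word, lets the remaining bump be straightened. -/
theorem carries_kink (e : Bool) : carries [[(0, 1, 0, 0)], [(1, 0, 0, 0), (0, 1, 0, 4)]]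
    (if e then
      [.vertex (4, 4, 0) (8, 4, 0) (8, 4, -8) (6, 4, -4) 0 [(1, 0, 0, -4), (0, 0, 1, 8)],
       .merge (4, 4, 0) (6, 4, -4) (8, 4, -8) 1 1,
       .vertex (-8, 4, -8) (-8, 4, 0) (0, 4, 0) (-4, 4, -4) 0 [(-1, 0, 0, 0), (0, 0, 1, 8)],
       .merge (-8, 4, -8) (-4, 4, -4) (0, 4, 0) 1 1,
       .vertex (4, 4, 0) (8, 4, -8) (-8, 4, -8) (-2, 4, -4) 0 [(0, 0, -1, 0), (1, 0, -1, 0)],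
       .merge (4, 4, 0) (-2, 4, -4) (-8, 4, -8) 1 1,
       .vertex (4, 4, 0) (-8, 4, -8) (0, 4, 0) (2, 6, -2) 0 [(0, 0, -1, 0)],
       .vertex (4, 4, 0) (2, 6, -2) (0, 4, 0) (2, 6, 0) 0 [(0, 1, 0, -4)],
       .vertex (2, 6, 0) (0, 4, 0) (4, 0, 0) (3, 3, 0) 0 [(-1, -1, -1, 8), (0, 1, -1, 0)],
       .merge (2, 6, 0) (3, 3, 0) (4, 0, 0) 1 1,
       .vertex (4, 4, 0) (2, 6, 0) (4, 0, 0) (4, 2, 0) 0 [(-2, -1, -2, 12), (0, 1, -1, 0)],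
       .merge (4, 4, 0) (4, 2, 0) (4, 0, 0) 1 1,
       .vertex (2, 2, 4) (4, 4, 0) (4, 0, 0) (3, 1, 2) 0 [(1, 0, 0, -2)],
       .merge (2, 2, 4) (3, 1, 2) (4, 0, 0) 1 1,
       .vertex (0, 0, 0) (2, 2, 4) (4, 0, 0) (2, 0, 0) 1 [(-1, 0, 2, 4)],
       .merge (0, 0, 0) (2, 0, 0) (4, 0, 0) 1 1]
    else
      [.vertex (4, 4, 0) (8, 4, 0) (8, 4, -8) (6, 4, -4) 0 [(1, 0, 0, -4), (0, 0, 1, 8)],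
       .merge (4, 4, 0) (6, 4, -4) (8, 4, -8) 1 1,
       .vertex (-8, 4, -8) (-8, 4, 0) (0, 4, 0) (-4, 4, -4) 0 [(-1, 0, 0, 0), (0, 0, 1, 8)],
       .merge (-8, 4, -8) (-4, 4, -4) (0, 4, 0) 1 1,
       .vertex (4, 4, 0) (8, 4, -8) (-8, 4, -8) (-2, 4, -4) 0 [(0, 2, -1, -8), (1, 0, -1, 0)],
       .merge (4, 4, 0) (-2, 4, -4) (-8, 4, -8) 1 1,
       .vertex (4, 4, 0) (-8, 4, -8) (0, 4, 0) (2, 6, -2) 0 [(0, 2, -1, -8)],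
       .vertex (4, 4, 0) (2, 6, -2) (0, 4, 0) (2, 6, 0) 0 [(0, 1, 0, -4)],
       .vertex (2, 6, 0) (0, 4, 0) (4, 0, 0) (3, 3, 0) 0 [(-1, -1, 1, 8), (0, 1, 1, 0)],
       .merge (2, 6, 0) (3, 3, 0) (4, 0, 0) 1 1,
       .vertex (4, 4, 0) (2, 6, 0) (4, 0, 0) (4, 2, 0) 0 [(-2, -1, 2, 12), (0, 1, 1, 0)],
       .merge (4, 4, 0) (4, 2, 0) (4, 0, 0) 1 1,
       .vertex (2, 2, -4) (4, 4, 0) (4, 0, 0) (3, 1, -2) 0 [(1, 0, 0, -2)],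
       .merge (2, 2, -4) (3, 1, -2) (4, 0, 0) 1 1,
       .vertex (0, 0, 0) (2, 2, -4) (4, 0, 0) (2, 0, 0) 1 [(-1, 4, 2, 4)],
       .merge (0, 0, 0) (2, 0, 0) (4, 0, 0) 1 1])
    (kinkPolygon e) straightPolygon = true := by
  revert e; decide

/-- The polygon of a crossing after a box, with the two closing arcs at its strands. -/
def crossingAfter : List (LatticePoint × LatticePoint) :=
  [((4, 0, 0), (6, 2, 4)), ((6, 2, 4), (8, 4, 0)), ((8, 4, 0), (12, 4, 0)), ((12, 4, 0), (12, 4,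
   -8)), ((12, 4, -8), (-8, 4, -8)), ((-8, 4, -8), (-8, 4, 0)), ((-8, 4, 0), (0, 4, 0)), ((4, 4,
   0), (8, 0, 0)), ((8, 0, 0), (12, 0, 0)), ((12, 0, 0), (12, 0, -8)), ((12, 0, -8), (-8, 0, -8)),
   ((-8, 0, -8), (-8, 0, 0)), ((-8, 0, 0), (0, 0, 0))]

/-- The polygon of a crossing before a box, with the two closing arcs at its strands. -/
def crossingBefore : List (LatticePoint × LatticePoint) :=
  [((4, 0, 0), (12, 0, 0)), ((12, 0, 0), (12, 0, -8)), ((12, 0, -8), (-8, 0, -8)), ((-8, 0, -8),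
   (-8, 0, 0)), ((-8, 0, 0), (-4, 0, 0)), ((-4, 0, 0), (-2, 2, 4)), ((-2, 2, 4), (0, 4, 0)), ((4,
   4, 0), (12, 4, 0)), ((12, 4, 0), (12, 4, -8)), ((12, 4, -8), (-8, 4, -8)), ((-8, 4, -8), (-8,
   4, 0)), ((-8, 4, 0), (-4, 4, 0)), ((-4, 4, 0), (0, 0, 0))]

/-- The zones lie behind, in front of and below a word compressed to 0 ≤ x ≤ 1. The strand that
passes over is swung out to a wider track around the word, the other one changes position on the
inner track, and the outer strand then returns in the vacated position. This carries the crossing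
around the closure. -/
theorem carries_conj : carries
    [[(0, 1, 0, 4), (0, -1, 0, 8), (1, 0, 0, -4)], [(0, 1, 0, 4), (0, -1, 0, 8), (-1, 0, 0, 0)],
     [(0, 1, 0, 4), (0, -1, 0, 8), (0, 0, -1, -4)]]
    [.split (12, 4, 0) (12, 4, -4) (12, 4, -8) 1 1,
     .split (-8, 4, -8) (-8, 4, -4) (-8, 4, 0) 1 1,
     .vertex (8, 4, 0) (12, 4, 0) (12, 4, -4) (16, 2, 4) 0 [(1, 1, 1, -12)],
     .vertex (16, 2, 4) (12, 4, -4) (12, 4, -8) (16, 2, -4) 0 [(2, 2, -1, -32), (0, 0, 1, 8)],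
     .vertex (16, 2, -4) (12, 4, -8) (-8, 4, -8) (16, 2, -12) 2 [(1, 5, 0, -12)],
     .vertex (16, 2, -12) (-8, 4, -8) (-8, 4, -4) (-12, 2, -12) 2 [(-1, 4, -4, -40)],
     .vertex (-12, 2, -12) (-8, 4, -4) (-8, 4, 0) (-12, 2, -4) 1 [(-1, 2, -1, -16), (0, 0, 1, 12)],
     .vertex (-12, 2, -4) (-8, 4, 0) (0, 4, 0) (-12, 2, 4) 1 [(0, 2, 1, 0)],
     .merge (16, 2, 4) (16, 2, -4) (16, 2, -12) 1 1,
     .merge (-12, 2, -12) (-12, 2, -4) (-12, 2, 4) 1 1,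
     .vertex (6, 2, 4) (8, 4, 0) (16, 2, 4) (12, 2, 4) 0 [(1, 2, 1, -14), (-1, 0, 0, 16)],
     .merge (6, 2, 4) (12, 2, 4) (16, 2, 4) 2 3,
     .vertex (4, 0, 0) (6, 2, 4) (16, 2, 4) (10, 1, 2) 0 [(-1, -1, 3, 6)],
     .merge (4, 0, 0) (10, 1, 2) (16, 2, 4) 1 1,
     .split (12, 0, 0) (12, 0, -4) (12, 0, -8) 1 1,
     .split (-8, 0, -8) (-8, 0, -4) (-8, 0, 0) 1 1,
     .vertex (4, 4, 0) (8, 0, 0) (12, 0, 0) (8, 2, 0) 0 [(-1, 0, 3, 12), (-1, 0, 0, 12),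
     (1, 0, -3, -4)],
     .merge (4, 4, 0) (8, 2, 0) (12, 0, 0) 1 1,
     .vertex (4, 4, 0) (12, 0, 0) (12, 0, -4) (12, 2, 0) 0 [(0, 0, 1, 4), (-1, 0, 0, 13),
     (1, 0, -3, -4)],
     .vertex (12, 2, 0) (12, 0, -4) (12, 0, -8) (12, 2, -4) 0 [(0, 0, -1, 0), (0, 0, 1, 8),
     (-1, 0, 0, 13)],
     .vertex (12, 2, -4) (12, 0, -8) (-8, 0, -8) (12, 2, -8) 2 [(1, 0, 0, 8), (-1, 0, 0, 13),
     (0, 0, 1, 9)],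
     .vertex (12, 2, -8) (-8, 0, -8) (-8, 0, -4) (-8, 2, -8) 2 [(-1, 0, 0, 12), (0, 0, 1, 9),
     (1, 0, 0, 9)],
     .vertex (-8, 2, -8) (-8, 0, -4) (-8, 0, 0) (-8, 2, -4) 1 [(0, 0, -1, 0), (0, 0, 1, 8),
     (1, 0, 0, 9)],
     .vertex (-8, 2, -4) (-8, 0, 0) (0, 0, 0) (-8, 2, 0) 1 [(0, 0, 1, 4), (1, -5, 0, 19)],
     .merge (12, 2, 0) (12, 2, -4) (12, 2, -8) 1 1,
     .merge (-8, 2, -8) (-8, 2, -4) (-8, 2, 0) 1 1,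
     .split (12, 2, 0) (12, 2, -4) (12, 2, -8) 1 1,
     .split (-8, 2, -8) (-8, 2, -4) (-8, 2, 0) 1 1,
     .vertex (4, 4, 0) (12, 2, 0) (12, 2, -4) (12, 4, 0) 0 [(0, 0, 1, 4), (-1, 5, 0, 3)],
     .vertex (12, 4, 0) (12, 2, -4) (12, 2, -8) (12, 4, -4) 0 [(0, 0, -1, 0), (0, 0, 1, 8),
     (-1, 0, 0, 13)],
     .vertex (12, 4, -4) (12, 2, -8) (-8, 2, -8) (12, 4, -8) 2 [(1, 0, 0, 8), (-1, 0, 0, 13),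
     (0, 0, 1, 9)],
     .vertex (12, 4, -8) (-8, 2, -8) (-8, 2, -4) (-8, 4, -8) 2 [(-1, 0, 0, 12), (0, 0, 1, 9),
     (1, 0, 0, 9)],
     .vertex (-8, 4, -8) (-8, 2, -4) (-8, 2, 0) (-8, 4, -4) 1 [(0, 0, -1, 0), (0, 0, 1, 8),
     (1, 0, 0, 9)],
     .vertex (-8, 4, -4) (-8, 2, 0) (0, 0, 0) (-8, 4, 0) 1 [(0, 0, 1, 4), (1, 0, 0, 9),
     (-1, 0, -3, 0)],
     .split (-8, 4, 0) (-4, 2, 0) (0, 0, 0) 1 1,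
     .vertex (-8, 4, 0) (-4, 2, 0) (0, 0, 0) (-4, 4, 0) 1 [(1, 0, 3, 8), (1, 0, 0, 8),
     (-1, 0, -3, 0)],
     .merge (12, 4, 0) (12, 4, -4) (12, 4, -8) 1 1,
     .merge (-8, 4, -8) (-8, 4, -4) (-8, 4, 0) 1 1,
     .split (-12, 2, 4) (-6, 3, 2) (0, 4, 0) 1 1,
     .vertex (-12, 2, 4) (-6, 3, 2) (0, 4, 0) (-2, 2, 4) 1 [(1, 1, 3, -2)],
     .split (-12, 2, 4) (-8, 2, 4) (-2, 2, 4) 3 2,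
     .vertex (-12, 2, 4) (-8, 2, 4) (-2, 2, 4) (-4, 0, 0) 1 [(-1, -2, 1, -2), (1, 0, 0, 12)],
     .split (16, 2, 4) (16, 2, -4) (16, 2, -12) 1 1,
     .split (-12, 2, -12) (-12, 2, -4) (-12, 2, 4) 1 1,
     .vertex (4, 0, 0) (16, 2, 4) (16, 2, -4) (12, 0, 0) 0 [(0, -2, 1, 8)],
     .vertex (12, 0, 0) (16, 2, -4) (16, 2, -12) (12, 0, -4) 0 [(1, -2, -1, -12), (0, 0, 1, 12)],
     .vertex (12, 0, -4) (16, 2, -12) (-12, 2, -12) (12, 0, -8) 2 [(1, -4, -4, -28)],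
     .vertex (12, 0, -8) (-12, 2, -12) (-12, 2, -4) (-8, 0, -8) 2 [(-1, -5, 0, 12)],
     .vertex (-8, 0, -8) (-12, 2, -4) (-12, 2, 4) (-8, 0, -4) 1 [(-2, -2, -1, -16), (0, 0, 1, 8)],
     .vertex (-8, 0, -4) (-12, 2, 4) (-4, 0, 0) (-8, 0, 0) 1 [(-1, -1, 1, -4)],
     .merge (12, 0, 0) (12, 0, -4) (12, 0, -8) 1 1,
     .merge (-8, 0, -8) (-8, 0, -4) (-8, 0, 0) 1 1]
    crossingAfter crossingBefore = true := by
  decide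

/-! ### Removing the last strand, and conjugation by a generator. -/

theorem strandsOn_singleton (i : ℕ) (x x' : ℝ) : strandsOn {i} x x' =
    segment ℝ ((x, (i : ℝ), 0) : Space) (x', (i : ℝ), 0) := by
  ext p; simp [strandsOn]

theorem arcsOn_singleton (i : ℕ) (a b : ℝ) : arcsOn {i} a b =
    segment ℝ ((b, (i : ℝ), 0) : Space) (b, (i : ℝ), -2) ∪
      segment ℝ ((b, (i : ℝ), -2) : Space) (a, (i : ℝ), -2) ∪
      segment ℝ ((a, (i : ℝ), -2) : Space) (a, (i : ℝ), 0) := by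
  ext p; simp [arcsOn]

theorem lt_succ_eq (n : ℕ) : {j | j < n + 1} = {j | j < n} ∪ {n} := by
  ext j; simp only [Set.mem_ofPred_eq, Set.mem_union, Set.mem_singleton_iff]; omega

/-- A word that never uses the extra last position leaves a straight strand there. The lead-in over
[a, x] is included because the drawing of an empty word is empty. -/
theorem strandsOn_union_draw_succ {n : ℕ} {w : List (ℕ × Bool)} (hw : Valid n w) {a x : ℝ}
    (ha : a ≤ x) : strandsOn {n} a x ∪ draw (n + 1) x w =
      strandsOn {n} a (x + w.length) ∪ draw n x w := by
  induction w generalizing x with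
  | nil => simp [draw]
  | cons g w ih =>
    have hg := hw g (by simp)
    have ho : others (n + 1) g.1 = others n g.1 ∪ {n} := by
      ext j
      simp only [others, Set.mem_ofPred_eq, Set.mem_union, Set.mem_singleton_iff]; omega
    have := ih (x := x + 1) (fun g hg => hw g (by simp [hg])) (by linarith)
    rw [← strandsOn_trans {n} ha (by linarith : x ≤ x + 1)] at this
    simp only [draw, letterSet, ho, strandsOn_union, List.length_cons]
    push_cast
    rw [add_comm (w.length : ℝ) 1, ← add_assoc]
    ext p
    have := Set.ext_iff.1 this p
    simp only [Set.mem_union] at this ⊢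
    tauto

theorem ambientIsotopic_kink {m : ℕ} {A : Set Space} (hA : ∀ p ∈ A, p.1 ≤ 0 ∧ p.2.1 ≤ m)
    (e : Bool) :
    AmbientIsotopic (A ∪ strandsOn {j | j < m} 0 2 ∪ arcsOn {j | j < m} (-2) 2 ∪
        placed (0, (m : ℝ), 0) (kinkPolygon e))
      (A ∪ strandsOn {j | j < m} 0 2 ∪ arcsOn {j | j < m} (-2) 2 ∪
        placed (0, (m : ℝ), 0) straightPolygon) := by
  refine ambientIsotopic_of_carries (carries_kink e) _ fun p hp => ?_
  have hp' : p.1 ≤ 0 ∧ p.2.1 ≤ m ∨ p.2.1 ≤ m - 1 := by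
    have hj : ∀ j ∈ {j | j < m}, (j : ℝ) ≤ m - 1 := by
      intro j hj
      have : (j : ℝ) + 1 ≤ m := by exact_mod_cast hj
      linarith
    rcases hp with (hp | hp) | hp
    · exact Or.inl (hA p hp)
    · obtain ⟨j, h, -, -, h'⟩ := (mem_strandsOn (by norm_num)).1 hp
      rw [h']; exact Or.inr (hj j h)
    · obtain ⟨j, h, h'⟩ := (arcsOn_bounds hp).2
      rw [h']; exact Or.inr (hj j h)
  simp only [region, Set.mem_ofPred_eq, List.mem_cons, List.not_mem_nil, or_false,
    exists_eq_or_imp, exists_eq_left, forall_eq_or_imp, forall_eq, AffineForm.evalAt,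
    Prod.fst_sub, Prod.snd_sub]
  push_cast
  rcases hp' with ⟨h, h'⟩ | h
  · rintro (h1 | ⟨h1, h2⟩) <;> linarith
  · rintro (h1 | ⟨h1, h2⟩) <;> linarith

set_option maxHeartbeats 1000000 in
/-- Removing the last strand together with its only crossing. -/
theorem closureSet_destabilize {m : ℕ} {w : List (ℕ × Bool)} (hw : Valid (m + 1) w) (e : Bool) :
    AmbientIsotopic (closureSet (m + 2) (w ++ [(m, e)])) (closureSet (m + 1) w) := by
  have hl : (0 : ℝ) ≤ w.length := by positivity
  have hw' : Valid (m + 2) (w ++ [(m, e)]) := by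
    intro g hg
    rcases List.mem_append.1 hg with hg | hg
    · have := hw g hg; omega
    · rw [List.mem_singleton.1 hg]; simp
  have h1 : (0 : ℝ) < w.length + 1 := by linarith
  have h2 : (0 : ℝ) < 1 := one_pos
  -- The slab from -1 to the end of the word is compressed to [-1, 0]. Starting at -1 rather than 0
  -- keeps its width positive for the empty word.
  set Φ := stretchHomeomorph (-1) _ _ h1 h2 with hΦ
  set D : Set Space := strandsOn {j | j < m + 1} (-2) 0 ∪ draw (m + 1) 0 w with hD
  have s₁ : stretch (-1) (w.length + 1) 1 (-2) = -2 := stretch_of_le (by norm_num)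
  have s₂ : stretch (-1) (w.length + 1) 1 w.length = 0 := by
    rw [stretch_of_ge h1 (by linarith)]; ring
  have s₃ : stretch (-1) (w.length + 1) 1 (w.length + 1) = 1 := by
    rw [stretch_of_ge h1 (by linarith)]; ring
  have s₄ : stretch (-1) (w.length + 1) 1 (w.length + 2) = 2 := by
    rw [stretch_of_ge h1 (by linarith)]; ring
  have hA : ∀ p ∈ Φ '' D, p.1 ≤ 0 ∧ p.2.1 ≤ m := by
    rintro _ ⟨p, hp, rfl⟩
    have : p.1 ≤ w.length ∧ p.2.1 ≤ m := by
      rcases hp with hp | hp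
      · obtain ⟨j, h, -, h', h''⟩ := (mem_strandsOn (by norm_num)).1 hp
        have : (j : ℝ) ≤ m := by exact_mod_cast Nat.lt_succ_iff.1 h
        rw [h'']
        exact ⟨by linarith, this⟩
      · obtain ⟨-, h, h', -⟩ := draw_bounds hw hp
        push_cast at h'
        exact ⟨by linarith, by linarith⟩
    refine ⟨?_, this.2⟩
    have h := stretch_monotone (p := -1) h1 h2 this.1
    rwa [s₂] at h
  have ho : others (m + 2) m = {j | j < m} := by
    ext j; simp only [others, Set.mem_ofPred_eq]; omega
  have hletter : Φ '' letterSet (m + 2) w.length (m, e) =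
      crossing 0 m e ∪ strandsOn {j | j < m} 0 1 := by
    rw [hΦ, stretch_image_of_ge h1 h2 (fun q hq => by
      linarith [(letterSet_bounds (by simp) hq).1]), letterSet, ho]
    simp only [Set.image_union, translation_crossing, translation_strandsOn]
    congr 2 <;> ring_nf
  have e1 : Φ '' braidClosure (m + 2) (-2) 0 (w ++ [(m, e)]) (w.length + 2) =
      Φ '' D ∪ strandsOn {j | j < m} 0 2 ∪ arcsOn {j | j < m} (-2) 2 ∪
        placed (0, (m : ℝ), 0) (kinkPolygon e) := by
    have h := strandsOn_union_draw_succ hw (by norm_num : (-2 : ℝ) ≤ 0)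
    have : braidClosure (m + 2) (-2) 0 (w ++ [(m, e)]) (w.length + 2) = D ∪
        (strandsOn {m + 1} (-2) w.length ∪ letterSet (m + 2) w.length (m, e) ∪
          strandsOn {j | j < m + 1 + 1} (w.length + 1) (w.length + 2) ∪
          arcsOn {j | j < m + 1 + 1} (-2) (w.length + 2)) := by
      rw [braidClosure, draw_append, hD]
      simp only [draw, lt_succ_eq (m + 1), strandsOn_union, List.length_append, List.length_cons,
        List.length_nil]
      push_cast
      simp only [zero_add] at h ⊢
      ext p
      have := Set.ext_iff.1 h p
      simp only [Set.mem_union, Set.mem_empty_iff_false] at this ⊢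
      tauto
    rw [this]
    simp only [Set.image_union, hletter]
    rw [stretch_strandsOn h1 h2 _ (by linarith), stretch_strandsOn h1 h2 _ (by linarith),
      stretch_arcsOn h1 h2 _ (by linarith), s₁, s₂, s₃, s₄,
      ← strandsOn_trans {j | j < m} (zero_le_one : (0 : ℝ) ≤ 1) (by norm_num : (1 : ℝ) ≤ 2)]
    simp only [lt_succ_eq (m + 1), lt_succ_eq m, strandsOn_union, arcsOn_union, kinkPolygon,
      placed_cons, placed_nil, strandsOn_singleton, arcsOn_singleton, crossing]
    have k : ∀ e, ((crossingTop e : ℤ) : ℝ) / 4 = if e then 1 else -1 := by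
      intro e; cases e <;> norm_num [crossingTop]
    simp only [zero_add, k]
    norm_num
    ring_nf
    refine Set.Subset.antisymm ?_ ?_ <;> simp only [Set.union_subset_iff] <;>
      (repeat' apply And.intro) <;> (intro p hp; simp only [Set.mem_union]; tauto)
  have e2 : Φ '' braidClosure (m + 1) (-2) 0 w (w.length + 2) =
      Φ '' D ∪ strandsOn {j | j < m} 0 2 ∪ arcsOn {j | j < m} (-2) 2 ∪
        placed (0, (m : ℝ), 0) straightPolygon := by
    rw [braidClosure, ← hD]
    simp only [Set.image_union, zero_add]
    rw [stretch_strandsOn h1 h2 _ (by linarith), stretch_arcsOn h1 h2 _ (by linarith), s₁, s₂, s₄,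
      lt_succ_eq m, strandsOn_union, arcsOn_union,
      ← strandsOn_trans {m} (zero_le_one : (0 : ℝ) ≤ 1) (by norm_num : (1 : ℝ) ≤ 2)]
    simp only [straightPolygon, placed_cons, placed_nil, strandsOn_singleton, arcsOn_singleton]
    norm_num
    ring_nf
    ext p; simp only [Set.mem_union]; tauto
  have key : AmbientIsotopic (braidClosure (m + 2) (-2) 0 (w ++ [(m, e)]) (w.length + 2))
      (braidClosure (m + 1) (-2) 0 w (w.length + 2)) := by
    refine AmbientIsotopic.of_image Φ ?_
    rw [e1, e2]
    exact ambientIsotopic_kink hA e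
  exact (braidClosure_isotopic hw' (by norm_num) (by simp)).symm.trans
    (key.trans (braidClosure_isotopic hw (by norm_num) (by linarith)))

theorem ambientIsotopic_conj {i : ℕ} {J : Set ℕ} (hJ : ∀ j ∈ J, j + 1 ≤ i ∨ i + 2 ≤ j)
    {A : Set Space} (hA : ∀ p ∈ A, 0 ≤ p.1 ∧ p.1 ≤ 1 ∧ -1 ≤ p.2.2) :
    AmbientIsotopic (A ∪ strandsOn J (-2) 0 ∪ strandsOn J 1 3 ∪ arcsOn J (-2) 3 ∪
        placed (0, (i : ℝ), 0) crossingAfter)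
      (A ∪ strandsOn J (-2) 0 ∪ strandsOn J 1 3 ∪ arcsOn J (-2) 3 ∪
        placed (0, (i : ℝ), 0) crossingBefore) := by
  refine ambientIsotopic_of_carries carries_conj _ fun p hp => ?_
  have hp' : (0 ≤ p.1 ∧ p.1 ≤ 1 ∧ -1 ≤ p.2.2) ∨ p.2.1 ≤ i - 1 ∨ (i : ℝ) + 2 ≤ p.2.1 := by
    have hj : ∀ j ∈ J, (j : ℝ) ≤ i - 1 ∨ (i : ℝ) + 2 ≤ j := by
      intro j hj
      rcases hJ j hj with h | h
      · left
        have : (j : ℝ) + 1 ≤ i := by exact_mod_cast h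
        linarith
      · right; exact_mod_cast h
    rcases hp with ((hp | hp) | hp) | hp
    · exact Or.inl (hA p hp)
    · obtain ⟨j, h, -, -, h'⟩ := (mem_strandsOn (by norm_num)).1 hp
      rw [h']; exact Or.inr (hj j h)
    · obtain ⟨j, h, -, -, h'⟩ := (mem_strandsOn (by norm_num)).1 hp
      rw [h']; exact Or.inr (hj j h)
    · obtain ⟨j, h, h'⟩ := (arcsOn_bounds hp).2
      rw [h']; exact Or.inr (hj j h)
  simp only [region, Set.mem_ofPred_eq, List.mem_cons, List.not_mem_nil, or_false,
    exists_eq_or_imp, exists_eq_left, forall_eq_or_imp, forall_eq, AffineForm.evalAt,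
    Prod.fst_sub, Prod.snd_sub]
  push_cast
  rcases hp' with ⟨h, h', h''⟩ | h | h <;>
    rintro (⟨h1, h2, h3⟩ | ⟨h1, h2, h3⟩ | ⟨h1, h2, h3⟩) <;> linarith

set_option maxHeartbeats 1000000 in
/-- Conjugation of a closed braid by a positive generator. -/
theorem closureSet_rotate_positive {n : ℕ} {w : List (ℕ × Bool)} (hw : Valid n w) {i : ℕ}
    (hi : i + 1 < n) :
    AmbientIsotopic (closureSet n (w ++ [(i, true)])) (closureSet n ((i, true) :: w)) := by
  -- The empty word cannot be compressed to width 1 by a stretch, but then both sides are literally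
  -- the same.
  rcases eq_or_ne w [] with rfl | hne
  · exact AmbientIsotopic.refl _
  have hl : (1 : ℝ) ≤ w.length := by exact_mod_cast List.length_pos_iff.2 hne
  have hw₁ : Valid n (w ++ [(i, true)]) := by
    intro g hg
    rcases List.mem_append.1 hg with hg | hg
    · exact hw g hg
    · rw [List.mem_singleton.1 hg]; exact hi
  have hw₂ : Valid n ((i, true) :: w) := by
    intro g hg
    rcases List.mem_cons.1 hg with rfl | hg
    · exact hi
    · exact hw g hg
  have h1 : (0 : ℝ) < w.length := by linarith
  have h2 : (0 : ℝ) < 1 := one_pos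
  set Φ := stretchHomeomorph 0 _ _ h1 h2 with hΦ
  have s₁ : stretch 0 w.length 1 (-2) = -2 := stretch_of_le (by norm_num)
  have s₁' : stretch 0 w.length 1 (-1) = -1 := stretch_of_le (by norm_num)
  have s₀ : stretch 0 w.length 1 0 = 0 := stretch_of_le le_rfl
  have s₂ : stretch 0 w.length 1 w.length = 1 := by
    rw [stretch_of_ge h1 (by linarith)]; ring
  have s₃ : stretch 0 w.length 1 (w.length + 1) = 2 := by
    rw [stretch_of_ge h1 (by linarith)]; ring
  have s₄ : stretch 0 w.length 1 (w.length + 2) = 3 := by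
    rw [stretch_of_ge h1 (by linarith)]; ring
  have hA : ∀ p ∈ Φ '' draw n 0 w, 0 ≤ p.1 ∧ p.1 ≤ 1 ∧ -1 ≤ p.2.2 := by
    rintro _ ⟨p, hp, rfl⟩
    obtain ⟨h, h', -, h'', -⟩ := draw_bounds hw hp
    have k := stretch_monotone (p := 0) h1 h2 h
    have k' := stretch_monotone (p := 0) h1 h2 h'
    rw [s₀] at k
    rw [zero_add, s₂] at k'
    exact ⟨k, k', h''⟩
  have hletter : Φ '' letterSet n w.length (i, true) =
      crossing 1 i true ∪ strandsOn (others n i) 1 2 := by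
    rw [hΦ, stretch_image_of_ge h1 h2 (fun q hq => by
      linarith [(letterSet_bounds (g := (i, true)) hi hq).1]), letterSet]
    simp only [Set.image_union, translation_crossing, translation_strandsOn]
    congr 2 <;> ring_nf
  have hletter' : Φ '' letterSet n (-1) (i, true) =
      crossing (-1) i true ∪ strandsOn (others n i) (-1) 0 := by
    rw [hΦ, stretch_image_of_le h1 h2 (fun q hq => by
      linarith [(letterSet_bounds (g := (i, true)) hi hq).2.1]), letterSet]
    norm_num
  have e1 : Φ '' braidClosure n (-2) 0 (w ++ [(i, true)]) (w.length + 2) =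
      Φ '' draw n 0 w ∪ strandsOn (others n i) (-2) 0 ∪ strandsOn (others n i) 1 3 ∪
        arcsOn (others n i) (-2) 3 ∪ placed (0, (i : ℝ), 0) crossingAfter := by
    rw [braidClosure, draw_append]
    simp only [draw, Set.image_union, zero_add, hletter, Set.union_empty,
      List.length_append, List.length_cons, List.length_nil]
    push_cast
    rw [stretch_strandsOn h1 h2 _ (by linarith), stretch_strandsOn h1 h2 _ (by linarith),
      stretch_arcsOn h1 h2 _ (by linarith), s₀, s₁, s₃, s₄,
      ← strandsOn_trans (others n i) (by norm_num : (1 : ℝ) ≤ 2) (by norm_num : (2 : ℝ) ≤ 3)]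
    simp only [lt_eq_others_union hi, strandsOn_union, Set.insert_eq,
      arcsOn_union, crossingAfter, placed_cons, placed_nil, arcsOn_singleton, strandsOn_singleton,
      crossing]
    push_cast
    norm_num
    ring_nf
    refine Set.Subset.antisymm ?_ ?_ <;> simp only [Set.union_subset_iff] <;>
      (repeat' apply And.intro) <;> (intro p hp; simp only [Set.mem_union]; tauto)
  have e2 : Φ '' braidClosure n (-2) (-1) ((i, true) :: w) (w.length + 2) =
      Φ '' draw n 0 w ∪ strandsOn (others n i) (-2) 0 ∪ strandsOn (others n i) 1 3 ∪
        arcsOn (others n i) (-2) 3 ∪ placed (0, (i : ℝ), 0) crossingBefore := by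
    rw [braidClosure_cons]
    simp only [Set.image_union, hletter', neg_add_cancel, zero_add]
    rw [stretch_strandsOn h1 h2 _ (by linarith), stretch_strandsOn h1 h2 _ (by linarith),
      stretch_arcsOn h1 h2 _ (by linarith), s₁', s₁, s₂, s₄,
      ← strandsOn_trans (others n i) (by norm_num : (-2 : ℝ) ≤ -1) (by norm_num : (-1 : ℝ) ≤ 0)]
    simp only [lt_eq_others_union hi, strandsOn_union, Set.insert_eq,
      arcsOn_union, crossingBefore, placed_cons, placed_nil, arcsOn_singleton, strandsOn_singleton,
      crossing]
    push_cast
    norm_num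
    ring_nf
    refine Set.Subset.antisymm ?_ ?_ <;> simp only [Set.union_subset_iff] <;>
      (repeat' apply And.intro) <;> (intro p hp; simp only [Set.mem_union]; tauto)
  have key : AmbientIsotopic (braidClosure n (-2) 0 (w ++ [(i, true)]) (w.length + 2))
      (braidClosure n (-2) (-1) ((i, true) :: w) (w.length + 2)) := by
    refine AmbientIsotopic.of_image Φ ?_
    rw [e1, e2]
    exact ambientIsotopic_conj (fun j hj => by have := hj.2; omega) hA
  exact (braidClosure_isotopic hw₁ (by norm_num) (by simp)).symm.trans
    (key.trans (braidClosure_isotopic hw₂ (by norm_num)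
      (by simp only [List.length_cons]; push_cast; linarith)))

/-! ### Conjugation and cancellation for arbitrary words, and the half turn. -/

theorem Valid.append {n : ℕ} {u v : List (ℕ × Bool)} (hu : Valid n u) (hv : Valid n v) :
    Valid n (u ++ v) := by
  intro g hg
  rcases List.mem_append.1 hg with h | h
  exacts [hu g h, hv g h]

theorem Valid.cons {n : ℕ} {g : ℕ × Bool} {v : List (ℕ × Bool)} (hg : g.1 + 1 < n)
    (hv : Valid n v) : Valid n (g :: v) := by
  intro k hk
  rcases List.mem_cons.1 hk with rfl | h
  exacts [hg, hv k h]

theorem Valid.left {n : ℕ} {u v : List (ℕ × Bool)} (h : Valid n (u ++ v)) : Valid n u :=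
  fun g hg => h g (List.mem_append_left _ hg)

theorem Valid.right {n : ℕ} {u v : List (ℕ × Bool)} (h : Valid n (u ++ v)) : Valid n v :=
  fun g hg => h g (List.mem_append_right _ hg)

theorem valid_nil (n : ℕ) : Valid n [] := fun _ h => absurd h List.not_mem_nil

/-- For an inverse letter, with s the generator: w s⁻¹ ~ s s⁻¹ w s⁻¹ ~ s⁻¹ w s⁻¹ s ~ s⁻¹ w, where
only s itself is moved around the closure. -/
theorem closureSet_rotate_letter {n : ℕ} {w : List (ℕ × Bool)} (hw : Valid n w) {g : ℕ × Bool}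
    (hg : g.1 + 1 < n) : AmbientIsotopic (closureSet n (w ++ [g])) (closureSet n (g :: w)) := by
  obtain ⟨i, e⟩ := g
  have hs : Valid n [(i, false)] := Valid.cons hg (valid_nil n)
  cases e with
  | true => exact closureSet_rotate_positive hw hg
  | false =>
    have h1 := closureSet_append_cancel (Valid.cons hg hw : Valid n ((i, false) :: w)) hg false
    have h2 := closureSet_rotate_positive
      ((Valid.cons hg hw : Valid n ((i, false) :: w)).append hs) hg
    have h3 := closureSet_cons_cancel (hw.append hs) hg true
    simp only [List.cons_append, List.append_assoc, List.nil_append, Bool.not_true,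
      Bool.not_false] at h1 h2 h3
    exact h3.symm.trans (h2.symm.trans h1)

theorem closureSet_rotate {n : ℕ} {u v : List (ℕ × Bool)} (hu : Valid n u) (hv : Valid n v) :
    AmbientIsotopic (closureSet n (u ++ v)) (closureSet n (v ++ u)) := by
  induction u generalizing v with
  | nil => simpa using AmbientIsotopic.refl _
  | cons g u ih =>
    have hg := hu g (by simp)
    have hu' : Valid n u := fun k hk => hu k (by simp [hk])
    have hs : Valid n [g] := Valid.cons hg (valid_nil n)
    have h1 := closureSet_rotate_letter (hu'.append hv) hg
    have h2 := ih hu' (hv.append hs)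
    simp only [List.cons_append, List.append_assoc, List.nil_append] at h1 h2 ⊢
    exact h1.symm.trans h2

theorem closureSet_cancel {n : ℕ} {u v : List (ℕ × Bool)} (hu : Valid n u) (hv : Valid n v)
    {i : ℕ} (hi : i + 1 < n) (e : Bool) :
    AmbientIsotopic (closureSet n (u ++ (i, e) :: (i, !e) :: v)) (closureSet n (u ++ v)) := by
  have h1 := closureSet_rotate hu (Valid.cons (g := (i, e)) hi (Valid.cons (g := (i, !e)) hi hv))
  have h2 := closureSet_cons_cancel (hv.append hu) hi e
  exact h1.trans (h2.trans (closureSet_rotate hv hu))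

/-- Rotation about the vertical axis by the angle `θ`. -/
noncomputable def rotation (θ : ℝ) : Space ≃ₜ Space where
  toFun p := (Real.cos θ * p.1 - Real.sin θ * p.2.1, Real.sin θ * p.1 + Real.cos θ * p.2.1, p.2.2)
  invFun p := (Real.cos θ * p.1 + Real.sin θ * p.2.1, -Real.sin θ * p.1 + Real.cos θ * p.2.1, p.2.2)
  left_inv p := by
    have := Real.sin_sq_add_cos_sq θ
    refine Prod.ext ?_ (Prod.ext ?_ rfl) <;> dsimp only
    · linear_combination p.1 * this
    · linear_combination p.2.1 * this
  right_inv p := by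
    have := Real.sin_sq_add_cos_sq θ
    refine Prod.ext ?_ (Prod.ext ?_ rfl) <;> dsimp only
    · linear_combination p.1 * this
    · linear_combination p.2.1 * this
  continuous_toFun := by fun_prop
  continuous_invFun := by fun_prop

/-- A rotation has unbounded displacement, so the Alexander trick does not apply; varying the angle
gives the isotopy. -/
theorem ambientIsotopic_rotation (θ : ℝ) (K : Set Space) :
    AmbientIsotopic K (rotation θ '' K) := by
  refine ⟨fun t => rotation (t * θ), ?_, ?_, ?_⟩
  · change Continuous fun p : unitInterval × Space =>
      (Real.cos (p.1 * θ) * p.2.1 - Real.sin (p.1 * θ) * p.2.2.1,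
        Real.sin (p.1 * θ) * p.2.1 + Real.cos (p.1 * θ) * p.2.2.1, p.2.2.2)
    fun_prop
  · intro p; simp [rotation]
  · simp

/-- The half turn `(x, y, z) ↦ (-x, c - y, z)`. -/
noncomputable def halfTurn (c : ℝ) : Space ≃ₜ Space :=
  (rotation Real.pi).trans (translation (0, c, 0))

theorem halfTurn_apply (c : ℝ) (p : Space) : halfTurn c p = (-p.1, c - p.2.1, p.2.2) := by
  simp [halfTurn, rotation, sub_eq_add_neg]

theorem ambientIsotopic_halfTurn (c : ℝ) (K : Set Space) : AmbientIsotopic K (halfTurn c '' K) := by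
  have : halfTurn c '' K = translation (0, c, 0) '' (rotation Real.pi '' K) := by
    rw [Set.image_image]; rfl
  rw [this]
  exact (ambientIsotopic_rotation _ _).trans (ambientIsotopic_translation _ _)

theorem halfTurn_segment (c x y z x' y' z' : ℝ) :
    halfTurn c '' segment ℝ ((x, y, z) : Space) (x', y', z') =
      segment ℝ ((-x', c - y', z') : Space) (-x, c - y, z) := by
  rw [segment_symm, show ((-x', c - y', z') : Space) = halfTurn c (x', y', z') by
    rw [halfTurn_apply], show ((-x, c - y, z) : Space) = halfTurn c (x, y, z) by
    rw [halfTurn_apply]]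
  refine image_segment_of_combo fun s t hs ht hst => ?_
  simp only [halfTurn_apply]
  refine Prod.ext ?_ (Prod.ext ?_ ?_)
  · simp; ring
  · simp only [Prod.snd_add, Prod.fst_add, Prod.smul_fst, Prod.smul_snd, smul_eq_mul]
    linear_combination (-c) * hst
  · simp

/-- The word of the braid turned upside down. -/
def flipWord (n : ℕ) (w : List (ℕ × Bool)) : List (ℕ × Bool) :=
  (w.map fun g => (n - 2 - g.1, g.2)).reverse

theorem Valid.flipWord {n : ℕ} {w : List (ℕ × Bool)} (hw : Valid n w) :
    Valid n (flipWord n w) := by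
  intro g hg
  obtain ⟨k, hk, rfl⟩ := List.mem_map.1 (List.mem_reverse.1 hg)
  have := hw k hk
  simp only; omega

theorem halfTurn_strandsOn {n : ℕ} {J J' : Set ℕ} (hJ : ∀ j ∈ J, j < n) (hJ' : ∀ j ∈ J', j < n)
    (h : ∀ j < n, j ∈ J' ↔ n - 1 - j ∈ J) (x x' : ℝ) :
    halfTurn (n - 1) '' strandsOn J x x' = strandsOn J' (-x') (-x) := by
  have hc : ∀ j < n, ((n - 1 - j : ℕ) : ℝ) = n - 1 - j := by
    intro j hj
    rw [Nat.sub_sub, Nat.cast_sub (by omega)]; push_cast; ring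
  have e : ∀ J x x', strandsOn J x x' =
      ⋃ j ∈ J, segment ℝ ((x, (j : ℝ), 0) : Space) (x', (j : ℝ), 0) := by
    intro J x x'; ext p; simp [strandsOn]
  rw [e, e, Set.image_iUnion₂]
  simp only [halfTurn_segment]
  ext p
  simp only [Set.mem_iUnion, exists_prop]
  constructor
  · rintro ⟨j, hj, hp⟩
    have hj' := hJ j hj
    refine ⟨n - 1 - j, (h _ (by omega)).2 (by rwa [show n - 1 - (n - 1 - j) = j by omega]), ?_⟩
    rwa [hc j hj']
  · rintro ⟨j, hj, hp⟩
    have hj' := hJ' j hj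
    refine ⟨n - 1 - j, (h _ hj').1 hj, ?_⟩
    rwa [hc j hj', sub_sub_cancel]

theorem halfTurn_arcsOn (n : ℕ) (a b : ℝ) :
    halfTurn (n - 1) '' arcsOn {j | j < n} a b = arcsOn {j | j < n} (-b) (-a) := by
  have hc : ∀ j < n, ((n - 1 - j : ℕ) : ℝ) = n - 1 - j := by
    intro j hj
    rw [Nat.sub_sub, Nat.cast_sub (by omega)]; push_cast; ring
  rw [arcsOn_eq_iUnion, arcsOn_eq_iUnion, Set.image_iUnion₂]
  simp only [Set.image_union, halfTurn_segment]
  ext p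
  simp only [Set.mem_iUnion, exists_prop, Set.mem_ofPred_eq]
  constructor
  · rintro ⟨j, hj, hp⟩
    refine ⟨n - 1 - j, by omega, ?_⟩
    rw [hc j hj]
    simp only [Set.mem_union] at hp ⊢
    tauto
  · rintro ⟨j, hj, hp⟩
    refine ⟨n - 1 - j, by omega, ?_⟩
    rw [hc j hj, sub_sub_cancel]
    simp only [Set.mem_union] at hp ⊢
    tauto

/-- Both horizontal directions are reversed and heights are kept. The upper strand still rises in
position from left to right, so the sign of the crossing survives. -/
theorem halfTurn_letterSet {n : ℕ} (x : ℝ) {g : ℕ × Bool} (hg : g.1 + 1 < n) :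
    halfTurn (n - 1) '' letterSet n x g = letterSet n (-(x + 1)) (n - 2 - g.1, g.2) := by
  have hc : ((n - 2 - g.1 : ℕ) : ℝ) = n - 2 - g.1 := by
    rw [Nat.sub_sub, Nat.cast_sub (by omega)]; push_cast; ring
  rw [letterSet, letterSet, Set.image_union, halfTurn_strandsOn (n := n) (fun j hj => hj.1)
    (fun j hj => hj.1) (J' := others n (n - 2 - g.1)) (fun j hj => by
      simp only [others, Set.mem_ofPred_eq]; omega), crossing, crossing]
  simp only [Set.image_union, halfTurn_segment, hc]
  ring_nf
  ext p; simp only [Set.mem_union]; tauto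

theorem halfTurn_draw {n : ℕ} (x : ℝ) {w : List (ℕ × Bool)} (hw : Valid n w) :
    halfTurn (n - 1) '' draw n x w = draw n (-(x + w.length)) (flipWord n w) := by
  induction w generalizing x with
  | nil => simp [draw, flipWord]
  | cons g w ih =>
    have := ih (x + 1) (fun k hk => hw k (by simp [hk]))
    simp only [draw, Set.image_union, this, halfTurn_letterSet x (hw g (by simp)), flipWord,
      List.map_cons, List.reverse_cons, draw_append, List.length_reverse, List.length_map,
      List.length_cons, Set.union_empty]
    push_cast
    rw [Set.union_comm]
    congr 2 <;> ring

/-- Exchanges the first and the last generator, so that destabilisation is needed at one end only.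
-/
theorem closureSet_flip {n : ℕ} {w : List (ℕ × Bool)} (hw : Valid n w) :
    AmbientIsotopic (closureSet n w) (closureSet n (flipWord n w)) := by
  have hl : (0 : ℝ) ≤ w.length := by positivity
  have hlen : (flipWord n w).length = w.length := by simp [flipWord]
  -- The left margin becomes the right margin after the half turn, and that one has to be positive.
  have h1 := braidClosure_isotopic (a := -1) (x := 0) (b := w.length + 1) hw (by norm_num)
    (by linarith)
  refine h1.symm.trans ((ambientIsotopic_halfTurn (n - 1) _).trans ?_)
  have : halfTurn (n - 1) '' braidClosure n (-1) 0 w (w.length + 1) =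
      braidClosure n (-(w.length + 1)) (-w.length) (flipWord n w) 1 := by
    have hs : ∀ x x' : ℝ, halfTurn (n - 1) '' strandsOn {j | j < n} x x' =
        strandsOn {j | j < n} (-x') (-x) := fun x x' =>
      halfTurn_strandsOn (n := n) (J := {j | j < n}) (J' := {j | j < n}) (fun j hj => hj)
        (fun j hj => hj) (fun j hj => by simp only [Set.mem_ofPred_eq]; omega) x x'
    simp only [braidClosure, Set.image_union, hs, halfTurn_arcsOn, halfTurn_draw _ hw, hlen,
      zero_add, neg_neg, neg_add_cancel, neg_zero]
    ext p; simp only [Set.mem_union]; tauto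
  rw [this]
  exact braidClosure_isotopic hw.flipWord (by linarith) (by rw [hlen]; norm_num)

/-! ### The closure of the trivial braid on one strand -/

/-- The ratio of the gauge of the rectangle `|x| ≤ 1 / 2`, `|z| ≤ 1` to the Euclidean norm. -/
noncomputable def gaugeRatio (x z : ℝ) : ℝ := max (1 / 2) (max (2 * |x|) |z| / √(x ^ 2 + z ^ 2))

theorem gaugeRatio_ge (x z : ℝ) : 1 / 2 ≤ gaugeRatio x z := le_max_left _ _

theorem max_abs_le (x z : ℝ) : max (2 * |x|) |z| ≤ 2 * √(x ^ 2 + z ^ 2) := by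
  have h1 : |x| ≤ √(x ^ 2 + z ^ 2) := Real.abs_le_sqrt (by nlinarith [sq_nonneg z])
  have h2 : |z| ≤ √(x ^ 2 + z ^ 2) := Real.abs_le_sqrt (by nlinarith [sq_nonneg x])
  have := Real.sqrt_nonneg (x ^ 2 + z ^ 2)
  exact max_le (by linarith) (by linarith)

theorem gaugeRatio_le (x z : ℝ) : gaugeRatio x z ≤ 2 :=
  max_le (by norm_num) (div_le_of_le_mul₀ (Real.sqrt_nonneg _) (by norm_num) (max_abs_le x z))

theorem gaugeRatio_mul {c : ℝ} (hc : 0 < c) (x z : ℝ) :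
    gaugeRatio (c * x) (c * z) = gaugeRatio x z := by
  have h1 : √((c * x) ^ 2 + (c * z) ^ 2) = c * √(x ^ 2 + z ^ 2) := by
    rw [show (c * x) ^ 2 + (c * z) ^ 2 = c ^ 2 * (x ^ 2 + z ^ 2) by ring,
      Real.sqrt_mul (by positivity), Real.sqrt_sq hc.le]
  have h2 : max (2 * |c * x|) |c * z| = c * max (2 * |x|) |z| := by
    rw [abs_mul, abs_mul, abs_of_pos hc, mul_max_of_nonneg _ _ hc.le]; ring_nf
  rw [gaugeRatio, gaugeRatio, h1, h2, mul_div_mul_left _ _ hc.ne']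

/-- The bound 1/2 inside `gaugeRatio` alters the quotient only at the origin, where division by zero
returns 0. -/
theorem gaugeRatio_mul_sqrt (x z : ℝ) :
    gaugeRatio x z * √(x ^ 2 + z ^ 2) = max (2 * |x|) |z| := by
  rcases (Real.sqrt_nonneg (x ^ 2 + z ^ 2)).eq_or_lt with h | h
  · have := max_abs_le x z
    rw [← h] at this ⊢
    have h' : 0 ≤ max (2 * |x|) |z| := le_max_of_le_right (abs_nonneg z)
    linarith
  · rw [gaugeRatio, max_eq_right, div_mul_cancel₀ _ h.ne']
    rw [le_div_iff₀ h]
    have hx : 2 * |x| ≤ max (2 * |x|) |z| := le_max_left _ _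
    have hz : |z| ≤ max (2 * |x|) |z| := le_max_right _ _
    have : √(x ^ 2 + z ^ 2) ≤ 2 * max (2 * |x|) |z| := by
      rw [Real.sqrt_le_left (by have := abs_nonneg z; linarith)]
      nlinarith [abs_nonneg x, abs_nonneg z, sq_abs x, sq_abs z]
    linarith

theorem continuousAt_gaugeRatio {p : ℝ × ℝ} (h : p ≠ 0) :
    ContinuousAt (fun p : ℝ × ℝ => gaugeRatio p.1 p.2) p := by
  have : √(p.1 ^ 2 + p.2 ^ 2) ≠ 0 := by
    rw [Real.sqrt_ne_zero (by positivity)]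
    intro h'
    apply h
    refine Prod.ext ?_ ?_ <;> simp only [Prod.fst_zero, Prod.snd_zero] <;>
      nlinarith [sq_nonneg p.1, sq_nonneg p.2]
  unfold gaugeRatio
  fun_prop (disch := assumption)

/-- The radial factor need not be continuous on the axis x = z = 0, but there it multiplies
coordinates that vanish. -/
theorem continuousAt_mul_of_bounded {X : Type*} [TopologicalSpace X] {r f : X → ℝ} {C : ℝ}
    (hr : ∀ p, |r p| ≤ C) {p : X} (hf : ContinuousAt f p) (h : ContinuousAt r p ∨ f p = 0) :
    ContinuousAt (fun q => r q * f q) p := by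
  rcases h with h | h
  · exact h.mul hf
  · have : Filter.Tendsto f (𝓝 p) (𝓝 0) := by rw [← h]; exact hf
    rw [ContinuousAt, h, mul_zero]
    refine Filter.Tendsto.zero_mul_isBoundedUnder_le this ?_ |>.congr (fun q => mul_comm _ _)
    exact ⟨C, Filter.eventually_map.2 (Filter.Eventually.of_forall fun q => by simpa using hr q)⟩

/-- The time `t` of the radial isotopy between a rectangle and the round circle. -/
noncomputable def radialFactor (t : ℝ) (p : Space) : ℝ := (1 - t) + t * gaugeRatio p.1 p.2.2

theorem radialFactor_mem {t : ℝ} (h0 : 0 ≤ t) (h1 : t ≤ 1) (p : Space) :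
    1 / 2 ≤ radialFactor t p ∧ radialFactor t p ≤ 2 := by
  have h2 := gaugeRatio_ge p.1 p.2.2
  have h3 := gaugeRatio_le p.1 p.2.2
  constructor <;> rw [radialFactor] <;> nlinarith

theorem continuousAt_radialFactor {q : ℝ × Space} (h : q.2.1 ≠ 0 ∨ q.2.2.2 ≠ 0) :
    ContinuousAt (fun q : ℝ × Space => radialFactor q.1 q.2) q := by
  have hg : ContinuousAt (fun q : ℝ × Space => gaugeRatio q.2.1 q.2.2.2) q := by
    have hc : ContinuousAt (fun q : ℝ × Space => (q.2.1, q.2.2.2)) q := by fun_prop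
    refine ContinuousAt.comp (f := fun q : ℝ × Space => (q.2.1, q.2.2.2))
      (continuousAt_gaugeRatio ?_) hc
    intro h'
    simp only [Prod.mk_eq_zero] at h'
    tauto
  have h1 : ContinuousAt (fun q : ℝ × Space => q.1) q := continuousAt_fst
  exact (continuousAt_const.sub h1).add (h1.mul hg)

theorem continuous_radial : Continuous fun q : unitInterval × Space =>
    ((radialFactor q.1 q.2 * q.2.1, q.2.2.1, radialFactor q.1 q.2 * q.2.2.2) : Space) := by
  have hb : ∀ q : unitInterval × Space, |radialFactor q.1 q.2| ≤ 2 := fun q => by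
    have := radialFactor_mem q.1.2.1 q.1.2.2 q.2
    rw [abs_le]; constructor <;> linarith
  have hc : ∀ q : unitInterval × Space, (q.2.1 ≠ 0 ∨ q.2.2.2 ≠ 0) →
      ContinuousAt (fun q : unitInterval × Space => radialFactor q.1 q.2) q := fun q h => by
    have : ContinuousAt (fun q : unitInterval × Space => ((q.1 : ℝ), q.2)) q := by fun_prop
    exact ContinuousAt.comp (f := fun q : unitInterval × Space => ((q.1 : ℝ), q.2))
      (continuousAt_radialFactor h) this
  rw [continuous_iff_continuousAt]
  intro q
  refine ContinuousAt.prodMk ?_ (ContinuousAt.prodMk (by fun_prop) ?_)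
  · refine continuousAt_mul_of_bounded hb (by fun_prop) ?_
    by_cases h : q.2.1 = 0
    exacts [Or.inr h, Or.inl (hc q (Or.inl h))]
  · refine continuousAt_mul_of_bounded hb (by fun_prop) ?_
    by_cases h : q.2.2.2 = 0
    exacts [Or.inr h, Or.inl (hc q (Or.inr h))]

theorem continuous_radial_inv {t : ℝ} (h0 : 0 ≤ t) (h1 : t ≤ 1) : Continuous fun p : Space =>
    (((radialFactor t p)⁻¹ * p.1, p.2.1, (radialFactor t p)⁻¹ * p.2.2) : Space) := by
  have hb : ∀ p : Space, |(radialFactor t p)⁻¹| ≤ 2 := fun p => by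
    have := radialFactor_mem h0 h1 p
    rw [abs_inv, abs_of_pos (by linarith), inv_le_comm₀ (by linarith) two_pos]
    linarith
  have hc : ∀ p : Space, (p.1 ≠ 0 ∨ p.2.2 ≠ 0) →
      ContinuousAt (fun p : Space => (radialFactor t p)⁻¹) p := fun p h => by
    have : ContinuousAt (fun p : Space => (t, p)) p := by fun_prop
    have h' : ContinuousAt (fun p : Space => radialFactor t p) p :=
      ContinuousAt.comp (f := fun p : Space => (t, p))
        (continuousAt_radialFactor (q := (t, p)) h) this
    exact h'.inv₀ (by linarith [radialFactor_mem h0 h1 p])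
  rw [continuous_iff_continuousAt]
  intro p
  refine ContinuousAt.prodMk ?_ (ContinuousAt.prodMk (by fun_prop) ?_)
  · refine continuousAt_mul_of_bounded hb (by fun_prop) ?_
    by_cases h : p.1 = 0
    exacts [Or.inr h, Or.inl (hc p (Or.inl h))]
  · refine continuousAt_mul_of_bounded hb (by fun_prop) ?_
    by_cases h : p.2.2 = 0
    exacts [Or.inr h, Or.inl (hc p (Or.inr h))]

theorem radialFactor_mul {c : ℝ} (hc : 0 < c) (t : ℝ) (p : Space) (y : ℝ) :
    radialFactor t (c * p.1, y, c * p.2.2) = radialFactor t p := by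
  rw [radialFactor, radialFactor, gaugeRatio_mul hc]

/-- The stages of the radial isotopy. -/
noncomputable def radial (t : unitInterval) : Space ≃ₜ Space where
  toFun p := (radialFactor t p * p.1, p.2.1, radialFactor t p * p.2.2)
  invFun p := ((radialFactor t p)⁻¹ * p.1, p.2.1, (radialFactor t p)⁻¹ * p.2.2)
  left_inv p := by
    have h : 0 < radialFactor t p := by linarith [(radialFactor_mem t.2.1 t.2.2 p).1]
    -- The factor is constant on rays in the (x, z) directions, so it takes the same value at the
    -- image point.
    simp only [radialFactor_mul h, inv_mul_cancel_left₀ h.ne']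
  right_inv p := by
    have h : 0 < radialFactor t p := by linarith [(radialFactor_mem t.2.1 t.2.2 p).1]
    simp only [radialFactor_mul (inv_pos.2 h), mul_inv_cancel_left₀ h.ne']
  continuous_toFun := continuous_radial.comp (by fun_prop : Continuous fun p : Space => (t, p))
  continuous_invFun := continuous_radial_inv t.2.1 t.2.2

/-- The boundary of the rectangle `|x| ≤ 1 / 2`, `|z| ≤ 1` in the plane `y = 0`. -/
def rectangle : Set Space := {p | max (2 * |p.1|) |p.2.2| = 1 ∧ p.2.1 = 0}

/-- At time 1 a point is scaled by the quotient of the gauge of the rectangle and the Euclidean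
norm, so the unit sphere of the gauge goes to that of the norm. -/
theorem ambientIsotopic_rectangle : AmbientIsotopic rectangle roundCircle := by
  refine ⟨radial, continuous_radial, fun p => by simp [radial, radialFactor], ?_⟩
  have hf : ∀ p, radialFactor ((1 : unitInterval) : ℝ) p = gaugeRatio p.1 p.2.2 := by
    intro p; simp [radialFactor]
  ext q
  constructor
  · rintro ⟨p, ⟨hp, hy⟩, rfl⟩
    rw [← gaugeRatio_mul_sqrt] at hp
    refine ⟨?_, hy⟩
    simp only [radial, Homeomorph.homeomorph_mk_coe, Equiv.coe_fn_mk, hf]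
    have := congrArg (· ^ 2) hp
    simp only [mul_pow] at this
    rw [Real.sq_sqrt (by positivity)] at this
    linarith
  · rintro ⟨hq, hy⟩
    refine ⟨(radial 1).symm q, ⟨?_, hy⟩, (radial 1).apply_symm_apply q⟩
    have h : 0 < gaugeRatio q.1 q.2.2 := by linarith [gaugeRatio_ge q.1 q.2.2]
    have h1 : ((radial 1).symm q).1 = (gaugeRatio q.1 q.2.2)⁻¹ * q.1 := by rw [← hf]; rfl
    have h2 : ((radial 1).symm q).2.2 = (gaugeRatio q.1 q.2.2)⁻¹ * q.2.2 := by rw [← hf]; rfl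
    rw [h1, h2, ← gaugeRatio_mul_sqrt, gaugeRatio_mul (inv_pos.2 h),
      show ((gaugeRatio q.1 q.2.2)⁻¹ * q.1) ^ 2 + ((gaugeRatio q.1 q.2.2)⁻¹ * q.2.2) ^ 2 =
        ((gaugeRatio q.1 q.2.2)⁻¹) ^ 2 * (q.1 ^ 2 + q.2.2 ^ 2) by ring, hq, mul_one,
      Real.sqrt_sq (inv_pos.2 h).le, mul_inv_cancel₀ h.ne']

theorem mem_segment_vertical {x y z z' : ℝ} (h : z ≤ z') (p : Space) :
    p ∈ segment ℝ ((x, y, z) : Space) (x, y, z') ↔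
      p.1 = x ∧ p.2.1 = y ∧ z ≤ p.2.2 ∧ p.2.2 ≤ z' := by
  constructor
  · rintro ⟨s, t, hs, ht, hst, rfl⟩
    obtain rfl : t = 1 - s := by linarith
    simp only [Prod.smul_mk, Prod.mk_add_mk, smul_eq_mul]
    refine ⟨by ring, by ring, ?_, ?_⟩ <;> nlinarith
  · rintro ⟨h1, h2, h3, h4⟩
    obtain ⟨a, b, c⟩ := p
    simp only at h1 h2 h3 h4
    subst h1 h2
    have : c ∈ segment ℝ z z' := by rw [segment_eq_Icc h]; exact ⟨h3, h4⟩
    obtain ⟨s, t, hs, ht, hst, hc⟩ := this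
    refine ⟨s, t, hs, ht, hst, ?_⟩
    rw [smul_eq_mul, smul_eq_mul] at hc
    simp only [Prod.smul_mk, Prod.mk_add_mk, smul_eq_mul, ← add_mul, hst, one_mul, hc]

theorem translation_closureSet_one :
    translation (-1 / 2, 0, 1) '' closureSet 1 [] = rectangle := by
  have hJ : {j | j < 1} = ({0} : Set ℕ) := by ext j; simp
  rw [closureSet, braidClosure]
  simp only [draw, List.length_nil, hJ, strandsOn_singleton, arcsOn_singleton, Set.image_union,
    translation_image_segment, Prod.mk_add_mk, Set.union_empty]
  norm_num
  ext p
  rw [segment_symm ℝ ((1 / 2, 0, 1) : Space) (1 / 2, 0, -1),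
    segment_symm ℝ ((1 / 2, 0, -1) : Space) (-(1 / 2), 0, -1)]
  simp only [Set.mem_union, Set.mem_insert_iff]
  rw [mem_segment_parallel (by norm_num) (0, 1), mem_segment_parallel (by norm_num) (0, -1),
    mem_segment_vertical (by norm_num), mem_segment_vertical (by norm_num)]
  obtain ⟨x, y, z⟩ := p
  simp only [rectangle, Set.mem_ofPred_eq, Prod.mk.injEq]
  constructor
  · have hx : -(1 / 2) ≤ x → x ≤ 1 / 2 → 2 * |x| ≤ 1 := fun h h' => by
      have := abs_le.2 ⟨h, h'⟩; linarith
    have h12 : |(1 / 2 : ℝ)| = 1 / 2 := abs_of_pos (by norm_num)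
    rintro ((⟨rfl, rfl, rfl⟩ | ⟨h1, h2, rfl, rfl⟩) |
      ((⟨rfl, rfl, h1, h2⟩ | ⟨h1, h2, rfl, rfl⟩) | ⟨rfl, rfl, h1, h2⟩))
    · norm_num [h12]
    · refine ⟨?_, rfl⟩
      rw [abs_one, max_eq_right (hx h1 h2)]
    · refine ⟨?_, rfl⟩
      rw [h12, max_eq_left] <;> norm_num
      exact abs_le.2 ⟨h1, h2⟩
    · refine ⟨?_, rfl⟩
      rw [abs_neg, abs_one, max_eq_right (hx h1 h2)]
    · refine ⟨?_, rfl⟩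
      rw [abs_neg, h12, max_eq_left] <;> norm_num
      exact abs_le.2 ⟨h1, h2⟩
  · rintro ⟨h, rfl⟩
    have hx : 2 * |x| ≤ 1 := h ▸ le_max_left _ _
    have hz : |z| ≤ 1 := h ▸ le_max_right _ _
    obtain ⟨hx1, hx2⟩ := abs_le.1 (by linarith : |x| ≤ 1 / 2)
    obtain ⟨hz1, hz2⟩ := abs_le.1 hz
    rcases max_choice (2 * |x|) |z| with h' | h'
    · have : |x| = 1 / 2 := by linarith
      rcases (abs_eq (by norm_num)).1 this with rfl | rfl
      · exact Or.inr (Or.inl (Or.inl ⟨rfl, rfl, hz1, hz2⟩))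
      · exact Or.inr (Or.inr ⟨rfl, rfl, hz1, hz2⟩)
    · have : |z| = 1 := by linarith
      rcases (abs_eq (by norm_num)).1 this with rfl | rfl
      · exact Or.inl (Or.inr ⟨hx1, hx2, rfl, rfl⟩)
      · exact Or.inr (Or.inl (Or.inr ⟨hx1, hx2, rfl, rfl⟩))

/-- The closure of the braid on one strand is trivial. -/
theorem closureSet_one : AmbientIsotopic (closureSet 1 []) roundCircle := by
  refine (ambientIsotopic_translation (-1 / 2, 0, 1) _).trans ?_
  rw [translation_closureSet_one]
  exact ambientIsotopic_rectangle

/-! ### Components of a closed braid -/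

/-- The permutation of a word: the strand that starts in position `j` ends in position
`perm w j`. -/
def perm : List (ℕ × Bool) → Equiv.Perm ℕ
  | [] => 1
  | g :: w => perm w * Equiv.swap g.1 (g.1 + 1)

theorem perm_lt {n : ℕ} {w : List (ℕ × Bool)} (hw : Valid n w) {j : ℕ} (hj : j < n) :
    perm w j < n := by
  induction w generalizing j with
  | nil => exact hj
  | cons g w ih =>
    have hg := hw g (by simp)
    rw [perm, Equiv.Perm.mul_apply]
    refine ih (fun k hk => hw k (by simp [hk])) ?_
    rw [Equiv.swap_apply_def]
    split_ifs <;> omega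

/-- The part of a letter drawn over `[x, x + 1]` that starts in position `j`. -/
def letterStrand (x : ℝ) (g : ℕ × Bool) (j : ℕ) : Set Space :=
  if j = g.1 then
    segment ℝ ((x, (j : ℝ), 0) : Space) (x + 1 / 2, (j : ℝ) + 1 / 2, if g.2 then 1 else -1) ∪
      segment ℝ ((x + 1 / 2, (j : ℝ) + 1 / 2, if g.2 then 1 else -1) : Space)
        (x + 1, (j : ℝ) + 1, 0)
  else if j = g.1 + 1 then segment ℝ ((x, (j : ℝ), 0) : Space) (x + 1, (g.1 : ℝ), 0)
  else segment ℝ ((x, (j : ℝ), 0) : Space) (x + 1, (j : ℝ), 0)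

/-- The strand of a word drawn from `x` on that starts in position `j`. -/
def strand : ℝ → List (ℕ × Bool) → ℕ → Set Space
  | _, [], _ => ∅
  | x, g :: w, j => letterStrand x g j ∪ strand (x + 1) w (Equiv.swap g.1 (g.1 + 1) j)

theorem letterStrand_left {x : ℝ} {g : ℕ × Bool} {p : Space} (hp : p ∈ letterStrand x g g.1) :
    x ≤ p.1 ∧ p.1 ≤ x + 1 ∧ p.2.1 = g.1 + (p.1 - x) ∧
      |p.2.2| = 2 * min (p.1 - x) (x + 1 - p.1) := by
  rw [letterStrand, if_pos rfl] at hp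
  rcases hp with ⟨s, t, hs, ht, hst, rfl⟩ | ⟨s, t, hs, ht, hst, rfl⟩
  · obtain rfl : s = 1 - t := by linarith
    simp only [Prod.smul_mk, Prod.mk_add_mk, smul_eq_mul]
    refine ⟨by linarith, by linarith, by ring, ?_⟩
    rw [min_eq_left (by linarith)]
    have : |(1 - t) * 0 + t * (if g.2 = true then 1 else -1)| = t := by
      split_ifs <;> simp [abs_of_nonneg ht]
    rw [this]; ring
  · obtain rfl : t = 1 - s := by linarith
    simp only [Prod.smul_mk, Prod.mk_add_mk, smul_eq_mul]
    refine ⟨by linarith, by linarith, by ring, ?_⟩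
    rw [min_eq_right (by linarith)]
    have : |s * (if g.2 = true then 1 else -1) + (1 - s) * 0| = s := by
      split_ifs <;> simp [abs_of_nonneg hs]
    rw [this]; ring

theorem letterStrand_right {x : ℝ} {g : ℕ × Bool} {p : Space}
    (hp : p ∈ letterStrand x g (g.1 + 1)) :
    x ≤ p.1 ∧ p.1 ≤ x + 1 ∧ p.2.1 = g.1 + 1 - (p.1 - x) ∧ p.2.2 = 0 := by
  rw [letterStrand, if_neg (by omega), if_pos rfl] at hp
  obtain ⟨s, t, hs, ht, hst, rfl⟩ := hp
  obtain rfl : s = 1 - t := by linarith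
  simp only [Prod.smul_mk, Prod.mk_add_mk, smul_eq_mul]
  refine ⟨by linarith, by linarith, ?_, by ring⟩
  push_cast; ring

theorem letterStrand_other {x : ℝ} {g : ℕ × Bool} {j : ℕ} (h : j ≠ g.1) (h' : j ≠ g.1 + 1)
    {p : Space} (hp : p ∈ letterStrand x g j) :
    x ≤ p.1 ∧ p.1 ≤ x + 1 ∧ p.2.1 = j ∧ p.2.2 = 0 := by
  rw [letterStrand, if_neg h, if_neg h', mem_segment_parallel (by linarith)] at hp
  exact ⟨hp.1, hp.2.1, by rw [hp.2.2], by rw [hp.2.2]⟩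

theorem letterStrand_bounds {x : ℝ} {g : ℕ × Bool} {j : ℕ} {p : Space}
    (hp : p ∈ letterStrand x g j) :
    x ≤ p.1 ∧ p.1 ≤ x + 1 ∧ -1 ≤ p.2.2 ∧ (p.1 = x → p.2.1 = j) ∧
      (p.1 = x + 1 → p.2.1 = Equiv.swap g.1 (g.1 + 1) j) := by
  rcases eq_or_ne j g.1 with rfl | h
  · obtain ⟨h1, h2, h3, h4⟩ := letterStrand_left hp
    refine ⟨h1, h2, ?_, ?_, ?_⟩
    · have : min (p.1 - x) (x + 1 - p.1) ≤ 1 / 2 := by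
        rcases le_total (p.1 - x) (1 / 2) with h | h
        · exact (min_le_left _ _).trans h
        · exact (min_le_right _ _).trans (by linarith)
      exact (abs_le.1 (by linarith : |p.2.2| ≤ 1)).1
    · intro h; rw [h3, h]; ring
    · intro h; rw [h3, h, Equiv.swap_apply_left]; push_cast; ring
  rcases eq_or_ne j (g.1 + 1) with rfl | h'
  · obtain ⟨h1, h2, h3, h4⟩ := letterStrand_right hp
    refine ⟨h1, h2, by linarith, ?_, ?_⟩
    · intro h; rw [h3, h]; push_cast; ring
    · intro h; rw [h3, h, Equiv.swap_apply_right]; ring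
  · obtain ⟨h1, h2, h3, h4⟩ := letterStrand_other h h' hp
    refine ⟨h1, h2, by linarith, fun _ => h3, fun _ => ?_⟩
    rw [h3, Equiv.swap_apply_of_ne_of_ne h h']

/-- Only the two exchanged strands ever have the same position, at the midpoint of the letter, and
there their heights are ±1 and 0. -/
theorem disjoint_letterStrand (x : ℝ) (g : ℕ × Bool) {j k : ℕ} (hjk : j ≠ k) :
    Disjoint (letterStrand x g j) (letterStrand x g k) := by
  have key : ∀ {j k : ℕ}, j ≠ k → (j = g.1 ∨ j = g.1 + 1 ∧ k ≠ g.1 ∨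
      j ≠ g.1 ∧ j ≠ g.1 + 1 ∧ k ≠ g.1 ∧ k ≠ g.1 + 1) →
      Disjoint (letterStrand x g j) (letterStrand x g k) := by
    intro j k hjk h
    have hout : ∀ k : ℕ, k ≠ g.1 → k ≠ g.1 + 1 → (k : ℝ) + 1 ≤ g.1 ∨ (g.1 : ℝ) + 2 ≤ k := by
      intro k h1 h2
      have : k + 1 ≤ g.1 ∨ g.1 + 2 ≤ k := by omega
      exact_mod_cast this
    rw [Set.disjoint_left]
    intro p hp hp'
    rcases h with rfl | ⟨rfl, hk⟩ | ⟨h1, h2, h3, h4⟩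
    · obtain ⟨h1, h2, h3, h4⟩ := letterStrand_left hp
      rcases eq_or_ne k (g.1 + 1) with rfl | hk
      · obtain ⟨-, -, h5, h6⟩ := letterStrand_right hp'
        have : p.1 - x = 1 / 2 := by linarith
        rw [h6, this, show x + 1 - p.1 = 1 / 2 by linarith] at h4
        norm_num at h4
      · obtain ⟨-, -, h5, -⟩ := letterStrand_other hjk.symm hk hp'
        rcases hout k hjk.symm hk with h | h <;> linarith
    · obtain ⟨h1, h2, h3, h4⟩ := letterStrand_right hp
      obtain ⟨-, -, h5, -⟩ := letterStrand_other hk hjk.symm hp'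
      rcases hout k hk hjk.symm with h | h <;> linarith
    · obtain ⟨-, -, h5, -⟩ := letterStrand_other h1 h2 hp
      obtain ⟨-, -, h6, -⟩ := letterStrand_other h3 h4 hp'
      exact hjk (by exact_mod_cast h5.symm.trans h6)
  by_cases h1 : j = g.1 ∨ j = g.1 + 1 ∧ k ≠ g.1 ∨
      j ≠ g.1 ∧ j ≠ g.1 + 1 ∧ k ≠ g.1 ∧ k ≠ g.1 + 1
  · exact key hjk h1
  · exact (key hjk.symm (by tauto)).symm

theorem strand_bounds {x : ℝ} {w : List (ℕ × Bool)} {j : ℕ} {p : Space} (hp : p ∈ strand x w j) :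
    x ≤ p.1 ∧ p.1 ≤ x + w.length ∧ -1 ≤ p.2.2 ∧ (p.1 = x → p.2.1 = j) ∧
      (p.1 = x + w.length → p.2.1 = perm w j) := by
  induction w generalizing x j with
  | nil => exact hp.elim
  | cons g w ih =>
    have hl : (0 : ℝ) ≤ w.length := by positivity
    rw [List.length_cons, perm, Equiv.Perm.mul_apply]
    push_cast
    rcases hp with hp | hp
    · obtain ⟨h1, h2, h3, h4, h5⟩ := letterStrand_bounds hp
      refine ⟨h1, by linarith, h3, h4, fun h => ?_⟩
      cases w with
      | nil => simp only [List.length_nil, Nat.cast_zero, zero_add] at h; exact h5 h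
      | cons g' w =>
        simp only [List.length_cons] at h
        push_cast at h
        have : (0 : ℝ) ≤ w.length := by positivity
        linarith
    · obtain ⟨h1, h2, h3, h4, h5⟩ := ih hp
      exact ⟨by linarith, by linarith, h3, fun h => by linarith, fun h => h5 (by linarith)⟩

/-- Pieces in consecutive letters can meet only in the plane between them, where they sit at
positions related by an injective map. -/
theorem disjoint_strand (x : ℝ) (w : List (ℕ × Bool)) {j k : ℕ} (hjk : j ≠ k) :
    Disjoint (strand x w j) (strand x w k) := by
  induction w generalizing x j k with
  | nil => exact Set.disjoint_empty _
  | cons g w ih =>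
    have key : ∀ {j k : ℕ}, j ≠ k → Disjoint (letterStrand x g j)
        (strand (x + 1) w (Equiv.swap g.1 (g.1 + 1) k)) := by
      intro j k hjk
      rw [Set.disjoint_left]
      intro p hp hp'
      obtain ⟨-, h1, -, -, h2⟩ := letterStrand_bounds hp
      obtain ⟨h3, -, -, h4, -⟩ := strand_bounds hp'
      have h5 := (h2 (le_antisymm h1 h3)).symm.trans (h4 (le_antisymm h1 h3))
      exact hjk ((Equiv.swap g.1 (g.1 + 1)).injective (by exact_mod_cast h5))
    simp only [strand, Set.disjoint_union_left, Set.disjoint_union_right]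
    exact ⟨⟨disjoint_letterStrand x g hjk, (key hjk.symm).symm⟩, key hjk,
      ih (x + 1) ((Equiv.swap g.1 (g.1 + 1)).injective.ne hjk)⟩

theorem isClosed_segment (p q : Space) : IsClosed (segment ℝ p q) := by
  rw [segment_eq_image]
  exact (isCompact_Icc.image (by fun_prop)).isClosed

theorem isClosed_strand (x : ℝ) (w : List (ℕ × Bool)) (j : ℕ) : IsClosed (strand x w j) := by
  induction w generalizing x j with
  | nil => exact isClosed_empty
  | cons g w ih =>
    refine IsClosed.union ?_ (ih _ _)
    rw [letterStrand]
    split_ifs <;> first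
      | exact (isClosed_segment _ _).union (isClosed_segment _ _)
      | exact isClosed_segment _ _

theorem letterSet_eq {n : ℕ} (x : ℝ) {g : ℕ × Bool} (hg : g.1 + 1 < n) :
    letterSet n x g = ⋃ j ∈ {j | j < n}, letterStrand x g j := by
  rw [lt_eq_others_union hg, Set.biUnion_union, Set.insert_eq, Set.biUnion_union,
    Set.biUnion_singleton, Set.biUnion_singleton]
  have : ⋃ j ∈ others n g.1, letterStrand x g j = strandsOn (others n g.1) x (x + 1) := by
    ext p
    simp only [strandsOn, Set.mem_iUnion, exists_prop, Set.mem_ofPred_eq]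
    refine exists_congr fun j => and_congr_right fun hj => ?_
    rw [letterStrand, if_neg hj.2.1, if_neg hj.2.2]
  have h₁ : letterStrand x g g.1 = segment ℝ ((x, (g.1 : ℝ), 0) : Space)
        (x + 1 / 2, (g.1 : ℝ) + 1 / 2, if g.2 then 1 else -1) ∪
      segment ℝ ((x + 1 / 2, (g.1 : ℝ) + 1 / 2, if g.2 then 1 else -1) : Space)
        (x + 1, (g.1 : ℝ) + 1, 0) := if_pos rfl
  have h₂ : letterStrand x g (g.1 + 1) =
      segment ℝ ((x, (g.1 : ℝ) + 1, 0) : Space) (x + 1, (g.1 : ℝ), 0) := by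
    rw [letterStrand, if_neg (Nat.succ_ne_self _), if_pos rfl, Nat.cast_add, Nat.cast_one]
  rw [this, letterSet, Set.union_comm, crossing, h₁, h₂]

theorem draw_eq {n : ℕ} (x : ℝ) {w : List (ℕ × Bool)} (hw : Valid n w) :
    draw n x w = ⋃ j ∈ {j | j < n}, strand x w j := by
  induction w generalizing x with
  | nil => simp [draw, strand]
  | cons g w ih =>
    have hg := hw g (by simp)
    have hs : ∀ {j}, j < n → Equiv.swap g.1 (g.1 + 1) j < n := by
      intro j hj
      rw [Equiv.swap_apply_def]
      split_ifs <;> omega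
    rw [draw, ih _ (fun k hk => hw k (by simp [hk])), letterSet_eq x hg]
    ext p
    simp only [Set.mem_union, Set.mem_iUnion, exists_prop, strand, Set.mem_ofPred_eq]
    constructor
    · rintro (⟨j, hj, hp⟩ | ⟨j, hj, hp⟩)
      · exact ⟨j, hj, Or.inl hp⟩
      · exact ⟨_, hs hj, Or.inr (by rwa [Equiv.swap_apply_self])⟩
    · rintro ⟨j, hj, hp | hp⟩
      · exact Or.inl ⟨j, hj, hp⟩
      · exact Or.inr ⟨_, hs hj, hp⟩

/-- The components of the closure of `w` through the positions in `J`. -/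
def closurePart (w : List (ℕ × Bool)) (J : Set ℕ) : Set Space :=
  strandsOn J 0 0 ∪ (⋃ j ∈ J, strand 0 w j) ∪ strandsOn J w.length (w.length + 1) ∪
    arcsOn J 0 (w.length + 1)

theorem closurePart_union (w : List (ℕ × Bool)) (J J' : Set ℕ) :
    closurePart w (J ∪ J') = closurePart w J ∪ closurePart w J' := by
  simp only [closurePart, strandsOn_union, arcsOn_union, Set.biUnion_union]
  ext p; simp only [Set.mem_union]; tauto

theorem closureSet_eq_closurePart {n : ℕ} {w : List (ℕ × Bool)} (hw : Valid n w) :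
    closureSet n w = closurePart w {j | j < n} := by
  rw [closureSet, braidClosure, closurePart, draw_eq 0 hw, zero_add]

theorem isClosed_closurePart (w : List (ℕ × Bool)) {J : Set ℕ} (hJ : J.Finite) :
    IsClosed (closurePart w J) := by
  have hs : ∀ x x' : ℝ, IsClosed (strandsOn J x x') := by
    intro x x'
    have : strandsOn J x x' = ⋃ j ∈ J, segment ℝ ((x, (j : ℝ), 0) : Space) (x', (j : ℝ), 0) := by
      ext p; simp [strandsOn]
    rw [this]
    exact hJ.isClosed_biUnion fun _ _ => isClosed_segment _ _
  refine (((hs _ _).union (hJ.isClosed_biUnion fun _ _ => isClosed_strand _ _ _)).union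
    (hs _ _)).union ?_
  rw [arcsOn_eq_iUnion]
  exact hJ.isClosed_biUnion fun _ _ => ((isClosed_segment _ _).union (isClosed_segment _ _)).union
    (isClosed_segment _ _)

theorem closurePart_nonempty (w : List (ℕ × Bool)) {J : Set ℕ} (hJ : J.Nonempty) :
    (closurePart w J).Nonempty := by
  obtain ⟨j, hj⟩ := hJ
  exact ⟨(0, j, 0), Or.inl (Or.inl (Or.inl ⟨j, hj, left_mem_segment _ _ _⟩))⟩

/-- Where the part of a closed braid above the closing arcs can meet other pieces. -/
theorem closurePart_upper {w : List (ℕ × Bool)} {J : Set ℕ} (hJ : ∀ j ∈ J, perm w j ∈ J)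
    {p : Space} (hp : p ∈ strandsOn J 0 0 ∪ (⋃ j ∈ J, strand 0 w j) ∪
      strandsOn J w.length (w.length + 1)) :
    -1 ≤ p.2.2 ∧ ((∃ j ∈ J, p.2.1 = (j : ℝ) ∧ (p.1 ≤ 0 ∨ w.length ≤ p.1)) ∨
      0 < p.1 ∧ p.1 < w.length ∧ ∃ j ∈ J, p ∈ strand 0 w j) := by
  rcases hp with (hp | hp) | hp
  · obtain ⟨j, hj, -, h', h⟩ := (mem_strandsOn le_rfl).1 hp
    rw [h]; exact ⟨by norm_num, Or.inl ⟨j, hj, rfl, Or.inl h'⟩⟩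
  · simp only [Set.mem_iUnion, exists_prop] at hp
    obtain ⟨j, hj, hp⟩ := hp
    obtain ⟨h1, h2, h3, h4, h5⟩ := strand_bounds hp
    refine ⟨h3, ?_⟩
    rcases h1.eq_or_lt with h | h
    · exact Or.inl ⟨j, hj, h4 h.symm, Or.inl h.ge⟩
    rcases h2.eq_or_lt with h' | h'
    · exact Or.inl ⟨_, hJ j hj, h5 h', Or.inr (by linarith)⟩
    · exact Or.inr ⟨h, by linarith, j, hj, hp⟩
  · obtain ⟨j, hj, h', -, h⟩ := (mem_strandsOn (by linarith)).1 hp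
    rw [h]; exact ⟨by norm_num, Or.inl ⟨j, hj, rfl, Or.inr h'⟩⟩

/-- Invariance under the permutation ensures that the strands from positions in `J` also end in `J`,
where the closing arcs of `J` take over. -/
theorem disjoint_closurePart {w : List (ℕ × Bool)} {J J' : Set ℕ} (hJ : ∀ j ∈ J, perm w j ∈ J)
    (hJ' : ∀ j ∈ J', perm w j ∈ J') (h : Disjoint J J') :
    Disjoint (closurePart w J) (closurePart w J') := by
  have hl : (0 : ℝ) ≤ w.length := by positivity
  have hy : ∀ {p : Space} {J J' : Set ℕ}, Disjoint J J' → (∃ j ∈ J, p.2.1 = (j : ℝ)) →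
      (∃ j ∈ J', p.2.1 = (j : ℝ)) → False := by
    rintro p J J' h ⟨j, hj, e⟩ ⟨k, hk, e'⟩
    have : j = k := by exact_mod_cast e.symm.trans e'
    exact Set.disjoint_left.1 h hj (this ▸ hk)
  have hmix : ∀ {p : Space} {J J' : Set ℕ}, Disjoint J J' → (∀ j ∈ J, perm w j ∈ J) →
      p ∈ strandsOn J 0 0 ∪ (⋃ j ∈ J, strand 0 w j) ∪ strandsOn J w.length (w.length + 1) →
      p ∈ arcsOn J' 0 (w.length + 1) → False := by
    intro p J J' h hJ hp hp'
    obtain ⟨h1, h2⟩ := closurePart_upper hJ hp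
    obtain ⟨h3, h4⟩ := arcsOn_bounds hp'
    rcases h2 with ⟨j, hj, e, -⟩ | ⟨h5, h6, -⟩
    · exact hy h ⟨j, hj, e⟩ h4
    · rcases h3 with h3 | h3 | h3 <;> linarith
  rw [Set.disjoint_left]
  rintro p (hp | hp) (hp' | hp')
  · obtain ⟨-, ⟨j, hj, e, h1⟩ | ⟨h1, h2, j, hj, hpj⟩⟩ := closurePart_upper hJ hp <;>
    obtain ⟨-, ⟨k, hk, e', h1'⟩ | ⟨h1', h2', k, hk, hpk⟩⟩ := closurePart_upper hJ' hp'
    · exact hy h ⟨j, hj, e⟩ ⟨k, hk, e'⟩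
    · rcases h1 with h1 | h1 <;> linarith
    · rcases h1' with h1' | h1' <;> linarith
    · have hjk : j ≠ k := fun e => Set.disjoint_left.1 h hj (e ▸ hk)
      exact Set.disjoint_left.1 (disjoint_strand 0 w hjk) hpj hpk
  · exact hmix h hJ hp hp'
  · exact hmix h.symm hJ' hp' hp
  · exact hy h (arcsOn_bounds hp).2 (arcsOn_bounds hp').2

/-- The permutation of `w` moves every position to every other one. -/
def Transitive (n : ℕ) (w : List (ℕ × Bool)) : Prop :=
  ∀ J : Set ℕ, (∀ j < n, j ∈ J ↔ perm w j ∈ J) → ∀ j < n, j ∈ J → ∀ k < n, k ∈ J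

/-- An invariant set of positions and its complement would split the closure into two disjoint
nonempty closed pieces. -/
theorem transitive_of_isPreconnected {n : ℕ} {w : List (ℕ × Bool)} (hw : Valid n w)
    (h : IsPreconnected (closureSet n w)) : Transitive n w := by
  intro J hJ j hj hjJ k hk
  by_contra hkJ
  set A := {j | j < n} ∩ J with hA
  set B := {j | j < n} \ J with hB
  have hu : {j | j < n} = A ∪ B := (Set.inter_union_sdiff _ _).symm
  have hfin : {j | j < n}.Finite := Set.finite_lt_nat n
  have hd : Disjoint (closurePart w A) (closurePart w B) :=
    disjoint_closurePart (fun i hi => ⟨perm_lt hw hi.1, (hJ i hi.1).1 hi.2⟩)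
      (fun i hi => ⟨perm_lt hw hi.1, fun h' => hi.2 ((hJ i hi.1).2 h')⟩)
      (Set.disjoint_left.2 fun i hi hi' => hi'.2 hi.2)
  rw [closureSet_eq_closurePart hw, hu, closurePart_union] at h
  obtain ⟨p, hp⟩ := closurePart_nonempty w (J := A) ⟨j, hj, hjJ⟩
  obtain ⟨q, hq⟩ := closurePart_nonempty w (J := B) ⟨k, hk, hkJ⟩
  obtain ⟨r, -, hr, hr'⟩ := isPreconnected_closed_iff.1 h _ _
    (isClosed_closurePart w (hfin.subset Set.inter_subset_left))
    (isClosed_closurePart w (hfin.subset Set.sdiff_subset)) subset_rfl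
    ⟨p, Or.inl hp, hp⟩ ⟨q, Or.inr hq, hq⟩
  exact Set.disjoint_left.1 hd hr hr'

theorem closureSet_zero {w : List (ℕ × Bool)} (hw : Valid 0 w) : closureSet 0 w = ∅ := by
  have : {j : ℕ | j < 0} = ∅ := by ext; simp
  rw [closureSet_eq_closurePart hw, this]
  ext p
  simp [closurePart, strandsOn, arcsOn]

theorem IsKnot.isConnected {K : Set Space} (hK : IsKnot K) : IsConnected K := by
  obtain ⟨f, hf, rfl⟩ := hK
  exact isConnected_range hf.continuous

theorem AmbientIsotopic.isConnected {K K' : Set Space} (h : AmbientIsotopic K K')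
    (hK : IsConnected K) : IsConnected K' := by
  obtain ⟨H, -, -, rfl⟩ := h
  exact hK.image _ (H 1).continuous.continuousOn

/-! ### Words with connected closure -/

/-- The generators that occur in a word, with repetitions. -/
def generators (w : List (ℕ × Bool)) : List ℕ := w.map Prod.fst

/-- Only the generator `i` moves a strand across the gap between the positions `i` and `i + 1`. -/
theorem perm_le_iff {i : ℕ} {w : List (ℕ × Bool)} (hi : i ∉ generators w) (j : ℕ) :
    perm w j ≤ i ↔ j ≤ i := by
  induction w generalizing j with
  | nil => rfl
  | cons g w ih =>
    simp only [generators, List.map_cons, List.mem_cons, not_or] at hi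
    rw [perm, Equiv.Perm.mul_apply, ih hi.2, Equiv.swap_apply_def]
    split_ifs <;> omega

theorem Transitive.mem_generators {n : ℕ} {w : List (ℕ × Bool)} (h : Transitive n w) {i : ℕ}
    (hi : i + 1 < n) : i ∈ generators w := by
  by_contra hi'
  have := h {j | j ≤ i} (fun j _ => (perm_le_iff hi' j).symm) 0 (by omega) (Nat.zero_le i)
    (i + 1) hi
  simp at this

theorem le_length_of_forall_mem {m : ℕ} {l : List ℕ} (h : ∀ i < m, i ∈ l) : m ≤ l.length := by
  have : Finset.range m ⊆ l.toFinset := fun i hi => by simpa using h i (Finset.mem_range.1 hi)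
  simpa using (Finset.card_le_card this).trans l.toFinset_card_le

/-- The generator `i` as a permutation of `n` positions. -/
def swapAt (n i : ℕ) : Equiv.Perm (Fin n) :=
  if h : i + 1 < n then Equiv.swap ⟨i, by omega⟩ ⟨i + 1, h⟩ else 1

/-- The permutation of a word on `n` positions. -/
def permFin (n : ℕ) : List (ℕ × Bool) → Equiv.Perm (Fin n)
  | [] => 1
  | g :: w => permFin n w * swapAt n g.1

theorem permFin_val {n : ℕ} {w : List (ℕ × Bool)} (hw : Valid n w) (j : Fin n) :
    (permFin n w j : ℕ) = perm w j := by
  induction w generalizing j with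
  | nil => rfl
  | cons g w ih =>
    have hg := hw g (by simp)
    rw [permFin, perm, Equiv.Perm.mul_apply, Equiv.Perm.mul_apply,
      ih (fun k hk => hw k (by simp [hk])), swapAt, dif_pos hg]
    congr 1
    rw [Equiv.swap_apply_def, Equiv.swap_apply_def]
    simp only [Fin.ext_iff]
    split_ifs <;> rfl

theorem sign_permFin {n : ℕ} {w : List (ℕ × Bool)} (hw : Valid n w) :
    Equiv.Perm.sign (permFin n w) = (-1) ^ w.length := by
  induction w with
  | nil => simp [permFin]
  | cons g w ih =>
    have hg := hw g (by simp)
    rw [permFin, map_mul, ih (fun k hk => hw k (by simp [hk])), swapAt, dif_pos hg,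
      Equiv.Perm.sign_swap (by simp [Fin.ext_iff]), List.length_cons, pow_succ]

theorem Transitive.sameCycle {n : ℕ} {w : List (ℕ × Bool)} (hw : Valid n w)
    (h : Transitive n w) (a b : Fin n) : (permFin n w).SameCycle a b := by
  have := h {j | ∃ hj : j < n, (permFin n w).SameCycle a ⟨j, hj⟩} (fun j hj => ?_) a a.2
    ⟨a.2, Equiv.Perm.SameCycle.refl _ _⟩ b b.2
  · exact this.2
  · have e : (⟨perm w j, perm_lt hw hj⟩ : Fin n) = permFin n w ⟨j, hj⟩ :=
      Fin.ext (permFin_val hw ⟨j, hj⟩).symm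
    constructor
    · rintro ⟨_, h'⟩
      exact ⟨perm_lt hw hj, by rw [e]; exact Equiv.Perm.sameCycle_apply_right.2 h'⟩
    · rintro ⟨_, h'⟩
      rw [e] at h'
      exact ⟨hj, Equiv.Perm.sameCycle_apply_right.1 h'⟩

/-- The parity of the length of a word whose closure is connected. -/
theorem Transitive.even_length_add {n : ℕ} (hn : 1 ≤ n) {w : List (ℕ × Bool)} (hw : Valid n w)
    (h : Transitive n w) : Even (w.length + n + 1) := by
  rcases hn.eq_or_lt with rfl | hn
  -- One strand is treated apart: the identity does not count as a cycle.
  · have : w = [] := by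
      cases w with
      | nil => rfl
      | cons g w => have := hw g (by simp); omega
    subst this
    exact ⟨1, rfl⟩
  have hs := h.sameCycle hw
  have hfix : ∀ a, permFin n w a ≠ a := by
    intro a ha
    have : ∀ b, a = b := fun b => (hs a b).eq_of_left ha
    have h0 := (this ⟨0, by omega⟩).symm.trans (this ⟨1, hn⟩)
    simp [Fin.ext_iff] at h0
  -- An n-cycle, whose sign is compared with the one counted letter by letter.
  have hc : (permFin n w).IsCycle := ⟨⟨0, by omega⟩, hfix _, fun b _ => hs _ b⟩
  have hsupp : (permFin n w).support = Finset.univ := by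
    ext a; simpa using hfix a
  have h1 := hc.sign
  rw [sign_permFin hw, hsupp, Finset.card_univ, Fintype.card_fin] at h1
  rcases Nat.even_or_odd (w.length + n + 1) with h2 | h2
  · exact h2
  · exfalso
    have h3 : ((-1 : ℤˣ)) ^ (w.length + n + 1) = -1 := h2.neg_one_pow
    rw [pow_succ, pow_add, h1, neg_mul, ← pow_add, Even.neg_one_pow ⟨n, rfl⟩] at h3
    simp at h3

/-! ### Removing generators that occur once -/

theorem generators_append (u v : List (ℕ × Bool)) :
    generators (u ++ v) = generators u ++ generators v := List.map_append

/-- A generator that occurs can be brought to the end. -/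
theorem exists_rotation {n : ℕ} {w : List (ℕ × Bool)} (hw : Valid n w) {i : ℕ}
    (hi : i ∈ generators w) : ∃ (u : List (ℕ × Bool)) (e : Bool),
      (u ++ [(i, e)]).Perm w ∧
      AmbientIsotopic (closureSet n w) (closureSet n (u ++ [(i, e)])) := by
  obtain ⟨⟨i, e⟩, hg, rfl⟩ := List.mem_map.1 hi
  obtain ⟨a, b, rfl⟩ := List.append_of_mem hg
  refine ⟨b ++ a, e, ?_, ?_⟩
  · rw [List.append_assoc]
    have : a ++ (i, e) :: b = (a ++ [(i, e)]) ++ b := by simp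
    rw [this]
    exact List.perm_append_comm
  · have : a ++ (i, e) :: b = (a ++ [(i, e)]) ++ b := by simp
    rw [this] at hw ⊢
    have h := closureSet_rotate hw.left hw.right
    rw [← List.append_assoc b] at h
    exact h

theorem valid_of_notMem {m : ℕ} {w : List (ℕ × Bool)} (hw : Valid (m + 2) w)
    (h : m ∉ generators w) : Valid (m + 1) w := by
  intro g hg
  have h1 := hw g hg
  have h2 : g.1 ≠ m := fun e => h (e ▸ List.mem_map_of_mem hg)
  omega

/-- A word in which every generator occurs exactly once closes to the trivial knot. -/
theorem closureSet_trivial {m : ℕ} {w : List (ℕ × Bool)} (hw : Valid (m + 1) w)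
    (hg : ∀ i < m, i ∈ generators w) (hl : w.length = m) :
    AmbientIsotopic (closureSet (m + 1) w) roundCircle := by
  induction m generalizing w with
  | zero =>
    obtain rfl := List.length_eq_zero_iff.1 hl
    exact closureSet_one
  | succ m ih =>
    obtain ⟨u, e, hp, hiso⟩ := exists_rotation hw (hg m (by omega))
    have hgu : ∀ i < m, i ∈ generators u := by
      intro i hi
      have : i ∈ generators (u ++ [(m, e)]) := (hp.map Prod.fst).mem_iff.2 (hg i (by omega))
      rw [generators_append, List.mem_append] at this
      rcases this with h | h
      · exact h
      · simp [generators] at h; omega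
    have hlu : u.length = m := by have := hp.length_eq; simp at this; omega
    have hm : m ∉ generators u := by
      intro h
      -- `u` has only m letters, which the m smaller generators already use up.
      have := le_length_of_forall_mem (m := m + 1) (l := generators u) (fun i hi => by
        rcases Nat.lt_succ_iff_lt_or_eq.1 hi with h' | rfl
        exacts [hgu i h', h])
      simp [generators] at this; omega
    have hvu : Valid (m + 2) (u ++ [(m, e)]) := fun g hg => hw g (hp.mem_iff.1 hg)
    have hv := valid_of_notMem hvu.left hm
    exact hiso.trans ((closureSet_destabilize hv e).trans (ih hv hgu hlu))

/-! ### Words of length one more than the number of strands -/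

/-- Two words can be exchanged inside every word without changing its closure. -/
def Interchangeable (n : ℕ) (p q : List (ℕ × Bool)) : Prop :=
  ∀ u v, Valid n u → Valid n v →
    AmbientIsotopic (closureSet n (u ++ p ++ v)) (closureSet n (u ++ q ++ v))

theorem Interchangeable.symm {n : ℕ} {p q : List (ℕ × Bool)} (h : Interchangeable n p q) :
    Interchangeable n q p := fun u v hu hv => (h u v hu hv).symm

theorem Interchangeable.trans {n : ℕ} {p q r : List (ℕ × Bool)} (h : Interchangeable n p q)
    (h' : Interchangeable n q r) : Interchangeable n p r :=
  fun u v hu hv => (h u v hu hv).trans (h' u v hu hv)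

theorem Interchangeable.within {n : ℕ} {p q : List (ℕ × Bool)} (h : Interchangeable n p q)
    {a b : List (ℕ × Bool)} (ha : Valid n a) (hb : Valid n b) :
    Interchangeable n (a ++ p ++ b) (a ++ q ++ b) := by
  intro u v hu hv
  have := h (u ++ a) (b ++ v) (hu.append ha) (hb.append hv)
  simpa only [List.append_assoc] using this

theorem Interchangeable.isotopic {n : ℕ} {p q : List (ℕ × Bool)} (h : Interchangeable n p q) :
    AmbientIsotopic (closureSet n p) (closureSet n q) := by
  simpa using h [] [] (valid_nil n) (valid_nil n)

/-! ### Braid relations with arbitrary signs. -/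

theorem interchangeable_cancel {n i : ℕ} (hi : i + 1 < n) (e : Bool) :
    Interchangeable n [(i, e), (i, !e)] [] := by
  intro u v hu hv
  simpa using closureSet_cancel hu hv hi e

theorem interchangeable_braid {n i : ℕ} (hi : i + 2 < n) :
    Interchangeable n [(i, true), (i + 1, true), (i, true)]
      [(i + 1, true), (i, true), (i + 1, true)] :=
  fun _ _ hu hv => closureSet_braid hu hv hi

/-- The braid relation for the inverses of the generators. -/
theorem interchangeable_braid_neg {n i : ℕ} (hi : i + 2 < n) :
    Interchangeable n [(i, false), (i + 1, false), (i, false)]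
      [(i + 1, false), (i, false), (i + 1, false)] := by
  have hx : ∀ e, Valid n [(i, e)] := fun e => Valid.cons (by simp; omega) (valid_nil n)
  have hy : ∀ e, Valid n [(i + 1, e)] := fun e => Valid.cons (by simp; omega) (valid_nil n)
  have cx := fun e => interchangeable_cancel (n := n) (i := i) (by omega) e
  have cy := fun e => interchangeable_cancel (n := n) (i := i + 1) (by omega) e
  have vx := hx false
  have vy := hy false
  have hY := (vy.append vx).append vy
  have hX := (vx.append vy).append vx
  -- With x, y the two generators, X = x⁻¹y⁻¹x⁻¹ and Y = y⁻¹x⁻¹y⁻¹: X ~ Y(yxy)X ~ Y(xyx)X ~ Y.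
  have s1 := (cy false).within (vy.append vx) ((hx true).append ((hy true).append hX))
  have s2 := (cx false).within vy ((hy true).append hX)
  have s3 := (cy false).within (valid_nil n) hX
  have s4 := (interchangeable_braid hi).symm.within hY hX
  have s5 := (cx true).within (hY.append ((hx true).append (hy true))) (vy.append vx)
  have s6 := (cy true).within (hY.append (hx true)) vx
  have s7 := (cx true).within hY (valid_nil n)
  simp only [List.cons_append, List.nil_append, List.append_nil, Bool.not_true,
    Bool.not_false] at s1 s2 s3 s4 s5 s6 s7
  exact (s3.symm.trans (s2.symm.trans (s1.symm.trans s4))).trans (s5.trans (s6.trans s7))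

/-- xyx⁻¹ ~ y⁻¹(yxy)x⁻¹ ~ y⁻¹(xyx)x⁻¹ ~ y⁻¹xy. -/
theorem interchangeable_mixed {n i : ℕ} (hi : i + 2 < n) :
    Interchangeable n [(i, true), (i + 1, true), (i, false)]
      [(i + 1, false), (i, true), (i + 1, true)] := by
  have hx : ∀ e, Valid n [(i, e)] := fun e => Valid.cons (by simp; omega) (valid_nil n)
  have hy : ∀ e, Valid n [(i + 1, e)] := fun e => Valid.cons (by simp; omega) (valid_nil n)
  have s1 := (interchangeable_cancel (n := n) (i := i + 1) (by omega) false).within (valid_nil n)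
    ((hx true).append ((hy true).append (hx false)))
  have s2 := (interchangeable_braid hi).symm.within (hy false) (hx false)
  have s3 := (interchangeable_cancel (n := n) (i := i) (by omega) true).within
    ((hy false).append ((hx true).append (hy true))) (valid_nil n)
  simp only [List.cons_append, List.nil_append, List.append_nil, Bool.not_true,
    Bool.not_false] at s1 s2 s3
  exact s1.symm.trans (s2.trans s3)

theorem interchangeable_mixed' {n i : ℕ} (hi : i + 2 < n) :
    Interchangeable n [(i + 1, false), (i, false), (i + 1, true)]
      [(i, true), (i + 1, false), (i, false)] := by
  have hx : ∀ e, Valid n [(i, e)] := fun e => Valid.cons (by simp; omega) (valid_nil n)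
  have hy : ∀ e, Valid n [(i + 1, e)] := fun e => Valid.cons (by simp; omega) (valid_nil n)
  have s1 := (interchangeable_cancel (n := n) (i := i) (by omega) true).within (valid_nil n)
    ((hy false).append ((hx false).append (hy true)))
  have s2 := (interchangeable_braid_neg hi).within (hx true) (hy true)
  have s3 := (interchangeable_cancel (n := n) (i := i + 1) (by omega) false).within
    ((hx true).append ((hy false).append (hx false))) (valid_nil n)
  simp only [List.cons_append, List.nil_append, List.append_nil, Bool.not_true,
    Bool.not_false] at s1 s2 s3
  exact s1.symm.trans (s2.trans s3)

/-- `S` is trivial, a trefoil, or the figure-eight knot. -/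
def IsSmall (S : Set Space) : Prop :=
  IsTrivial S ∨ IsTrefoil S ∨ IsFigureEight S

theorem IsSmall.of_isotopic {S T : Set Space} (h : AmbientIsotopic S T) (hT : IsSmall T) :
    IsSmall S := by
  rcases hT with hT | ⟨e, hT⟩ | hT
  exacts [Or.inl (h.trans hT), Or.inr (Or.inl ⟨e, h.trans hT⟩), Or.inr (Or.inr (h.trans hT))]

theorem closedBraid_trefoilWord (e : Bool) :
    closedBraid (trefoilWord e) = closureSet 2 [(0, e), (0, e), (0, e)] :=
  closedBraid_eq_closureSet _

theorem closedBraid_figureEightWord :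
    closedBraid figureEightWord = closureSet 3 [(0, true), (1, false), (0, true), (1, false)] :=
  closedBraid_eq_closureSet _

/-! ### Words on two and on three strands. -/

theorem valid_two (e f g : Bool) : Valid 2 [(0, e), (0, f), (0, g)] := by
  intro g hg; simp at hg; rcases hg with rfl | rfl | rfl <;> simp

/-- Either two adjacent letters cancel and one crossing is left, which closes to the trivial knot,
or all signs agree. -/
theorem isSmall_two_strands (a b c : Bool) : IsSmall (closureSet 2 [(0, a), (0, b), (0, c)]) := by
  have h1 : ∀ e, IsSmall (closureSet 2 [(0, e)]) := fun e =>
    Or.inl (closureSet_trivial (m := 1) (Valid.cons (by simp) (valid_nil 2))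
      (fun i hi => by simp [generators]; omega) rfl)
  have hv : ∀ e, Valid 2 [(0, e)] := fun e => Valid.cons (by simp) (valid_nil 2)
  by_cases hab : b = !a
  · subst hab
    exact (h1 c).of_isotopic (closureSet_cancel (valid_nil 2) (hv c) (by omega) a)
  by_cases hbc : c = !b
  · subst hbc
    exact (h1 a).of_isotopic (closureSet_cancel (hv a) (valid_nil 2) (by omega) b)
  obtain rfl : a = b := by cases a <;> cases b <;> simp_all
  obtain rfl : a = c := by cases a <;> cases c <;> simp_all
  refine Or.inr (Or.inl ⟨a, ?_⟩)
  rw [closedBraid_trefoilWord]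
  exact AmbientIsotopic.refl _

theorem valid_three {w : List (ℕ × Bool)} (h : ∀ g ∈ w, g.1 < 2) : Valid 3 w :=
  fun g hg => by have := h g hg; omega

theorem isSmall_pair (e f : Bool) : IsSmall (closureSet 3 [(0, e), (1, f)]) :=
  Or.inl (closureSet_trivial (m := 2) (valid_three (by simp))
    (fun i hi => by simp [generators]; omega) rfl)

theorem isSmall_pair' (e f : Bool) : IsSmall (closureSet 3 [(1, f), (0, e)]) :=
  Or.inl (closureSet_trivial (m := 2) (valid_three (by simp))
    (fun i hi => by simp [generators]; omega) rfl)

theorem isSmall_rotate {n : ℕ} {u v : List (ℕ × Bool)} (hu : Valid n u) (hv : Valid n v)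
    (h : IsSmall (closureSet n (u ++ v))) : IsSmall (closureSet n (v ++ u)) :=
  h.of_isotopic (closureSet_rotate hv hu)

/-- Conjugate to x³y, which destabilises to x³ on two strands. -/
theorem isSmall_cube (e : Bool) : IsSmall (closureSet 3 [(0, e), (0, e), (1, e), (0, e)]) := by
  have hv : Valid 3 [(0, e), (0, e), (1, e)] := valid_three (by simp)
  have hx : Valid 3 [(0, e)] := valid_three (by simp)
  refine isSmall_rotate (u := [(0, e)]) hx hv ?_
  exact (isSmall_two_strands e e e).of_isotopic
    (closureSet_destabilize (m := 1) (w := [(0, e), (0, e), (0, e)]) (valid_two e e e) e)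

/-- Rotation by two letters pairs up the sixteen sign patterns. Equal signs give a trefoil by xyxy ~
xxyx, and the two alternating patterns give the figure-eight knot. In the others a braid relation
creates a cancelling pair, and two letters remain, one of each generator. -/
theorem isSmall_three_strands (a b c d : Bool) :
    IsSmall (closureSet 3 [(0, a), (1, b), (0, c), (1, d)]) := by
  have hx : ∀ e, Valid 3 [(0, e)] := fun e => valid_three (by simp)
  have hy : ∀ e, Valid 3 [(1, e)] := fun e => valid_three (by simp)
  have hp : ∀ e f, Valid 3 [(0, e), (1, f)] := fun e f => valid_three (by simp)
  have hq : ∀ e f, Valid 3 [(1, e), (0, f)] := fun e f => valid_three (by simp)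
  have v0 := valid_nil 3
  have cx := fun e => interchangeable_cancel (n := 3) (i := 0) (by omega) e
  have cy := fun e => interchangeable_cancel (n := 3) (i := 1) (by omega) e
  have br := interchangeable_braid (n := 3) (i := 0) (by omega)
  have bn := interchangeable_braid_neg (n := 3) (i := 0) (by omega)
  have turn : ∀ {a b c d}, IsSmall (closureSet 3 [(0, c), (1, d), (0, a), (1, b)]) →
      IsSmall (closureSet 3 [(0, a), (1, b), (0, c), (1, d)]) := fun {a b c d} h =>
    isSmall_rotate (u := [(0, c), (1, d)]) (hp c d) (hp a b) h
  have p1 : IsSmall (closureSet 3 [(0, true), (1, true), (0, true), (1, false)]) :=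
    (isSmall_pair' true true).of_isotopic
      ((br.within v0 (hy false)).trans ((cy true).within (hq true true) v0)).isotopic
  have p2 : IsSmall (closureSet 3 [(0, false), (1, true), (0, true), (1, true)]) :=
    (isSmall_pair' true true).of_isotopic
      ((br.symm.within (hx false) v0).trans ((cx false).within v0 (hq true true))).isotopic
  have n1 : IsSmall (closureSet 3 [(0, false), (1, false), (0, false), (1, true)]) :=
    (isSmall_pair' false false).of_isotopic
      ((bn.within v0 (hy true)).trans ((cy false).within (hq false false) v0)).isotopic
  have n2 : IsSmall (closureSet 3 [(0, true), (1, false), (0, false), (1, false)]) :=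
    (isSmall_pair' false false).of_isotopic
      ((bn.symm.within (hx true) v0).trans ((cx true).within v0 (hq false false))).isotopic
  have m1 : IsSmall (closureSet 3 [(0, true), (1, true), (0, false), (1, false)]) :=
    (isSmall_pair' true false).of_isotopic
      (((interchangeable_mixed (n := 3) (i := 0) (by omega)).within v0 (hy false)).trans
        ((cy true).within (hq false true) v0)).isotopic
  have m2 : IsSmall (closureSet 3 [(0, true), (1, false), (0, false), (1, true)]) := by
    refine IsSmall.of_isotopic
      ((interchangeable_mixed' (n := 3) (i := 0) (by omega)).within (hx true) v0).isotopic ?_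
    refine isSmall_rotate (u := [(0, false)]) (v := [(0, true), (0, true), (1, false)]) (hx _)
      (valid_three (by simp)) ?_
    exact (isSmall_pair true false).of_isotopic ((cx false).within v0 (hp true false)).isotopic
  have f1 : IsSmall (closureSet 3 [(0, true), (1, false), (0, true), (1, false)]) := by
    refine Or.inr (Or.inr ?_)
    rw [IsFigureEight, closedBraid_figureEightWord]
    exact AmbientIsotopic.refl _
  -- The figure-eight knot is its own mirror image: the half turn swaps the two generators and
  -- reverses the word, which carries one alternating pattern to the other.
  have f2 : IsSmall (closureSet 3 [(0, false), (1, true), (0, false), (1, true)]) :=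
    f1.of_isotopic (closureSet_flip (valid_three (by simp)))
  have a1 : IsSmall (closureSet 3 [(0, true), (1, true), (0, true), (1, true)]) :=
    (isSmall_cube true).of_isotopic (br.symm.within (hx true) v0).isotopic
  have a2 : IsSmall (closureSet 3 [(0, false), (1, false), (0, false), (1, false)]) :=
    (isSmall_cube false).of_isotopic (bn.symm.within (hx false) v0).isotopic
  cases a <;> cases b <;> cases c <;> cases d
  exacts [a2, n1, turn n2, turn m1, turn n1, f2, turn m2, p2, n2, m2, f1, turn p1, m1, turn p2, p1,
    a1]

/-! ### Counting occurrences of generators. -/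

theorem sum_count_generators {m : ℕ} {w : List (ℕ × Bool)} (hw : Valid (m + 1) w) :
    ∑ i ∈ Finset.range m, (generators w).count i = w.length := by
  have := Multiset.sum_count_eq_card (s := Finset.range m) (m := (generators w : Multiset ℕ))
    (fun i hi => by
      obtain ⟨g, hg, rfl⟩ := List.mem_map.1 (Multiset.mem_coe.1 hi)
      have := hw g hg
      exact Finset.mem_range.2 (by omega))
  simpa [generators] using this

/-- Without the generator `1`, the strand in position `0` can only visit the positions `0`
and `1`. -/
theorem perm_zero {w : List (ℕ × Bool)} (h : 1 ∉ generators w) :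
    (perm w 0 = if Even ((generators w).count 0) then 0 else 1) ∧
      perm w 1 = if Even ((generators w).count 0) then 1 else 0 := by
  induction w with
  | nil => simp [perm, generators]
  | cons g w ih =>
    simp only [generators, List.map_cons, List.mem_cons, not_or] at h
    obtain ⟨h1, h2⟩ := ih h.2
    simp only [perm, Equiv.Perm.mul_apply]
    rcases Nat.eq_zero_or_pos g.1 with hg | hg
    · simp only [generators, List.map_cons, hg, zero_add, Equiv.swap_apply_left,
        Equiv.swap_apply_right, List.count_cons_self, Nat.even_add_one] at h1 h2 ⊢
      rw [h1, h2]
      by_cases h : Even ((w.map Prod.fst).count 0) <;> simp only [h, if_true, if_false, not_true,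
        not_false_iff, and_self]
    · have e0 : Equiv.swap g.1 (g.1 + 1) 0 = 0 :=
        Equiv.swap_apply_of_ne_of_ne (by omega) (by omega)
      have e1 : Equiv.swap g.1 (g.1 + 1) 1 = 1 :=
        Equiv.swap_apply_of_ne_of_ne h.1 (by omega)
      have ec : (generators (g :: w)).count 0 = (generators w).count 0 := by
        simp only [generators, List.map_cons]
        exact List.count_cons_of_ne (by omega)
      rw [e0, e1, ec]
      exact ⟨h1, h2⟩

theorem perm_append (u v : List (ℕ × Bool)) (j : ℕ) : perm (u ++ v) j = perm v (perm u j) := by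
  induction u generalizing j with
  | nil => rfl
  | cons g u ih => rw [List.cons_append, perm, perm, Equiv.Perm.mul_apply, ih,
      Equiv.Perm.mul_apply]

theorem count_eq_of_perm {u v : List (ℕ × Bool)} (h : u.Perm v) (i : ℕ) :
    (generators u).count i = (generators v).count i := (h.map Prod.fst).count_eq i

theorem Transitive.perm_zero_ne {n : ℕ} (hn : 2 ≤ n) {w : List (ℕ × Bool)}
    (ht : Transitive n w) : perm w 0 ≠ 0 := by
  intro hfix
  have := ht {0} (fun j _ => by
    rw [Set.mem_singleton_iff, Set.mem_singleton_iff, ← (perm w).apply_eq_iff_eq, hfix])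
    0 (by omega) rfl 1 (by omega)
  simp at this

/-- If the generator `0` occurs twice and `1` once, then some strand closes up on its own. -/
theorem not_isConnected_of_count {n : ℕ} (hn : 3 ≤ n) {w : List (ℕ × Bool)} (hw : Valid n w)
    (h0 : (generators w).count 0 = 2) (h1 : (generators w).count 1 = 1) :
    ¬ IsConnected (closureSet n w) := by
  intro hc
  obtain ⟨u, e, hp, hiso⟩ := exists_rotation hw (i := 1) (List.count_pos_iff.1 (by omega))
  have hv : Valid n (u ++ [(1, e)]) := fun g hg => hw g (hp.mem_iff.1 hg)
  have ht := transitive_of_isPreconnected hv (hiso.isConnected hc).isPreconnected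
  rw [← count_eq_of_perm hp] at h0 h1
  simp only [generators_append, List.count_append] at h0 h1
  have h0' : (generators u).count 0 = 2 := by simpa [generators] using h0
  have h1' : (generators u).count 1 = 0 := by simpa [generators] using h1
  -- With the only letter 1 rotated to the end, the two letters 0 bring the strand back to position
  -- 0, which the last letter does not touch.
  have hfix : perm (u ++ [(1, e)]) 0 = 0 := by
    rw [perm_append, (perm_zero (List.count_eq_zero.1 h1')).1, h0', if_pos even_two]
    simp only [perm, one_mul]
    exact Equiv.swap_apply_of_ne_of_ne (by omega) (by omega)
  exact ht.perm_zero_ne (by omega) hfix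

/-- The induction step: the single occurrence of the last generator is rotated to the end and
removed, which lowers strands and length by one each. -/
theorem isSmall_of_destabilize {m : ℕ} {w : List (ℕ × Bool)} (hw : Valid (m + 2) w)
    (h1 : (generators w).count m = 1)
    (h : ∀ u, Valid (m + 1) u → u.length + 1 = w.length →
      AmbientIsotopic (closureSet (m + 2) w) (closureSet (m + 1) u) →
      IsSmall (closureSet (m + 1) u)) : IsSmall (closureSet (m + 2) w) := by
  obtain ⟨u, e, hp, hiso⟩ := exists_rotation hw (i := m) (List.count_pos_iff.1 (by omega))
  have hv : Valid (m + 2) (u ++ [(m, e)]) := fun g hg => hw g (hp.mem_iff.1 hg)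
  rw [← count_eq_of_perm hp, generators_append, List.count_append] at h1
  have h1' : (generators u).count m = 0 := by simpa [generators] using h1
  have hvu := valid_of_notMem hv.left (List.count_eq_zero.1 h1')
  have hiso' := hiso.trans (closureSet_destabilize hvu e)
  exact (h u hvu (by simpa using hp.length_eq) hiso').of_isotopic hiso'

theorem generators_flipWord (n : ℕ) (w : List (ℕ × Bool)) :
    generators (flipWord n w) = ((generators w).map fun i => n - 2 - i).reverse := by
  simp [generators, flipWord, Function.comp_def]

theorem count_flipWord {m : ℕ} {w : List (ℕ × Bool)} (hw : Valid (m + 2) w) :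
    (generators (flipWord (m + 2) w)).count m = (generators w).count 0 := by
  rw [generators_flipWord, List.count_reverse]
  have hg : ∀ i ∈ generators w, i ≤ m := by
    intro i hi
    obtain ⟨g, hg, rfl⟩ := List.mem_map.1 hi
    have := hw g hg
    omega
  generalize generators w = l at hg
  induction l with
  | nil => rfl
  | cons i l ih =>
    rw [List.map_cons, List.count_cons, List.count_cons, ih fun i hi => hg i (by simp [hi])]
    have := hg i (by simp)
    congr 1
    have : (m + 2 - 2 - i == m) = (i == 0) := by
      rw [Bool.eq_iff_iff, beq_iff_eq, beq_iff_eq]; omega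
    rw [this]

theorem exists_eq_of_length_three {w : List (ℕ × Bool)} (hw : Valid 2 w) (hl : w.length = 3) :
    ∃ a b c, w = [(0, a), (0, b), (0, c)] := by
  obtain ⟨⟨i, a⟩, ⟨j, b⟩, ⟨k, c⟩, rfl⟩ := List.length_eq_three.1 hl
  have h1 := hw (i, a) (by simp)
  have h2 := hw (j, b) (by simp)
  have h3 := hw (k, c) (by simp)
  simp only at h1 h2 h3
  obtain rfl : i = 0 := by omega
  obtain rfl : j = 0 := by omega
  obtain rfl : k = 0 := by omega
  exact ⟨a, b, c, rfl⟩

theorem isSmall_of_length_four {w : List (ℕ × Bool)} (hw : Valid 3 w) (hl : w.length = 4)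
    (hc : IsConnected (closureSet 3 w)) (h0 : (generators w).count 0 = 2) :
    IsSmall (closureSet 3 w) := by
  have ht := transitive_of_isPreconnected hw hc.isPreconnected
  match w, hl with
  | [(i, a), (j, b), (k, c), (l, d)], _ =>
    have h1 := hw (i, a) (by simp)
    have h2 := hw (j, b) (by simp)
    have h3 := hw (k, c) (by simp)
    have h4 := hw (l, d) (by simp)
    simp only at h1 h2 h3 h4
    have hx : ∀ e, Valid 3 [(0, e)] := fun e => valid_three (by simp)
    have hfix := ht.perm_zero_ne (by omega)
    simp only [perm, one_mul, Equiv.Perm.mul_apply] at hfix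
    simp only [generators, List.map_cons, List.map_nil] at h0
    have hi : i = 0 ∨ i = 1 := by omega
    have hj : j = 0 ∨ j = 1 := by omega
    have hk : k = 0 ∨ k = 1 := by omega
    have hl : l = 0 ∨ l = 1 := by omega
    -- If the two letters 0 are cyclically adjacent, position 0 is fixed, contrary to transitivity.
    -- The two alternating arrangements remain, one of them after a rotation.
    rcases hi with rfl | rfl <;> rcases hj with rfl | rfl <;> rcases hk with rfl | rfl <;>
      rcases hl with rfl | rfl <;> first
      | exact absurd h0 (by decide)
      | exact absurd (by decide) hfix
      | exact isSmall_three_strands a b c d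
      | exact isSmall_rotate (u := [(0, d)]) (hx d) (valid_three (by simp))
          (isSmall_three_strands d a b c)

/-- A connected closure of a word on `m + 1` strands of length `m + 2` is trivial, a trefoil or
the figure-eight knot. -/
theorem isSmall_of_length {m : ℕ} {w : List (ℕ × Bool)} (hw : Valid (m + 1) w)
    (hc : IsConnected (closureSet (m + 1) w)) (hl : w.length = m + 2) :
    IsSmall (closureSet (m + 1) w) := by
  induction m generalizing w with
  | zero =>
    cases w with
    | nil => simp at hl
    | cons g w => have := hw g (by simp); omega
  | succ m ih =>
    have ih' : ∀ u, Valid (m + 1) u → u.length + 1 = m + 1 + 2 → ∀ v,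
        AmbientIsotopic (closureSet (m + 2) v) (closureSet (m + 1) u) →
        IsConnected (closureSet (m + 2) v) → IsSmall (closureSet (m + 1) u) :=
      fun u hu hlu v hi hcv => ih hu (hi.isConnected hcv) (by omega)
    have ht := transitive_of_isPreconnected hw hc.isPreconnected
    have hpos : ∀ i < m + 1, 1 ≤ (generators w).count i := fun i hi =>
      List.count_pos_iff.2 (ht.mem_generators (by omega))
    have hsum := sum_count_generators hw
    rw [hl] at hsum
    by_cases hlast : (generators w).count m = 1
    · exact isSmall_of_destabilize hw hlast fun u hu hlu hi => ih' u hu (by omega) w hi hc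
    by_cases hfirst : (generators w).count 0 = 1
    · have hf := closureSet_flip hw
      have hlf : (flipWord (m + 2) w).length = w.length := by simp [flipWord]
      refine (isSmall_of_destabilize hw.flipWord ((count_flipWord hw).trans hfirst)
        fun u hu hlu hi => ?_).of_isotopic hf
      exact ih' u hu (hlu.trans (hlf.trans hl)) _ hi (hf.isConnected hc)
    have hge0 := hpos 0 (by omega)
    have hgem := hpos m (by omega)
    -- Every generator occurs, so the occurrences beyond the first ones number exactly two.
    have hsum' : ∑ i ∈ Finset.range (m + 1), ((generators w).count i - 1) = 2 := by
      have : ∑ i ∈ Finset.range (m + 1), (generators w).count i =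
          ∑ i ∈ Finset.range (m + 1), ((generators w).count i - 1) + (m + 1) := by
        have e : m + 1 = ∑ i ∈ Finset.range (m + 1), 1 := by simp
        nth_rewrite 3 [e]
        rw [← Finset.sum_add_distrib]
        exact Finset.sum_congr rfl fun i hi => by
          have := hpos i (Finset.mem_range.1 hi); omega
      omega
    match m with
    | 0 =>
      obtain ⟨a, b, c, rfl⟩ := exists_eq_of_length_three hw hl
      exact isSmall_two_strands a b c
    | 1 =>
      simp only [Finset.sum_range_succ, Finset.sum_range_zero] at hsum
      exact isSmall_of_length_four hw hl hc (by omega)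
    | m + 2 =>
      exfalso
      -- Both end generators take one unit of excess each, and this leaves none for the generator 1,
      -- which is distinct from both here.
      have hsub := Finset.sum_le_sum_of_subset (f := fun i => (generators w).count i - 1)
        (show ({0, 1, m + 2} : Finset ℕ) ⊆ Finset.range (m + 2 + 1) by
          intro i hi
          simp only [Finset.mem_insert, Finset.mem_singleton] at hi
          rw [Finset.mem_range]; omega)
      rw [hsum', Finset.sum_insert (by simp), Finset.sum_insert (by simp),
        Finset.sum_singleton] at hsub
      have h1 := hpos 1 (by omega)
      exact not_isConnected_of_count (by omega) hw (by omega) (by omega) hc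

/-! ### The reduced length -/

theorem exists_braidWord {n : ℕ} {w : List (ℕ × Bool)} (hw : Valid n w) :
    ∃ w' : BraidWord n, w'.map natLetter = w := by
  induction w with
  | nil => exact ⟨[], rfl⟩
  | cons g w ih =>
    obtain ⟨w', rfl⟩ := ih fun k hk => hw k (by simp [hk])
    have hg := hw g (by simp)
    exact ⟨(⟨g.1, by omega⟩, g.2) :: w', rfl⟩

theorem exists_represents_iff {n l : ℕ} {K : Set Space} :
    (∃ w : BraidWord n, w.length = l ∧ Represents w K) ↔
      ∃ w, Valid n w ∧ w.length = l ∧ AmbientIsotopic (closureSet n w) K := by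
  constructor
  · rintro ⟨w, rfl, hw⟩
    rw [Represents, closedBraid_eq_closureSet] at hw
    exact ⟨_, valid_map_natLetter w, by simp, hw⟩
  · rintro ⟨w, hv, rfl, hw⟩
    obtain ⟨w', rfl⟩ := exists_braidWord hv
    exact ⟨w', by simp, by rwa [Represents, closedBraid_eq_closureSet]⟩

/-- Transitivity gives length at least n - 1, nontriviality excludes equality, and parity excludes n
and n + 2; at n + 1 the classification applies. -/
theorem length_of_isKnot {n : ℕ} {K : Set Space} (hK : IsKnot K) (hn : ¬ IsTrivial K)
    {w : List (ℕ × Bool)} (hw : Valid n w) (h : AmbientIsotopic (closureSet n w) K) :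
    w.length = n + 1 ∧ (IsTrefoil K ∨ IsFigureEight K) ∨ n + 3 ≤ w.length := by
  have hc := h.symm.isConnected hK.isConnected
  obtain ⟨m, rfl⟩ : ∃ m, n = m + 1 := by
    refine ⟨n - 1, ?_⟩
    rcases Nat.eq_zero_or_pos n with rfl | h0
    · rw [closureSet_zero hw] at hc
      exact absurd hc.nonempty Set.not_nonempty_empty
    · omega
  have ht := transitive_of_isPreconnected hw hc.isPreconnected
  have hg : ∀ i < m, i ∈ generators w := fun i hi => ht.mem_generators (by omega)
  have hle : m ≤ w.length := by simpa [generators] using le_length_of_forall_mem hg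
  have hne : w.length ≠ m := fun hl => hn (h.symm.trans (closureSet_trivial hw hg hl))
  obtain ⟨k, hk⟩ := ht.even_length_add (by omega) hw
  by_cases hl : w.length = m + 2
  · refine Or.inl ⟨hl, ?_⟩
    rcases (isSmall_of_length hw hc hl).of_isotopic h.symm with h' | h' | h'
    exacts [absurd h' hn, Or.inl h', Or.inr h']
  · right; omega

theorem exists_stabilized {m : ℕ} {K : Set Space} {w : List (ℕ × Bool)} (hw : Valid (m + 1) w)
    (h : AmbientIsotopic (closureSet (m + 1) w) K) (k : ℕ) :
    ∃ w', Valid (m + k + 1) w' ∧ AmbientIsotopic (closureSet (m + k + 1) w') K := by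
  induction k with
  | zero => exact ⟨w, hw, h⟩
  | succ k ih =>
    obtain ⟨w', hw', h'⟩ := ih
    -- Destabilisation read backwards: a new last strand with a single crossing.
    refine ⟨w' ++ [(m + k, true)], ?_, (closureSet_destabilize hw' true).trans h'⟩
    intro g hg
    rcases List.mem_append.1 hg with hg | hg
    · have := hw' g hg; omega
    · rw [List.mem_singleton.1 hg]; simp only; omega

theorem exists_word_of_braidIndex_le {n : ℕ} {K : Set Space} (hK : IsKnot K)
    (h : braidIndex K ≤ n) : ∃ w, Valid n w ∧ AmbientIsotopic (closureSet n w) K := by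
  obtain ⟨m, ⟨w, hw⟩, hmn⟩ : ∃ m : ℕ, (∃ w : BraidWord m, Represents w K) ∧ m ≤ n := by
    by_contra! hcon
    have : ((n + 1 : ℕ) : ℕ∞) ≤ braidIndex K :=
      le_iInf₂ fun m hm => by exact_mod_cast hcon m hm
    have := this.trans h
    rw [Nat.cast_le] at this
    omega
  obtain ⟨v, hv, -, hiso⟩ := exists_represents_iff.1 ⟨w, rfl, hw⟩
  obtain ⟨m, rfl⟩ : ∃ k, m = k + 1 := by
    refine ⟨m - 1, ?_⟩
    rcases Nat.eq_zero_or_pos m with rfl | h0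
    · have hc := hiso.symm.isConnected hK.isConnected
      rw [closureSet_zero hv] at hc
      exact absurd hc.nonempty Set.not_nonempty_empty
    · omega
  obtain ⟨v', hv', hiso'⟩ := exists_stabilized hv hiso (n - (m + 1))
  have e : m + (n - (m + 1)) + 1 = n := by omega
  rw [e] at hv' hiso'
  exact ⟨v', hv', hiso'⟩

/-- The set of lengths is nonempty from the braid index on, so the infimum is attained and is not
the default value 0 of an empty set. -/
theorem exists_word_minLength {n : ℕ} {K : Set Space} (hK : IsKnot K) (h : braidIndex K ≤ n) :
    ∃ w, Valid n w ∧ w.length = minLength n K ∧ AmbientIsotopic (closureSet n w) K := by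
  obtain ⟨w, hw, hiso⟩ := exists_word_of_braidIndex_le hK h
  have hne : {l : ℕ | ∃ w : BraidWord n, w.length = l ∧ Represents w K}.Nonempty :=
    ⟨w.length, exists_represents_iff.2 ⟨w, hw, rfl, hiso⟩⟩
  exact exists_represents_iff.1 (Nat.sInf_mem hne)

theorem braidIndex_le {n : ℕ} {K : Set Space} {w : BraidWord n} (h : Represents w K) :
    braidIndex K ≤ n := iInf₂_le n ⟨w, h⟩

theorem reducedLength_eq_one {n : ℕ} {K : Set Space} (hK : IsKnot K) (hn : ¬ IsTrivial K)
    {w : BraidWord n} (hw : Represents w K) (hl : w.length = n + 1) : reducedLength n K = 1 := by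
  have hle : minLength n K ≤ n + 1 := Nat.sInf_le ⟨w, hl, hw⟩
  obtain ⟨v, hv, hlv, hiso⟩ := exists_word_minLength hK (braidIndex_le hw)
  have := length_of_isKnot hK hn hv hiso
  rw [reducedLength]
  omega

end KnotBraid

theorem theorem1p5 (K : Set KnotBraid.Space) (hK : KnotBraid.IsKnot K)
    (hnontrivial : ¬ KnotBraid.IsTrivial K) :
    ((∃ n : ℕ, KnotBraid.braidIndex K ≤ (n : ℕ∞) ∧ KnotBraid.reducedLength n K = 1) ↔
        (KnotBraid.IsTrefoil K ∨ KnotBraid.IsFigureEight K)) ∧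
      (¬ (KnotBraid.IsTrefoil K ∨ KnotBraid.IsFigureEight K) →
        ∀ n : ℕ, KnotBraid.braidIndex K ≤ (n : ℕ∞) → 3 ≤ KnotBraid.reducedLength n K) := by
  -- Both parts rest on this dichotomy, applied to a word of minimal length.
  have key : ∀ n : ℕ, KnotBraid.braidIndex K ≤ n →
      KnotBraid.reducedLength n K = 1 ∧ (KnotBraid.IsTrefoil K ∨ KnotBraid.IsFigureEight K) ∨
        3 ≤ KnotBraid.reducedLength n K := by
    intro n hn
    obtain ⟨w, hw, hl, hiso⟩ := KnotBraid.exists_word_minLength hK hn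
    rw [KnotBraid.reducedLength]
    rcases KnotBraid.length_of_isKnot hK hnontrivial hw hiso with ⟨h, h'⟩ | h
    · exact Or.inl ⟨by omega, h'⟩
    · exact Or.inr (by omega)
  refine ⟨⟨?_, ?_⟩, ?_⟩
  · rintro ⟨n, hn, h1⟩
    rcases key n hn with h | h
    · exact h.2
    · omega
  · rintro (⟨e, he⟩ | h)
    · have hw : KnotBraid.Represents (KnotBraid.trefoilWord e) K := he.symm
      exact ⟨2, KnotBraid.braidIndex_le hw,
        KnotBraid.reducedLength_eq_one hK hnontrivial hw rfl⟩
    · have hw : KnotBraid.Represents KnotBraid.figureEightWord K := h.symm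
      exact ⟨3, KnotBraid.braidIndex_le hw,
        KnotBraid.reducedLength_eq_one hK hnontrivial hw rfl⟩
  · intro hne n hn
    rcases key n hn with h | h
    · exact absurd h.2 hne
    · exact h
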